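/- Let $(M,g)$ be a smooth spacetime, i.e. a smooth Hausdorff second countable $d$-manifold with a smooth Lorentzian metric of signature $(-,+,\dots,+)$, time-oriented by a continuous timelike vector field. Causal curves are future-directed, piecewise $C^1$, with nonzero timelike or null velocity, and defined on an interval; such a curve is inextendible if it has neither a past nor a future end point in $M$. For $S\subseteq M$, the sets $J^{\pm}(S)\supseteq S$ are the causal future and past of $S$, and $D(S)$ is the set of points $p$ such that every inextendible causal curve through $p$ meets $S$. A time function is a $C^1$ function $T:M\to\mathbb{R}$ that strictly increases along every future-directed causal curve; a timeslice is a level set of a time function. A set $\Sigma'$ is a Cauchy evolution of $\Sigma$ forward in time within $U$ if $$D(\Sigma')=D(\Sigma),\qquad \Sigma'\subseteq J^+(\Sigma),\qquad \Sigma\subseteq J^-(\Sigma'),\qquad \Sigma\,\Delta\,\Sigma'\subseteq U,\qquad \bigl(J^+(\Sigma)\cap J^-(\Sigma')\bigr)\setminus\Sigma\subseteq U .$$ **Proposition (Timeslices can be deformed).** Let $k\in\{1,2,\dots,\infty\}$, let $\Sigma\subseteq M$ be a timeslice that is a level set of a time function of class $C^k$, let $X\subseteq\Sigma$ be compact and let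 $U\supseteq X$ be open in $M$. Then there exists a timeslice $\Sigma'$, again a level set of a time function of class $C^k$, such that $\Sigma'$ is a Cauchy evolution of $\Sigma$ forward in time within $U$ and $$\Sigma'\cap\Sigma\cap X=\varnothing .$$ -/

import Mathlib

open Set Topology
open scoped Manifold ContDiff

namespace Spacetime

section

variable {d : ℕ} {M : Type*} [TopologicalSpace M] [ChartedSpace (EuclideanSpace ℝ (Fin d)) M]

/-- A smooth Lorentzian metric of signature `(-, +, …, +)` on a smooth `d`-manifold: a smooth
field of symmetric bilinear forms on the tangent spaces such that at each point some vector `v`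
satisfies `g(v, v) < 0` and `g` is positive definite on the orthogonal complement of `v`. -/
structure LorentzianMetric (d : ℕ) (M : Type*) [TopologicalSpace M]
    [ChartedSpace (EuclideanSpace ℝ (Fin d)) M] [IsManifold (𝓡 d) ∞ M] where
  /-- the bilinear form on the tangent space at `x` -/
  form (x : M) : TangentSpace (𝓡 d) x →L[ℝ] TangentSpace (𝓡 d) x →L[ℝ] ℝ
  symm (x : M) (v w : TangentSpace (𝓡 d) x) : form x v w = form x w v
  signature (x : M) : ∃ v : TangentSpace (𝓡 d) x, form x v v < 0 ∧
    ∀ w : TangentSpace (𝓡 d) x, form x v w = 0 → w ≠ 0 → 0 < form x w w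
  contMDiff : ContMDiff (𝓡 d)
    ((𝓡 d).prod 𝓘(ℝ, EuclideanSpace ℝ (Fin d) →L[ℝ] EuclideanSpace ℝ (Fin d) →L[ℝ] ℝ)) ∞
    (fun x : M ↦ Bundle.TotalSpace.mk'
      (EuclideanSpace ℝ (Fin d) →L[ℝ] EuclideanSpace ℝ (Fin d) →L[ℝ] ℝ)
      (E := fun x : M ↦ TangentSpace (𝓡 d) x →L[ℝ] TangentSpace (𝓡 d) x →L[ℝ] ℝ) x (form x))

variable [IsManifold (𝓡 d) ∞ M]

/-- A time orientation: a continuous timelike vector field, which points to the future. -/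
structure TimeOrientation (g : LorentzianMetric d M) where
  /-- the value at `x` of the vector field -/
  field (x : M) : TangentSpace (𝓡 d) x
  timelike (x : M) : g.form x (field x) (field x) < 0
  continuous : Continuous (fun x : M ↦ (⟨x, field x⟩ : TangentBundle (𝓡 d) M))

variable {g : LorentzianMetric d M} (τ : TimeOrientation g)

/-- `v` is a future-directed causal (timelike or null, nonzero) tangent vector. -/
def IsFutureCausal {x : M} (v : TangentSpace (𝓡 d) x) : Prop :=
  v ≠ 0 ∧ g.form x v v ≤ 0 ∧ g.form x v (τ.field x) < 0

/-- `γ` is `C¹` on `[a, b]` with future-directed causal velocity (one-sided at the end points). -/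
def IsC1CausalOn (γ : ℝ → M) (a b : ℝ) : Prop :=
  ContMDiffOn 𝓘(ℝ, ℝ) (𝓡 d) 1 γ (Icc a b) ∧
    ∀ s ∈ Icc a b,
      IsFutureCausal τ (mfderivWithin 𝓘(ℝ, ℝ) (𝓡 d) γ (Icc a b) s (1 : ℝ) :
        TangentSpace (𝓡 d) (γ s))

/-- `γ`, restricted to the interval `I`, is a future-directed, piecewise `C¹` causal curve:
every parameter `t ∈ I` which is not the maximum of `I` is the left end of a subinterval of `I` on
which `γ` is a `C¹` future-directed causal curve, and symmetrically on the left. (Hence the break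
points form a locally finite subset of `I`.) -/
structure IsCausalCurveOn (γ : ℝ → M) (I : Set ℝ) : Prop where
  ordConnected : I.OrdConnected
  right : ∀ t ∈ I, ∀ u ∈ I, t < u → ∃ b ∈ Ioc t u, IsC1CausalOn τ γ t b
  left : ∀ t ∈ I, ∀ u ∈ I, u < t → ∃ a ∈ Ico u t, IsC1CausalOn τ γ a t

/-- `p` is a future end point of the curve `γ` on `I`. -/
def IsFutureEndpoint (γ : ℝ → M) (I : Set ℝ) (p : M) : Prop :=
  ∀ V ∈ 𝓝 p, ∃ t₀ ∈ I, ∀ t ∈ I, t₀ ≤ t → γ t ∈ V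

/-- `p` is a past end point of the curve `γ` on `I`. -/
def IsPastEndpoint (γ : ℝ → M) (I : Set ℝ) (p : M) : Prop :=
  ∀ V ∈ 𝓝 p, ∃ t₀ ∈ I, ∀ t ∈ I, t ≤ t₀ → γ t ∈ V

/-- An inextendible causal curve: it has neither a future nor a past end point. -/
def IsInextendibleCausalCurve (γ : ℝ → M) (I : Set ℝ) : Prop :=
  IsCausalCurveOn τ γ I ∧ ∀ p : M, ¬ IsFutureEndpoint γ I p ∧ ¬ IsPastEndpoint γ I p

/-- The causal future `J⁺(S)`, which contains `S`. -/
def causalFuture (S : Set M) : Set M :=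
  {q | ∃ p ∈ S, p = q ∨ ∃ (γ : ℝ → M) (a b : ℝ), a < b ∧ IsCausalCurveOn τ γ (Icc a b) ∧
    γ a = p ∧ γ b = q}

/-- The causal past `J⁻(S)`, which contains `S`. -/
def causalPast (S : Set M) : Set M :=
  {q | ∃ p ∈ S, q = p ∨ ∃ (γ : ℝ → M) (a b : ℝ), a < b ∧ IsCausalCurveOn τ γ (Icc a b) ∧
    γ a = q ∧ γ b = p}

/-- The domain of dependence `D(S)`: the points `p` such that every inextendible causal curve
through `p` meets `S`. -/
def domainOfDependence (S : Set M) : Set M :=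
  {p | ∀ (γ : ℝ → M) (I : Set ℝ), IsInextendibleCausalCurve τ γ I → p ∈ γ '' I →
    (γ '' I ∩ S).Nonempty}

/-- A time function: a `C¹` function which strictly increases along every future-directed causal
curve. -/
structure IsTimeFunction (T : M → ℝ) : Prop where
  contMDiff : ContMDiff (𝓡 d) 𝓘(ℝ, ℝ) 1 T
  strictMonoOn : ∀ (γ : ℝ → M) (I : Set ℝ), IsCausalCurveOn τ γ I → StrictMonoOn (T ∘ γ) I

/-- `S` is a level set of a time function of class `C^k`. For `k = 1` this says that `S` is a
timeslice; larger `k` records the smoothness of a corresponding time function. -/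
def IsTimeslice (k : ℕ∞) (S : Set M) : Prop :=
  ∃ (T : M → ℝ) (c : ℝ), IsTimeFunction τ T ∧ ContMDiff (𝓡 d) 𝓘(ℝ, ℝ) k T ∧ S = T ⁻¹' {c}

/-- `S'` is a Cauchy evolution of `S` forward in time within `U`: the two sets have the same domain
of dependence, `S'` lies in the future of `S`, and both the places where they differ and
the region between them lie in `U`. -/
structure IsForwardCauchyEvolution (U S S' : Set M) : Prop where
  domain : domainOfDependence τ S' = domainOfDependence τ S
  future : S' ⊆ causalFuture τ S
  past : S ⊆ causalPast τ S'
  differ : symmDiff S S' ⊆ U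
  between : (causalFuture τ S ∩ causalPast τ S') \ S ⊆ U

end

end Spacetime

/-!
A time function `T` increases along piecewise `C¹` causal curves, but its gradient may degenerate.
Hence an arbitrary lowering of `T` near a point `p` of the zero level set need not be a time
function. Instead `T` is glued near `p` to a smooth function `h` that increases along the causal
cones, is negative at `p`, and exceeds `T` on a shell around `p`: then `T` is lowered only inside
the shell. By compactness of `X` finitely many such changes suffice. An inextendible causal curve
cannot stay in a compact coordinate ball, so none of them alters the domain of dependence.

The function `h` is a smoothed indicator of the complement of the `ε`-past of `p`: the points from
which `p` is reached by chains of small steps that are causal up to an error `ε`. It is greater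
than `T` on the shell provided that, for small `ε`, the `ε`-past of `p` meets the shell only where
`T` is bounded above by a negative constant. Otherwise such chains converge, as `ε` tends to `0`, to
a Lipschitz curve that is causal in the limit and along which `T` is constant. By strict convexity
of the cones, a gain of causality in the middle of a chord would let `T` increase, so the second
differences of this curve are `O(D ^ (5 / 4))` at scale `D`. Hence the curve is `C¹` and causal, and
`T` increases strictly along it, a contradiction.
-/

namespace Spacetime

open Filter Metric

/-! ### Weakly causal curves in a cone field -/

/-- A field of convex cones `{v | 0 ≤ f y v}` on a ball of a normed space, given by superadditive,
positively homogeneous functions `f y`, together with a linear form `l` which controls the norm on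
slightly wider cones, a vector `e` in the interior of all cones, a large constant `C` and a small
constant `κ`. The last field is a quantitative form of the strict convexity of the cones. It is the
local model of the causal cones of a spacetime, for which `f` involves a square root and is
therefore only Hölder continuous in `y`. -/
structure ConeField (E : Type*) [NormedAddCommGroup E] [NormedSpace ℝ E] (p : E) (R : ℝ) where
  f : E → E → ℝ
  l : E →L[ℝ] ℝ
  e : E
  C : ℝ
  κ : ℝ
  one_le_C : 1 ≤ C
  κ_pos : 0 < κ
  add_le : ∀ y ∈ ball p R, ∀ v w, f y v + f y w ≤ f y (v + w)
  smul : ∀ y ∈ ball p R, ∀ (c : ℝ) v, 0 ≤ c → f y (c • v) = c * f y v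
  holder : ∀ y ∈ ball p R, ∀ y' ∈ ball p R, ∀ v, |f y v - f y' v| ≤ C * √‖y - y'‖ * ‖v‖
  bound : ∀ y ∈ ball p R, ∀ v, |f y v| ≤ C * ‖v‖
  narrow : ∀ y ∈ ball p R, ∀ v, -(κ * ‖v‖) ≤ f y v → ‖v‖ ≤ C * l v
  interior : ∀ y ∈ ball p R, κ ≤ f y e
  strict : ∀ y ∈ ball p R, ∀ v w η, 0 ≤ η → l v = l w → -η ≤ f y v → -η ≤ f y w →
    f y (v + w) ≤ η → ‖v - w‖ ^ 2 ≤ C * η * (‖v‖ + ‖w‖ + η)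

namespace ConeField

variable {E : Type*} [NormedAddCommGroup E] [NormedSpace ℝ E] {p : E} {R : ℝ}
  (F : ConeField E p R)

lemma C_pos : 0 < F.C := zero_lt_one.trans_le F.one_le_C

lemma f_zero {y : E} (hy : y ∈ ball p R) : F.f y 0 = 0 := by
  simpa using F.smul y hy 0 0 le_rfl

lemma e_ne_zero (hR : 0 < R) : F.e ≠ 0 := fun he ↦ by
  have pos := F.κ_pos.trans_le (F.interior p (mem_ball_self hR))
  rw [he, F.f_zero (mem_ball_self hR)] at pos
  exact pos.false

lemma abs_f_sub_f_le {y : E} (hy : y ∈ ball p R) (v w : E) :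
    |F.f y v - F.f y w| ≤ F.C * ‖v - w‖ := by
  have f_sub_le : ∀ v w, F.f y w - F.f y v ≤ F.C * ‖v - w‖ := fun v w ↦ by
    have superadditive := F.add_le y hy w (v - w)
    have lower := (abs_le.1 (F.bound y hy (v - w))).1
    rw [add_sub_cancel] at superadditive
    linarith
  refine abs_sub_le_iff.2 ⟨?_, f_sub_le v w⟩
  rw [norm_sub_rev]
  exact f_sub_le w v

lemma tendsto_f {α : Type*} {u : Filter α} {a b : α → E} {y v : E} (ha : Tendsto a u (𝓝 y))
    (hb : Tendsto b u (𝓝 v)) (hy : y ∈ ball p R) :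
    Tendsto (fun i ↦ F.f (a i) (b i)) u (𝓝 (F.f y v)) := by
  rw [tendsto_iff_norm_sub_tendsto_zero]
  have lim : Tendsto (fun i ↦ F.C * √‖a i - y‖ * ‖b i‖ + F.C * ‖b i - v‖) u (𝓝 0) := by
    have base := (tendsto_iff_norm_sub_tendsto_zero.1 ha).sqrt.const_mul F.C
    have vector := (tendsto_iff_norm_sub_tendsto_zero.1 hb).const_mul F.C
    simpa using (base.mul hb.norm).add vector
  refine squeeze_zero' (Eventually.of_forall fun _ ↦ norm_nonneg _) ?_ lim
  filter_upwards [ha.eventually (isOpen_ball.mem_nhds hy)] with i hi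
  exact (abs_sub_le _ (F.f y (b i)) _).trans
    (add_le_add (F.holder _ hi y hy (b i)) (F.abs_f_sub_f_le hy (b i) v))

lemma norm_le_of_f_nonneg {y v : E} (hy : y ∈ ball p R) (hv : 0 ≤ F.f y v) : ‖v‖ ≤ F.C * F.l v :=
  F.narrow y hy v ((neg_nonpos.2 (mul_nonneg F.κ_pos.le (norm_nonneg _))).trans hv)

lemma l_nonneg_of_norm_le {v : E} (hv : ‖v‖ ≤ F.C * F.l v) : 0 ≤ F.l v :=
  nonneg_of_mul_nonneg_right ((norm_nonneg _).trans hv) F.C_pos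

/-- The Hölder bound for the change of `f` along a curve of duration `D` and speed at most `C`,
evaluated at the displacement of the curve. -/
noncomputable def defect (D : ℝ) : ℝ := F.C * √(F.C * D) * (F.C * D)

lemma defect_eq (D : ℝ) : F.defect D = F.C * √F.C * F.C * (D * √D) := by
  rw [defect, Real.sqrt_mul F.C_pos.le]; ring

lemma defect_pos {D : ℝ} (hD : 0 < D) : 0 < F.defect D := by
  have := F.C_pos
  unfold defect; positivity

lemma defect_nonneg {D : ℝ} (hD : 0 ≤ D) : 0 ≤ F.defect D := by
  have := F.C_pos
  unfold defect; positivity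

lemma defect_mono {D D' : ℝ} (hD : 0 ≤ D) (h : D ≤ D') : F.defect D ≤ F.defect D' := by
  have := F.C_pos
  unfold defect; gcongr

lemma continuous_defect : Continuous F.defect := by
  unfold defect; fun_prop

lemma abs_f_sub_f_le_defect {y z w : E} {D : ℝ} (hy : y ∈ ball p R) (hz : z ∈ ball p R)
    (hyz : ‖y - z‖ ≤ F.C * D) (hw : ‖w‖ ≤ F.C * D) : |F.f y w - F.f z w| ≤ F.defect D := by
  have := F.C_pos
  refine (F.holder y hy z hz w).trans ?_
  unfold defect; gcongr

/-- The step relation of chains in the ball of radius `r` with mesh `ε`, whose steps are causal up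
to an error `ε`. -/
structure Step (r ε : ℝ) (a b : E) : Prop where
  mem_ball : a ∈ ball p r
  norm_lt : ‖b - a‖ < ε
  lt_f : -(ε * ‖b - a‖) < F.f a (b - a)

/-- An almost causal chain of `N` steps which ends in the ball of radius `ε`. -/
structure IsChain (r ε : ℝ) (c : ℕ → E) (N : ℕ) : Prop where
  mem_ball : c N ∈ ball p ε
  step : ∀ i < N, F.Step r ε (c i) (c (i + 1))

/-- The points from which an almost causal chain leads to the ball of radius `ε`. -/
def almostPast (r ε : ℝ) : Set E :=
  {q | ∃ (N : ℕ) (c : ℕ → E), c 0 = q ∧ F.IsChain r ε c N}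

lemma ball_subset_almostPast (r ε : ℝ) : ball p ε ⊆ F.almostPast r ε :=
  fun q hq ↦ ⟨0, fun _ ↦ q, rfl, hq, by simp⟩

lemma Step.mem_almostPast {r ε : ℝ} {a b : E} (h : F.Step r ε a b) (hb : b ∈ F.almostPast r ε) :
    a ∈ F.almostPast r ε := by
  obtain ⟨N, c, rfl, hN, hc⟩ := hb
  refine ⟨N + 1, fun i ↦ Nat.casesOn i a c, rfl, hN, ?_⟩
  rintro (_ | i) hi
  · exact h
  · exact hc i (by omega)

lemma mem_ball_or_exists_step_of_mem_almostPast {r ε : ℝ} {a : E} (h : a ∈ F.almostPast r ε) :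
    a ∈ ball p ε ∨ ∃ b ∈ F.almostPast r ε, F.Step r ε a b := by
  obtain ⟨N, c, rfl, hN, hc⟩ := h
  rcases N with _ | N
  · exact Or.inl hN
  · exact Or.inr ⟨c 1, ⟨N, fun i ↦ c (i + 1), rfl, hN, fun i hi ↦ hc (i + 1) (by omega)⟩,
      hc 0 (by omega)⟩

lemma isOpen_almostPast {r ε : ℝ} (hr : r ≤ R) : IsOpen (F.almostPast r ε) := by
  rw [isOpen_iff_mem_nhds]
  intro a ha
  rcases F.mem_ball_or_exists_step_of_mem_almostPast ha with h | ⟨b, hb, hab⟩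
  · exact mem_of_superset (isOpen_ball.mem_nhds h) (F.ball_subset_almostPast r ε)
  · have hb' : Tendsto (fun x ↦ b - x) (𝓝 a) (𝓝 (b - a)) := tendsto_const_nhds.sub tendsto_id
    have mem : ∀ᶠ x in 𝓝 a, x ∈ ball p r := isOpen_ball.mem_nhds hab.mem_ball
    have short : ∀ᶠ x in 𝓝 a, ‖b - x‖ < ε := hb'.norm.eventually (gt_mem_nhds hab.norm_lt)
    have causal : ∀ᶠ x in 𝓝 a, -(ε * ‖b - x‖) < F.f x (b - x) :=
      ((hb'.norm.const_mul ε).neg).eventually_lt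
        (F.tendsto_f tendsto_id hb' (ball_subset_ball hr hab.mem_ball)) hab.lt_f
    filter_upwards [mem, short, causal] with x hx hbx hf
    exact Step.mem_almostPast F ⟨hx, hbx, hf⟩ hb

variable {F}

section chain

variable {r ε : ℝ} {N : ℕ} {c : ℕ → E}

lemma Step.norm_le (hr : r ≤ R) (hε : ε ≤ F.κ) {a b : E} (h : F.Step r ε a b) :
    ‖b - a‖ ≤ F.C * F.l (b - a) := by
  refine F.narrow a (ball_subset_ball hr h.mem_ball) _ (le_trans ?_ h.lt_f.le)
  exact neg_le_neg (mul_le_mul_of_nonneg_right hε (norm_nonneg _))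

lemma Step.le_f (hr : r ≤ R) (hε : ε ≤ F.κ) {a b : E} (h : F.Step r ε a b) {y : E} {ρ : ℝ}
    (hε0 : 0 ≤ ε) (hy : y ∈ ball p R) (hya : ‖y - a‖ ≤ ρ) :
    -((ε + F.C * √ρ) * (F.C * F.l (b - a))) ≤ F.f y (b - a) := by
  have hC := F.C_pos
  have turn := (abs_le.1 (F.holder y hy a (ball_subset_ball hr h.mem_ball) (b - a))).1
  have error : (ε + F.C * √‖y - a‖) * ‖b - a‖ ≤ (ε + F.C * √ρ) * (F.C * F.l (b - a)) := by
    gcongr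
    exact h.norm_le hr hε
  linarith [h.lt_f]

lemma IsChain.norm_sub_le (hc : F.IsChain r ε c N) (hr : r ≤ R) (hε : ε ≤ F.κ) {i j : ℕ}
    (hij : i ≤ j) (hj : j ≤ N) : ‖c j - c i‖ ≤ F.C * F.l (c j - c i) := by
  induction j, hij using Nat.le_induction with
  | base => simp
  | succ j _ ih =>
    have last := (hc.step j (by omega)).norm_le hr hε
    rw [← sub_add_sub_cancel _ (c j), map_add, mul_add]
    exact (norm_add_le _ _).trans (add_le_add last (ih (by omega)))

lemma IsChain.mem (hc : F.IsChain r ε c N) (hεr : ε ≤ r) {i : ℕ} (hi : i ≤ N) :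
    c i ∈ ball p r := by
  rcases hi.eq_or_lt with rfl | h
  · exact ball_subset_ball hεr hc.mem_ball
  · exact (hc.step i h).mem_ball

lemma IsChain.le_f (hc : F.IsChain r ε c N) (hr : r ≤ R) (hε : ε ≤ F.κ) (hε0 : 0 ≤ ε)
    (hεr : ε ≤ r) {i j : ℕ} (hij : i ≤ j) (hj : j ≤ N) :
    -(ε * (F.C * F.l (c j - c i)) + F.defect (F.l (c j - c i))) ≤ F.f (c i) (c j - c i) := by
  have hi : c i ∈ ball p R := ball_subset_ball hr (hc.mem hεr (hij.trans hj))
  rw [defect, ← add_mul]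
  set ρ := F.C * F.l (c j - c i)
  suffices H : ∀ m, i ≤ m → m ≤ j →
      -((ε + F.C * √ρ) * (F.C * F.l (c m - c i))) ≤ F.f (c i) (c m - c i) from H j hij le_rfl
  intro m him
  induction m, him using Nat.le_induction with
  | base => intro _; simp [F.f_zero hi]
  | succ m him ih =>
    intro hmj
    have near : ‖c i - c m‖ ≤ ρ := by
      rw [norm_sub_rev]
      refine (hc.norm_sub_le hr hε him (by omega)).trans
        (mul_le_mul_of_nonneg_left ?_ F.C_pos.le)
      have := F.l_nonneg_of_norm_le (hc.norm_sub_le hr hε (i := m) (j := j) (by omega) hj)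
      rw [map_sub] at this ⊢
      rw [map_sub]; linarith
    have last := (hc.step m (by omega)).le_f hr hε hε0 hi near
    have superadditive := F.add_le _ hi (c (m + 1) - c m) (c m - c i)
    rw [← sub_add_sub_cancel (c (m + 1)) (c m) (c i), map_add, mul_add, mul_add]
    linarith [ih (by omega)]

end chain

/-- An almost causal chain from `q` to `b`, seen as a step function of the time `l`, which is
stationary before and after the chain. -/
structure IsStepCurve (F : ConeField E p R) (r ε : ℝ) (q b : E) (g : ℝ → E) : Prop where
  start_mem : q ∈ ball p r
  end_mem : b ∈ ball p ε
  mem_ball : ∀ s, g s ∈ ball p r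
  norm_sub_le : ∀ s s', s ≤ s' → ‖g s' - g s‖ ≤ F.C * F.l (g s' - g s)
  le_f : ∀ s s', s ≤ s' →
    -(ε * (F.C * F.l (g s' - g s)) + F.defect (F.l (g s' - g s))) ≤ F.f (g s) (g s' - g s)
  norm_sub_start_le : ∀ s, ‖g s - q‖ ≤ F.C * F.l (g s - q)
  norm_end_sub_le : ∀ s, ‖b - g s‖ ≤ F.C * F.l (b - g s)
  l_sub_start_le : ∀ s, 0 ≤ s → F.l (g s - q) ≤ s
  le_l_sub_start : ∀ s, 0 ≤ s → min s (F.l (b - q)) - ‖F.l‖ * ε ≤ F.l (g s - q)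

lemma exists_isStepCurve_of_mem_almostPast {r ε : ℝ} {q : E} (hr : r ≤ R) (hε : ε ≤ F.κ)
    (hε0 : 0 ≤ ε) (hεr : ε ≤ r) (hq : q ∈ F.almostPast r ε) :
    ∃ b g, F.IsStepCurve r ε q b g := by
  classical
  obtain ⟨N, c, rfl, hc⟩ := hq
  set i : ℝ → ℕ := fun s ↦ Nat.findGreatest (fun i ↦ F.l (c i - c 0) ≤ s) N
  have i_le : ∀ s, i s ≤ N := fun s ↦ Nat.findGreatest_le N
  have i_mono : ∀ s s', s ≤ s' → i s ≤ i s' := fun s s' h ↦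
    Nat.findGreatest_mono (fun _ h' ↦ le_trans h' h) le_rfl
  refine ⟨c N, fun s ↦ c (i s),
    { start_mem := hc.mem hεr (Nat.zero_le N)
      end_mem := hc.mem_ball
      mem_ball := fun s ↦ hc.mem hεr (i_le s)
      norm_sub_le := fun s s' h ↦ hc.norm_sub_le hr hε (i_mono s s' h) (i_le s')
      le_f := fun s s' h ↦ hc.le_f hr hε hε0 hεr (i_mono s s' h) (i_le s')
      norm_sub_start_le := fun s ↦ hc.norm_sub_le hr hε (Nat.zero_le _) (i_le s)
      norm_end_sub_le := fun s ↦ hc.norm_sub_le hr hε (i_le s) le_rfl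
      l_sub_start_le := fun s hs ↦ ?_
      le_l_sub_start := fun s _ ↦ ?_ }⟩
  · exact Nat.findGreatest_spec (P := fun i ↦ F.l (c i - c 0) ≤ s) (m := 0) (Nat.zero_le N)
      (by simpa using hs)
  · rcases (i_le s).eq_or_lt with h | h
    · have : 0 ≤ ‖F.l‖ * ε := by positivity
      simp only [h]
      linarith [min_le_right s (F.l (c N - c 0))]
    · have next_late : ¬ F.l (c (i s + 1) - c 0) ≤ s :=
        Nat.findGreatest_is_greatest (P := fun i ↦ F.l (c i - c 0) ≤ s) (Nat.lt_succ_self _) h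
      have step_short : F.l (c (i s + 1) - c (i s)) ≤ ‖F.l‖ * ε :=
        (le_abs_self _).trans ((F.l.le_opNorm _).trans
          (mul_le_mul_of_nonneg_left (hc.step _ h).norm_lt.le (norm_nonneg _)))
      have := min_le_left s (F.l (c N - c 0))
      simp only [map_sub] at *
      linarith

/-- A curve on `[0, a]`, parametrized by `l`, which is causal in an integrated sense. Limits of
almost causal chains have this property, but need not be differentiable a priori. -/
structure IsWeaklyCausal (F : ConeField E p R) (γ : ℝ → E) (a : ℝ) : Prop where
  l_sub : ∀ s s', 0 ≤ s → s ≤ s' → s' ≤ a → F.l (γ s' - γ s) = s' - s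
  norm_sub_le : ∀ s s', 0 ≤ s → s ≤ s' → s' ≤ a → ‖γ s' - γ s‖ ≤ F.C * (s' - s)
  le_f : ∀ s s', 0 ≤ s → s ≤ s' → s' ≤ a → -F.defect (s' - s) ≤ F.f (γ s) (γ s' - γ s)

section limit

variable {ι : Type*} {u : Filter ι} {r : ℝ} {ε : ι → ℝ} {q b : ι → E} {g : ι → ℝ → E}
  {q₀ : E} {γ : ℝ → E}

lemma tendsto_l_sub {x y : ι → E} {x₀ y₀ : E} (hx : Tendsto x u (𝓝 x₀)) (hy : Tendsto y u (𝓝 y₀)) :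
    Tendsto (fun n ↦ F.l (x n - y n)) u (𝓝 (F.l (x₀ - y₀))) :=
  (F.l.continuous.tendsto _).comp (hx.sub hy)

lemma norm_sub_le_of_tendsto [NeBot u] {x y : ι → E} {x₀ y₀ : E} (hx : Tendsto x u (𝓝 x₀))
    (hy : Tendsto y u (𝓝 y₀)) (h : ∀ n, ‖x n - y n‖ ≤ F.C * F.l (x n - y n)) :
    ‖x₀ - y₀‖ ≤ F.C * F.l (x₀ - y₀) :=
  le_of_tendsto_of_tendsto (hx.sub hy).norm ((tendsto_l_sub hx hy).const_mul _)
    (Eventually.of_forall h)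

lemma eq_of_norm_sub_le_of_l_sub_eq_zero {x y : E} (h : ‖x - y‖ ≤ F.C * F.l (x - y))
    (hl : F.l (x - y) = 0) : x = y := by
  rw [hl, mul_zero] at h
  exact sub_eq_zero.1 (norm_le_zero_iff.1 h)

lemma IsStepCurve.norm_end_sub_start_le {ε : ℝ} {q b : E} {g : ℝ → E}
    (hg : F.IsStepCurve r ε q b g) : ‖b - q‖ ≤ F.C * F.l (b - q) := by
  rw [← sub_add_sub_cancel _ (g 0), map_add, mul_add]
  exact (norm_add_le _ _).trans (add_le_add (hg.norm_end_sub_le 0) (hg.norm_sub_start_le 0))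

lemma IsStepCurve.tendsto_end (hg : ∀ n, F.IsStepCurve r (ε n) (q n) (b n) (g n))
    (hε : Tendsto ε u (𝓝 0)) : Tendsto b u (𝓝 p) := by
  rw [tendsto_iff_norm_sub_tendsto_zero]
  exact squeeze_zero (fun _ ↦ norm_nonneg _)
    (fun n ↦ (mem_ball_iff_norm.1 (hg n).end_mem).le) hε

lemma IsStepCurve.l_sub_start_of_tendsto [NeBot u]
    (hg : ∀ n, F.IsStepCurve r (ε n) (q n) (b n) (g n)) (hε : Tendsto ε u (𝓝 0))
    (hq : Tendsto q u (𝓝 q₀)) (hγ : ∀ s, Tendsto (fun n ↦ g n s) u (𝓝 (γ s))) {s : ℝ}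
    (hs : 0 ≤ s) (hs' : s ≤ F.l (p - q₀)) : F.l (γ s - q₀) = s := by
  apply le_antisymm
  · exact le_of_tendsto (tendsto_l_sub (hγ s) hq)
      (Eventually.of_forall fun n ↦ (hg n).l_sub_start_le s hs)
  · have lower : Tendsto (fun n ↦ min s (F.l (b n - q n)) - ‖F.l‖ * ε n) u
        (𝓝 (min s (F.l (p - q₀)) - ‖F.l‖ * 0)) :=
      (tendsto_const_nhds.min (tendsto_l_sub (tendsto_end hg hε) hq)).sub (hε.const_mul _)
    have := le_of_tendsto_of_tendsto lower (tendsto_l_sub (hγ s) hq)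
      (Eventually.of_forall fun n ↦ (hg n).le_l_sub_start s hs)
    rwa [min_eq_left hs', mul_zero, sub_zero] at this

lemma IsStepCurve.isWeaklyCausal_of_tendsto [NeBot u]
    (hg : ∀ n, F.IsStepCurve r (ε n) (q n) (b n) (g n)) (hε : Tendsto ε u (𝓝 0))
    (hq : Tendsto q u (𝓝 q₀)) (hγ : ∀ s, Tendsto (fun n ↦ g n s) u (𝓝 (γ s)))
    (hγR : ∀ s, γ s ∈ ball p R) : F.IsWeaklyCausal γ (F.l (p - q₀)) := by
  have l_sub : ∀ s s', 0 ≤ s → s ≤ s' → s' ≤ F.l (p - q₀) → F.l (γ s' - γ s) = s' - s := by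
    intro s s' hs hss hs'
    rw [← sub_sub_sub_cancel_right _ _ q₀, map_sub,
      l_sub_start_of_tendsto hg hε hq hγ (hs.trans hss) hs',
      l_sub_start_of_tendsto hg hε hq hγ hs (hss.trans hs')]
  refine ⟨l_sub, fun s s' hs hss hs' ↦ ?_, fun s s' hs hss hs' ↦ ?_⟩
  · rw [← l_sub s s' hs hss hs']
    exact norm_sub_le_of_tendsto (hγ s') (hγ s) fun n ↦ (hg n).norm_sub_le s s' hss
  · rw [← l_sub s s' hs hss hs']
    have lim := tendsto_l_sub (F := F) (hγ s') (hγ s)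
    have lower : Tendsto (fun n ↦ -(ε n * (F.C * F.l (g n s' - g n s)) +
        F.defect (F.l (g n s' - g n s)))) u (𝓝 (-F.defect (F.l (γ s' - γ s)))) := by
      simpa using ((hε.mul (lim.const_mul F.C)).add
        ((F.continuous_defect.tendsto _).comp lim)).neg
    exact le_of_tendsto_of_tendsto lower (F.tendsto_f (hγ s) ((hγ s').sub (hγ s)) (hγR s))
      (Eventually.of_forall fun n ↦ (hg n).le_f s s' hss)

end limit

lemma exists_tendsto_isStepCurve [ProperSpace E] {r : ℝ} {ε : ℕ → ℝ} {q b : ℕ → E}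
    {g : ℕ → ℝ → E} (hg : ∀ n, F.IsStepCurve r (ε n) (q n) (b n) (g n)) :
    ∃ u : Ultrafilter ℕ, (u : Filter ℕ) ≤ atTop ∧ ∃ q₀ ∈ closedBall p r, Tendsto q u (𝓝 q₀) ∧
      ∃ γ : ℝ → E, ∀ s, γ s ∈ closedBall p r ∧ Tendsto (fun n ↦ g n s) u (𝓝 (γ s)) := by
  have compact : ∀ x : ℕ → E, (∀ n, x n ∈ closedBall p r) →
      ∃ y ∈ closedBall p r, Tendsto x (hyperfilter ℕ) (𝓝 y) := fun x hx ↦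
    (isCompact_closedBall p r).ultrafilter_le_nhds ((hyperfilter ℕ).map x)
      (tendsto_principal.2 (Eventually.of_forall hx))
  obtain ⟨q₀, hq₀, hq⟩ := compact q fun n ↦ ball_subset_closedBall (hg n).start_mem
  choose γ hγ hgγ using fun s ↦
    compact (fun n ↦ g n s) fun n ↦ ball_subset_closedBall ((hg n).mem_ball s)
  exact ⟨hyperfilter ℕ, Nat.hyperfilter_le_atTop, q₀, hq₀, hq, γ, fun s ↦ ⟨hγ s, hgγ s⟩⟩

lemma exists_isWeaklyCausal_of_almostPast [ProperSpace E] {r : ℝ} (hr0 : 0 < r) (hr : r < R)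
    {T : E → ℝ} (hT : ContinuousOn T (ball p R))
    (H : ∀ ε > 0, ∃ q ∈ F.almostPast r ε, r / 2 ≤ ‖q - p‖ ∧ -ε ≤ T q) :
    ∃ (γ : ℝ → E) (a : ℝ), 0 < a ∧ F.IsWeaklyCausal γ a ∧ (∀ s, γ s ∈ closedBall p r) ∧
      γ a = p ∧ 0 ≤ T (γ 0) := by
  have closedBall_sub : closedBall p r ⊆ ball p R := closedBall_subset_ball hr
  have δ_pos : 0 < min F.κ r := lt_min F.κ_pos hr0
  set ε : ℕ → ℝ := fun n ↦ min F.κ r / (n + 1 : ℕ)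
  have ε_pos : ∀ n, 0 < ε n := fun n ↦ by positivity
  have ε_le : ∀ n, ε n ≤ min F.κ r := fun n ↦ div_le_self δ_pos.le (by simp)
  have ε_lim : Tendsto ε atTop (𝓝 0) :=
    (tendsto_const_div_atTop_nhds_zero_nat _).comp (tendsto_add_atTop_nat 1)
  choose q hq hqp hqT using fun n ↦ H (ε n) (ε_pos n)
  choose b g hg using fun n ↦ exists_isStepCurve_of_mem_almostPast hr.le
    ((ε_le n).trans (min_le_left _ _)) (ε_pos n).le ((ε_le n).trans (min_le_right _ _)) (hq n)
  obtain ⟨u, hu, q₀, hq₀, hqlim, γ, hγ⟩ := exists_tendsto_isStepCurve hg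
  have ε_lim := ε_lim.mono_left hu
  have hblim := IsStepCurve.tendsto_end hg ε_lim
  have l_sub_start := fun {s} ↦
    IsStepCurve.l_sub_start_of_tendsto (s := s) hg ε_lim hqlim fun s ↦ (hγ s).2
  have duration_pos : 0 < F.l (p - q₀) := by
    have far : r / 2 ≤ ‖p - q₀‖ := by
      rw [norm_sub_rev]
      exact ge_of_tendsto (hqlim.sub_const p).norm (Eventually.of_forall hqp)
    exact pos_of_mul_pos_right ((half_pos hr0).trans_le (far.trans
      (norm_sub_le_of_tendsto hblim hqlim fun n ↦ (hg n).norm_end_sub_start_le))) F.C_pos.le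
  refine ⟨γ, F.l (p - q₀), duration_pos, IsStepCurve.isWeaklyCausal_of_tendsto hg ε_lim hqlim
    (fun s ↦ (hγ s).2) fun s ↦ closedBall_sub (hγ s).1, fun s ↦ (hγ s).1, Eq.symm ?_, ?_⟩
  · refine eq_of_norm_sub_le_of_l_sub_eq_zero
      (norm_sub_le_of_tendsto hblim (hγ _).2 fun n ↦ (hg n).norm_end_sub_le _) ?_
    rw [← sub_sub_sub_cancel_right _ _ q₀, map_sub, l_sub_start duration_pos.le le_rfl, sub_self]
  · rw [eq_of_norm_sub_le_of_l_sub_eq_zero (norm_sub_le_of_tendsto (hγ 0).2 hqlim fun n ↦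
      (hg n).norm_sub_start_le 0) (l_sub_start le_rfl duration_pos.le)]
    have T_lim := (hT.continuousAt (isOpen_ball.mem_nhds (closedBall_sub hq₀))).tendsto.comp hqlim
    simpa using le_of_tendsto_of_tendsto ε_lim.neg T_lim (Eventually.of_forall hqT)

end ConeField

section secondDifference

variable {E : Type*} [NormedAddCommGroup E]

lemma exists_tendstoUniformlyOn_of_norm_sub_le [CompleteSpace E] {α : Type*} {f : ℕ → α → E}
    {s : Set α} {u : ℕ → ℝ} (hu : Summable u) (h : ∀ n, ∀ x ∈ s, ‖f (n + 1) x - f n x‖ ≤ u n) :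
    ∃ G : α → E, TendstoUniformlyOn f G atTop s := by
  refine ⟨fun x ↦ f 0 x + ∑' n, (f (n + 1) x - f n x), ?_⟩
  have partial_sums := tendstoUniformlyOn_tsum_nat hu h
  rw [Metric.tendstoUniformlyOn_iff] at partial_sums ⊢
  intro ε hε
  filter_upwards [partial_sums ε hε] with n hn x hx
  have := hn x hx
  rwa [Finset.sum_range_sub (fun n ↦ f n x), ← dist_add_left (f 0 x), add_sub_cancel] at this

variable [NormedSpace ℝ E]

lemma inv_half_smul_sub_inv_smul {D : ℝ} (x y z : E) :
    (D / 2)⁻¹ • (y - x) - D⁻¹ • (z - x) = D⁻¹ • ((y - x) - (z - y)) := by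
  rw [inv_div, div_eq_mul_inv]; module

variable [CompleteSpace E]

-- The slopes of `c` are the derivatives of the slopes of its primitive, which converge to `c`.
lemma hasDerivAt_of_tendstoUniformlyOn_slope {c G : ℝ → E} (hc : Continuous c) {d : ℕ → ℝ}
    (hd : Tendsto d atTop (𝓝[≠] 0)) {U : Set ℝ} (hU : IsOpen U)
    (h : TendstoUniformlyOn (fun n s ↦ (d n)⁻¹ • (c (s + d n) - c s)) G atTop U) {s : ℝ}
    (hs : s ∈ U) : HasDerivAt c (G s) s := by
  set P : ℝ → E := fun s ↦ ∫ x in (0 : ℝ)..s, c x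
  have hP : ∀ s, HasDerivAt P (c s) s := fun s ↦
    intervalIntegral.integral_hasDerivAt_right (hc.intervalIntegrable _ _)
      hc.aestronglyMeasurable.stronglyMeasurableAtFilter hc.continuousAt
  refine hasDerivAt_of_tendstoUniformlyOn (f := fun n s ↦ (d n)⁻¹ • (P (s + d n) - P s)) hU h
    (Eventually.of_forall fun n s _ ↦ ?_) (fun s _ ↦ ?_) hs
  · exact (((hP (s + d n)).comp_add_const s (d n)).sub (hP s)).const_smul _
  · exact (hasDerivAt_iff_tendsto_slope_zero.1 (hP s)).comp hd

lemma exists_continuousOn_hasDerivAt {γ : ℝ → E} {a : ℝ} (ha : 0 < a)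
    (hγ : ContinuousOn γ (Icc 0 a)) {η : ℝ → ℝ} (hη : Summable fun n : ℕ ↦ η (a / 2 * (1 / 2) ^ n))
    (h : ∀ s D, 0 ≤ s → 0 ≤ D → s + D ≤ a →
      ‖(γ (s + D / 2) - γ s) - (γ (s + D) - γ (s + D / 2))‖ ≤ D * η D) :
    ∃ G : ℝ → E, ContinuousOn G (Ioo 0 (a / 2)) ∧
      ∀ s ∈ Ioo 0 (a / 2), HasDerivAt γ (G s) s := by
  set c : ℝ → E := fun s ↦ γ (projIcc 0 a ha.le s) with hc
  have c_cont : Continuous c := hγ.domRestrict.comp continuous_projIcc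
  have c_eq : ∀ s ∈ Icc 0 a, c s = γ s := fun s hs ↦ by simp [hc, projIcc_of_mem ha.le hs]
  set d : ℕ → ℝ := fun n ↦ a / 2 * (1 / 2) ^ n with hd
  have d_pos : ∀ n, 0 < d n := fun n ↦ by positivity
  have d_le : ∀ n, d n ≤ a / 2 := fun n ↦
    mul_le_of_le_one_right (by positivity) (pow_le_one₀ (by norm_num) (by norm_num))
  have d_succ : ∀ n, d (n + 1) = d n / 2 := fun n ↦ by simp only [hd, pow_succ]; ring
  have d_lim : Tendsto d atTop (𝓝[≠] 0) := by
    refine tendsto_nhdsWithin_iff.2 ⟨?_, Eventually.of_forall fun n ↦ (d_pos n).ne'⟩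
    simpa only [mul_zero] using (tendsto_pow_atTop_nhds_zero_of_lt_one (r := (1 / 2 : ℝ))
      (by norm_num) (by norm_num)).const_mul (a / 2)
  have slope_sub_le : ∀ n, ∀ s ∈ Ioo 0 (a / 2), ‖(d (n + 1))⁻¹ • (c (s + d (n + 1)) - c s) -
      (d n)⁻¹ • (c (s + d n) - c s)‖ ≤ η (d n) := by
    intro n s hs
    have hn := d_pos n
    have hn' := d_le n
    rw [d_succ, inv_half_smul_sub_inv_smul, norm_smul, norm_inv, Real.norm_of_nonneg hn.le,
      inv_mul_le_iff₀ hn, c_eq s ⟨by linarith [hs.1], by linarith [hs.2]⟩,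
      c_eq (s + d n / 2) ⟨by linarith [hs.1], by linarith [hs.2]⟩,
      c_eq (s + d n) ⟨by linarith [hs.1], by linarith [hs.2]⟩]
    exact h s (d n) hs.1.le hn.le (by linarith [hs.2])
  obtain ⟨G, hG⟩ := exists_tendstoUniformlyOn_of_norm_sub_le
    (f := fun n s ↦ (d n)⁻¹ • (c (s + d n) - c s)) hη slope_sub_le
  refine ⟨G, hG.continuousOn (Frequently.of_forall fun n ↦ by fun_prop), fun s hs ↦
    (hasDerivAt_of_tendstoUniformlyOn_slope c_cont d_lim isOpen_Ioo hG
      hs).congr_of_eventuallyEq ?_⟩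
  filter_upwards [isOpen_Ioo.mem_nhds hs] with x hx
  exact (c_eq x ⟨hx.1.le, by linarith [hx.2]⟩).symm

end secondDifference

lemma sqrt_pow_eq_pow_sqrt {x : ℝ} (hx : 0 ≤ x) (n : ℕ) : √(x ^ n) = √x ^ n :=
  (Real.sqrt_eq_iff_mul_self_eq (by positivity) (by positivity)).2
    (by rw [← mul_pow, Real.mul_self_sqrt hx])

lemma summable_sqrt_sqrt_geometric {a : ℝ} (ha : 0 ≤ a) :
    Summable fun n : ℕ ↦ √√(a * (1 / 2) ^ n) := by
  have eq : ∀ n : ℕ, √√(a * (1 / 2) ^ n) = √√a * √√(1 / 2) ^ n := fun n ↦ by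
    rw [Real.sqrt_mul ha, Real.sqrt_mul (Real.sqrt_nonneg _), sqrt_pow_eq_pow_sqrt (by norm_num),
      sqrt_pow_eq_pow_sqrt (Real.sqrt_nonneg _)]
  simp only [eq]
  refine (summable_geometric_of_lt_one (Real.sqrt_nonneg _) ?_).mul_left _
  rw [Real.sqrt_lt' one_pos, Real.sqrt_lt' (by norm_num)]; norm_num

-- Summing over `n` equal pieces of an interval of length `D` gives a decrease of `D * η (D / n)`.
lemma le_of_sub_mul_le {φ η : ℝ → ℝ} {a δ : ℝ} (hδ : 0 < δ) (hη : Tendsto η (𝓝[>] 0) (𝓝 0))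
    (h : ∀ s s', 0 ≤ s → s ≤ s' → s' ≤ a → s' - s ≤ δ → φ s - (s' - s) * η (s' - s) ≤ φ s')
    {s s' : ℝ} (hs : 0 ≤ s) (hss : s ≤ s') (hs' : s' ≤ a) : φ s ≤ φ s' := by
  rcases hss.eq_or_lt with rfl | hss
  · exact le_rfl
  have D_pos : 0 < s' - s := sub_pos.2 hss
  have lim : Tendsto (fun n : ℕ ↦ (s' - s) / (n + 1 : ℕ)) atTop (𝓝 0) :=
    (tendsto_const_div_atTop_nhds_zero_nat (s' - s)).comp (tendsto_add_atTop_nat 1)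
  have lim_pos : Tendsto (fun n : ℕ ↦ (s' - s) / (n + 1 : ℕ)) atTop (𝓝[>] 0) :=
    tendsto_nhdsWithin_iff.2 ⟨lim, Eventually.of_forall fun n ↦ by
      simp only [mem_Ioi]; positivity⟩
  have subdivided : ∀ᶠ n : ℕ in atTop, φ s - (s' - s) * η ((s' - s) / (n + 1 : ℕ)) ≤ φ s' := by
    filter_upwards [lim.eventually (gt_mem_nhds hδ)] with n hn
    have hxn : ((n + 1 : ℕ) : ℝ) * ((s' - s) / (n + 1 : ℕ)) = s' - s := by field_simp
    have x_nonneg : 0 ≤ (s' - s) / (n + 1 : ℕ) := by positivity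
    generalize (s' - s) / (n + 1 : ℕ) = x at *
    have pieces : ∀ k : ℕ, k ≤ n + 1 → φ s - k * (x * η x) ≤ φ (s + k * x) := by
      intro k
      induction k with
      | zero => simp
      | succ k ih =>
        intro hk
        have end_le : ((k + 1 : ℕ) : ℝ) * x ≤ s' - s := by
          rw [← hxn]; gcongr
        push_cast at end_le ⊢
        have piece := h (s + k * x) (s + (k + 1) * x) (by positivity) (by nlinarith) (by linarith)
          (by linarith)
        rw [show s + (k + 1) * x - (s + k * x) = x by ring] at piece
        linarith [ih (by omega)]
    have := pieces (n + 1) le_rfl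
    rwa [hxn, add_sub_cancel, ← mul_assoc, hxn] at this
  refine le_of_tendsto ?_ subdivided
  simpa using ((hη.comp lim_pos).const_mul (s' - s)).const_sub (φ s)

lemma exists_pos_mul_sqrt_lt_mul_lt (a b : ℝ) {c d : ℝ} (hc : 0 < c) (hd : 0 < d) :
    ∃ δ : ℝ, 0 < δ ∧ a * √δ < c ∧ b * δ < d := by
  have sqrt_lim : Tendsto (fun δ : ℝ ↦ a * √δ) (𝓝 0) (𝓝 0) :=
    Continuous.tendsto' (by fun_prop) _ _ (by simp)
  have linear_lim : Tendsto (fun δ : ℝ ↦ b * δ) (𝓝 0) (𝓝 0) :=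
    Continuous.tendsto' (by fun_prop) _ _ (mul_zero _)
  have eventually_lt := (sqrt_lim.eventually_lt_const hc).and (linear_lim.eventually_lt_const hd)
  have eventually_pos : ∀ᶠ δ : ℝ in 𝓝[>] 0, 0 < δ := self_mem_nhdsWithin
  exact (eventually_pos.and (eventually_lt.filter_mono nhdsWithin_le_nhds)).exists

namespace ConeField

variable {E : Type*} [NormedAddCommGroup E] [NormedSpace ℝ E] {p : E} {R : ℝ}

/-- `T` strictly increases along the `C¹` curves with velocities in the cones. -/
def Increasing (F : ConeField E p R) (T : E → ℝ) : Prop :=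
  ∀ (γ γ' : ℝ → E) (a b : ℝ), a < b →
    (∀ s ∈ Icc a b, HasDerivWithinAt γ (γ' s) (Icc a b) s) → ContinuousOn γ' (Icc a b) →
    (∀ s ∈ Icc a b, γ s ∈ ball p R ∧ γ' s ≠ 0 ∧ 0 ≤ F.f (γ s) (γ' s)) → T (γ a) < T (γ b)

variable {F : ConeField E p R} {T : E → ℝ}

lemma Increasing.lt_add (hT : F.Increasing T) {y w : E} (hy : y ∈ ball p R)
    (hyw : y + w ∈ ball p R) (hw : w ≠ 0) (h : ∀ z ∈ segment ℝ y (y + w), 0 ≤ F.f z w) :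
    T y < T (y + w) := by
  have := hT (fun s ↦ y + s • w) (fun _ ↦ w) 0 1 one_pos
    (fun s _ ↦ by
      simpa using (((hasDerivAt_id s).smul_const w).const_add y).hasDerivWithinAt)
    continuousOn_const (fun s hs ↦ ?_)
  · simpa using this
  · have hz : y + s • w ∈ segment ℝ y (y + w) := by
      rw [segment_eq_image']; exact ⟨s, hs, by simp⟩
    exact ⟨(convex_ball p R).segment_subset hy hyw hz, hw, h _ hz⟩

lemma Increasing.lt_add_of_defect_lt (hT : F.Increasing T) {y w : E} {D : ℝ} (hy : y ∈ ball p R)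
    (hyw : y + w ∈ ball p R) (hw : ‖w‖ ≤ F.C * D) (h : F.defect D < F.f y w) :
    T y < T (y + w) := by
  have D_nonneg : 0 ≤ D := nonneg_of_mul_nonneg_right ((norm_nonneg _).trans hw) F.C_pos
  have w_ne : w ≠ 0 := by
    rintro rfl
    rw [F.f_zero hy] at h
    exact h.not_ge (F.defect_nonneg D_nonneg)
  refine hT.lt_add hy hyw w_ne fun z hz ↦ ?_
  have near : ‖y - z‖ ≤ F.C * D := by
    rw [segment_eq_image'] at hz
    obtain ⟨s, hs, rfl⟩ := hz
    rw [norm_sub_rev]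
    simp only [add_sub_cancel_left, norm_smul, Real.norm_of_nonneg hs.1]
    exact (mul_le_of_le_one_left (norm_nonneg _) hs.2).trans hw
  linarith [(abs_le.1 (F.abs_f_sub_f_le_defect hy
    ((convex_ball p R).segment_subset hy hyw hz) near hw)).2]

lemma defect_two_mul_le {D : ℝ} (hD : 0 ≤ D) : F.defect (2 * D) ≤ 4 * F.defect D := by
  have hC := F.C_pos
  have sqrt_le : √(2 * D) ≤ 2 * √D := by
    rw [Real.sqrt_le_left (by positivity), mul_pow, Real.sq_sqrt hD]; linarith
  rw [defect_eq, defect_eq]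
  calc F.C * √F.C * F.C * (2 * D * √(2 * D)) ≤ F.C * √F.C * F.C * (2 * D * (2 * √D)) := by gcongr
    _ = 4 * (F.C * √F.C * F.C * (D * √D)) := by ring

-- The correction `t • e` outweighs the defect of `v` and the turning of the cones along the way.
lemma Increasing.lt_add_add_smul (hT : F.Increasing T) {y v : E} {D t : ℝ} (hy : y ∈ ball p R)
    (hD : 0 < D) (hv : ‖v‖ ≤ F.C * D) (hvf : -F.defect D ≤ F.f y v)
    (ht : t * F.κ = 6 * F.defect D) (hte : ‖t • F.e‖ ≤ F.C * D)
    (hmem : y + (v + t • F.e) ∈ ball p R) : T y < T (y + (v + t • F.e)) := by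
  have defect_pos := F.defect_pos hD
  have t_nonneg : 0 ≤ t :=
    (pos_of_mul_pos_left (ht ▸ (by positivity : 0 < 6 * F.defect D)) F.κ_pos.le).le
  refine hT.lt_add_of_defect_lt (D := 2 * D) hy hmem ?_ ?_
  · exact (norm_add_le _ _).trans (by linarith)
  · have interior := mul_le_mul_of_nonneg_left (F.interior _ hy) t_nonneg
    have superadditive := F.add_le _ hy v (t • F.e)
    rw [F.smul _ hy _ _ t_nonneg] at superadditive
    linarith [F.defect_two_mul_le hD.le]

namespace IsWeaklyCausal

variable {r a : ℝ} {γ : ℝ → E}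

lemma exists_sub_mul_le (hγ : F.IsWeaklyCausal γ a) (hr : r < R)
    (hm : ∀ s, γ s ∈ closedBall p r) (hT : F.Increasing T) {L : ℝ}
    (hL : ∀ x ∈ ball p R, ∀ y ∈ ball p R, |T x - T y| ≤ L * ‖x - y‖) :
    ∃ δ K : ℝ, 0 < δ ∧ ∀ s s', 0 ≤ s → s ≤ s' → s' ≤ a → s' - s ≤ δ →
      T (γ s) - (s' - s) * (K * √(s' - s)) ≤ T (γ s') := by
  have closedBall_sub : closedBall p r ⊆ ball p R := closedBall_subset_ball hr
  have hC := F.C_pos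
  have hκ := F.κ_pos
  obtain ⟨B, B_nonneg, hB⟩ : ∃ B : ℝ, 0 ≤ B ∧ B * F.κ = 6 * (F.C * √F.C * F.C) :=
    ⟨6 * (F.C * √F.C * F.C) / F.κ, by positivity, div_mul_cancel₀ _ hκ.ne'⟩
  obtain ⟨δ, δ_pos, small_correction, small_step⟩ :=
    exists_pos_mul_sqrt_lt_mul_lt (B * ‖F.e‖) (2 * F.C) hC (sub_pos.2 hr)
  refine ⟨δ, L * (B * ‖F.e‖), δ_pos, fun s s' hs hss hs' hδ ↦ ?_⟩
  rcases hss.eq_or_lt with rfl | hss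
  · simp
  have hv := hγ.norm_sub_le s s' hs hss.le hs'
  have hvf := hγ.le_f s s' hs hss.le hs'
  have D_pos : 0 < s' - s := sub_pos.2 hss
  generalize s' - s = D at *
  set t := B * (D * √D) with ht
  have hte : ‖t • F.e‖ ≤ F.C * D := by
    rw [norm_smul, Real.norm_of_nonneg (by positivity)]
    calc t * ‖F.e‖ = B * ‖F.e‖ * √D * D := by rw [ht]; ring
      _ ≤ B * ‖F.e‖ * √δ * D := by gcongr
      _ ≤ F.C * D := by gcongr
  have hmem : γ s + ((γ s' - γ s) + t • F.e) ∈ ball p R := by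
    rw [mem_ball_iff_norm, add_sub_right_comm]
    have : F.C * D ≤ F.C * δ := by gcongr
    linarith [norm_add_le (γ s - p) ((γ s' - γ s) + t • F.e), norm_add_le (γ s' - γ s) (t • F.e),
      mem_closedBall_iff_norm.1 (hm s)]
  have increase := hT.lt_add_add_smul (closedBall_sub (hm s)) D_pos hv hvf
    (by rw [ht, F.defect_eq, mul_right_comm, hB]; ring) hte hmem
  have lipschitz := (abs_le.1 (hL _ hmem _ (closedBall_sub (hm s')))).2
  rw [show γ s + ((γ s' - γ s) + t • F.e) - γ s' = t • F.e by abel, norm_smul,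
    Real.norm_of_nonneg (by positivity), ht] at lipschitz
  linarith

lemma le_of_increasing (hγ : F.IsWeaklyCausal γ a) (hr : r < R) (hm : ∀ s, γ s ∈ closedBall p r)
    (hT : F.Increasing T) {L : ℝ}
    (hL : ∀ x ∈ ball p R, ∀ y ∈ ball p R, |T x - T y| ≤ L * ‖x - y‖) {s s' : ℝ} (hs : 0 ≤ s)
    (hss : s ≤ s') (hs' : s' ≤ a) : T (γ s) ≤ T (γ s') := by
  obtain ⟨δ, K, δ_pos, hK⟩ := hγ.exists_sub_mul_le hr hm hT hL
  have lim : Tendsto (fun x ↦ K * √x) (𝓝[>] 0) (𝓝 0) :=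
    (Continuous.tendsto' (by fun_prop) _ _ (by simp)).mono_left nhdsWithin_le_nhds
  exact le_of_sub_mul_le (φ := T ∘ γ) δ_pos lim hK hs hss hs'

lemma f_le_defect (hγ : F.IsWeaklyCausal γ a) (hm : ∀ s, γ s ∈ ball p R)
    (hT : F.Increasing T) (hTγ : ∀ s ∈ Icc 0 a, T (γ s) = 0) {s s' : ℝ} (hs : 0 ≤ s)
    (hss : s ≤ s') (hs' : s' ≤ a) : F.f (γ s) (γ s' - γ s) ≤ F.defect (s' - s) := by
  by_contra! h
  have increase := hT.lt_add_of_defect_lt (hm s) (by simpa only [add_sub_cancel] using hm s')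
    (hγ.norm_sub_le s s' hs hss hs') h
  rw [add_sub_cancel, hTγ s ⟨hs, hss.trans hs'⟩, hTγ s' ⟨hs.trans hss, hs'⟩] at increase
  exact lt_irrefl _ increase

lemma norm_second_difference_sq_le (hγ : F.IsWeaklyCausal γ a) (hm : ∀ s, γ s ∈ ball p R)
    (hT : F.Increasing T) (hTγ : ∀ s ∈ Icc 0 a, T (γ s) = 0) {s D : ℝ} (hs : 0 ≤ s) (hD : 0 ≤ D)
    (hsD : s + D ≤ a) :
    ‖(γ (s + D / 2) - γ s) - (γ (s + D) - γ (s + D / 2))‖ ^ 2 ≤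
      F.C * (2 * F.defect D) * (F.C * D + 2 * F.defect D) := by
  have hC := F.C_pos
  have hs₁ : s ≤ s + D / 2 := by linarith
  have hs₂ : s + D / 2 ≤ s + D := by linarith
  have mid_nonneg := hs.trans hs₁
  have mid_le := hs₂.trans hsD
  have norm_v := hγ.norm_sub_le s _ hs hs₁ mid_le
  have norm_w := hγ.norm_sub_le _ _ mid_nonneg hs₂ hsD
  have f_v := hγ.le_f s _ hs hs₁ mid_le
  have f_w := hγ.le_f _ _ mid_nonneg hs₂ hsD
  have f_vw := hγ.f_le_defect hm hT hTγ hs (hs₁.trans hs₂) hsD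
  have l_eq : F.l (γ (s + D / 2) - γ s) = F.l (γ (s + D) - γ (s + D / 2)) := by
    rw [hγ.l_sub s _ hs hs₁ mid_le, hγ.l_sub _ _ mid_nonneg hs₂ hsD]; ring
  rw [← sub_add_sub_cancel' (γ (s + D / 2))] at f_vw
  rw [add_sub_cancel_left] at f_v f_vw norm_v
  rw [show s + D - (s + D / 2) = D / 2 by ring] at f_w norm_w
  have turn := (abs_le.1 (F.abs_f_sub_f_le_defect (hm (s + D / 2)) (hm s) norm_v norm_w)).2
  have half_le := F.defect_mono (by positivity) (half_le_self hD)
  have defect_nonneg := F.defect_nonneg hD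
  refine (F.strict _ (hm s) _ _ (2 * F.defect D) (by positivity) l_eq (by linarith) (by linarith)
    (by linarith)).trans ?_
  gcongr
  linarith

lemma exists_norm_second_difference_le (hγ : F.IsWeaklyCausal γ a) (hm : ∀ s, γ s ∈ ball p R)
    (hT : F.Increasing T) (hTγ : ∀ s ∈ Icc 0 a, T (γ s) = 0) :
    ∃ K : ℝ, ∀ s D, 0 ≤ s → 0 ≤ D → s + D ≤ a →
      ‖(γ (s + D / 2) - γ s) - (γ (s + D) - γ (s + D / 2))‖ ≤ D * (K * √√D) := by
  have hC := F.C_pos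
  set A := F.C * √F.C * F.C with hA
  have A_nonneg : 0 ≤ A := by positivity
  set Q := F.C * (2 * A) * (F.C + 2 * A * √a) with hQ
  refine ⟨√Q, fun s D hs hD hsD ↦ ?_⟩
  rw [← pow_le_pow_iff_left₀ (norm_nonneg _) (by positivity) two_ne_zero]
  have sqrt_le : √D ≤ √a := Real.sqrt_le_sqrt (by linarith)
  calc _ ≤ F.C * (2 * (A * (D * √D))) * (F.C * D + 2 * (A * (D * √D))) := by
        rw [hA, ← F.defect_eq]
        exact hγ.norm_second_difference_sq_le hm hT hTγ hs hD hsD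
    _ ≤ F.C * (2 * (A * (D * √D))) * (F.C * D + 2 * (A * (D * √a))) := by gcongr
    _ = (D * (√Q * √√D)) ^ 2 := by
        rw [mul_pow, mul_pow, Real.sq_sqrt (by positivity), Real.sq_sqrt (Real.sqrt_nonneg _), hQ]
        ring

lemma continuousOn (hγ : F.IsWeaklyCausal γ a) : ContinuousOn γ (Icc 0 a) := by
  refine (LipschitzOnWith.of_dist_le_mul (K := ⟨F.C, F.C_pos.le⟩) fun s hs s' hs' ↦
    ?_).continuousOn
  wlog h : s ≤ s' generalizing s s'
  · rw [dist_comm, dist_comm s]; exact this s' hs' s hs (not_le.1 h).le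
  · rw [dist_comm, dist_comm s, dist_eq_norm, dist_eq_norm, Real.norm_of_nonneg (sub_nonneg.2 h)]
    exact hγ.norm_sub_le s s' hs.1 h hs'.2

lemma eventually_mem_Icc {s : ℝ} (hs : s ∈ Ico 0 a) :
    ∀ᶠ t in 𝓝[>] (0 : ℝ), 0 < t ∧ s ≤ s + t ∧ s + t ≤ a := by
  filter_upwards [Ioo_mem_nhdsGT (sub_pos.2 hs.2)] with t ht
  exact ⟨ht.1, by linarith [ht.1], by linarith [ht.2]⟩

lemma l_eq_one_of_hasDerivAt (hγ : F.IsWeaklyCausal γ a) {s : ℝ} (hs : s ∈ Ico 0 a) {v : E}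
    (hv : HasDerivAt γ v s) : F.l v = 1 := by
  have slope : Tendsto (fun t ↦ F.l (t⁻¹ • (γ (s + t) - γ s))) (𝓝[>] 0) (𝓝 (F.l v)) :=
    (F.l.continuous.tendsto _).comp ((hasDerivAt_iff_tendsto_slope_zero.1 hv).mono_left
      (nhdsWithin_mono _ fun _ hx ↦ ne_of_gt hx))
  refine tendsto_nhds_unique slope (tendsto_const_nhds.congr' ?_)
  filter_upwards [eventually_mem_Icc hs] with t ht
  rw [map_smul, hγ.l_sub s (s + t) hs.1 ht.2.1 ht.2.2, add_sub_cancel_left, smul_eq_mul,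
    inv_mul_cancel₀ ht.1.ne']

lemma f_nonneg_of_hasDerivAt (hγ : F.IsWeaklyCausal γ a) {s : ℝ} (hs : s ∈ Ico 0 a)
    (hm : γ s ∈ ball p R) {v : E} (hv : HasDerivAt γ v s) : 0 ≤ F.f (γ s) v := by
  have slope : Tendsto (fun t ↦ F.f (γ s) (t⁻¹ • (γ (s + t) - γ s))) (𝓝[>] 0)
      (𝓝 (F.f (γ s) v)) :=
    F.tendsto_f tendsto_const_nhds ((hasDerivAt_iff_tendsto_slope_zero.1 hv).mono_left
      (nhdsWithin_mono _ fun _ hx ↦ ne_of_gt hx)) hm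
  have lower : Tendsto (fun t ↦ -(F.C * √(F.C * t) * F.C)) (𝓝[>] 0) (𝓝 0) :=
    (Continuous.tendsto' (by fun_prop) _ _ (by simp)).mono_left nhdsWithin_le_nhds
  refine le_of_tendsto_of_tendsto lower slope ?_
  filter_upwards [eventually_mem_Icc hs] with t ht
  have := hγ.le_f s (s + t) hs.1 ht.2.1 ht.2.2
  rw [add_sub_cancel_left, defect] at this
  rw [F.smul _ hm _ _ (inv_nonneg.2 ht.1.le), inv_mul_eq_div, le_div_iff₀ ht.1]
  linarith

lemma not_forall_eq_zero [CompleteSpace E] (hγ : F.IsWeaklyCausal γ a) (ha : 0 < a)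
    (hm : ∀ s, γ s ∈ ball p R) (hT : F.Increasing T) : ¬ ∀ s ∈ Icc 0 a, T (γ s) = 0 := by
  intro hTγ
  obtain ⟨K, hK⟩ := hγ.exists_norm_second_difference_le hm hT hTγ
  obtain ⟨G, hG, hGd⟩ := exists_continuousOn_hasDerivAt ha hγ.continuousOn
    ((summable_sqrt_sqrt_geometric (half_pos ha).le).mul_left K) hK
  have Icc_sub : Icc (a / 8) (a / 4) ⊆ Ioo 0 (a / 2) :=
    fun s hs ↦ ⟨by linarith [hs.1], by linarith [hs.2]⟩
  have hGd' : ∀ s ∈ Icc (a / 8) (a / 4), HasDerivAt γ (G s) s := fun s hs ↦ hGd s (Icc_sub hs)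
  have Ico_mem : ∀ s ∈ Icc (a / 8) (a / 4), s ∈ Ico 0 a :=
    fun s hs ↦ ⟨by linarith [hs.1], by linarith [hs.2]⟩
  have increase : T (γ (a / 8)) < T (γ (a / 4)) := by
    refine hT γ G _ _ (by linarith) (fun s hs ↦ (hGd' s hs).hasDerivWithinAt) (hG.mono Icc_sub)
      fun s hs ↦ ⟨hm s, fun h ↦ zero_ne_one (α := ℝ) ?_,
        hγ.f_nonneg_of_hasDerivAt (Ico_mem s hs) (hm s) (hGd' s hs)⟩
    rw [← hγ.l_eq_one_of_hasDerivAt (Ico_mem s hs) (hGd' s hs), h, map_zero]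
  rw [hTγ _ ⟨by linarith, by linarith⟩, hTγ _ ⟨by linarith, by linarith⟩] at increase
  exact lt_irrefl _ increase

end IsWeaklyCausal

theorem exists_forall_almostPast_lt [ProperSpace E] {r : ℝ} (hr0 : 0 < r) (hr : r < R)
    (hT : F.Increasing T) {L : ℝ}
    (hL : ∀ x ∈ ball p R, ∀ y ∈ ball p R, |T x - T y| ≤ L * ‖x - y‖) (hTp : T p = 0) :
    ∃ ε > 0, ∀ q ∈ F.almostPast r ε, ‖q - p‖ < r / 2 ∨ T q < -ε := by
  by_contra! H
  have T_cont : ContinuousOn T (ball p R) :=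
    (LipschitzOnWith.of_dist_le_mul (K := L.toNNReal) fun x hx y hy ↦ by
      rw [dist_eq_norm, dist_eq_norm, Real.norm_eq_abs]
      exact (hL x hx y hy).trans
        (mul_le_mul_of_nonneg_right (Real.le_coe_toNNReal L) (norm_nonneg _))).continuousOn
  obtain ⟨γ, a, ha, hγ, hm, hγa, hγ0⟩ := exists_isWeaklyCausal_of_almostPast hr0 hr T_cont H
  refine hγ.not_forall_eq_zero ha (fun s ↦ closedBall_subset_ball hr (hm s)) hT fun s hs ↦
    le_antisymm ?_ (hγ0.trans (hγ.le_of_increasing hr hm hT hL le_rfl hs.1 hs.2))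
  have := hγ.le_of_increasing hr hm hT hL hs.1 hs.2 le_rfl
  rwa [hγa, hTp] at this

end ConeField

/-! ### Local times in a cone field -/

section smoothing

variable {E : Type*} [NormedAddCommGroup E] [NormedSpace ℝ E]

open MeasureTheory in
open scoped Convolution in
lemma exists_contDiff_mollification [FiniteDimensional ℝ E] [MeasurableSpace E] [BorelSpace E]
    (μ : Measure E) [μ.IsAddHaarMeasure] {g : E → ℝ} (hg : LocallyIntegrable g μ) {σ : ℝ}
    (hσ : 0 < σ) :
    ∃ H : E → ℝ, ContDiff ℝ ∞ H ∧ (∀ q c, (∀ x ∈ ball q σ, g x = c) → H q = c) ∧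
      (∀ q, (∀ x, 0 ≤ g x) → 0 ≤ H q) ∧
      ∀ q q', (∀ z ∈ ball (0 : E) σ, g (q - z) ≤ g (q' - z)) → H q ≤ H q' := by
  let φ : ContDiffBump (0 : E) := ⟨σ / 2, σ, half_pos hσ, half_lt_self hσ⟩
  have φ_compact : HasCompactSupport (φ.normed μ) := φ.hasCompactSupport_normed
  have φ_smooth : ContDiff ℝ ∞ (φ.normed μ) := φ.contDiff_normed
  have integrable := φ_compact.convolutionExists_left (ContinuousLinearMap.lsmul ℝ ℝ)
    φ_smooth.continuous hg
  refine ⟨φ.normed μ ⋆[ContinuousLinearMap.lsmul ℝ ℝ, μ] g,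
    φ_compact.contDiff_convolution_left _ φ_smooth hg, fun q c hc ↦ ?_, fun q g_nonneg ↦ ?_,
    fun q q' h ↦ integral_mono (integrable q) (integrable q') fun z ↦ ?_⟩
  · have hq := hc q (mem_ball_self hσ)
    rw [← hq]
    exact φ.normed_convolution_eq_right fun x hx ↦ by rw [hc x hx, hq]
  · exact integral_nonneg fun z ↦ mul_nonneg (φ.nonneg_normed z) (g_nonneg _)
  · simp only [ContinuousLinearMap.lsmul_apply, smul_eq_mul]
    by_cases hz : z ∈ ball (0 : E) σ
    · exact mul_le_mul_of_nonneg_left (h z hz) (φ.nonneg_normed z)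
    · have : φ.normed μ z = 0 := by
        rwa [← Function.notMem_support, φ.support_normed_eq]
      simp [this]

lemma fderiv_nonneg_of_eventually_le {H : E → ℝ} {q v : E} (hH : DifferentiableAt ℝ H q)
    (h : ∀ᶠ s : ℝ in 𝓝[>] 0, H q ≤ H (q + s • v)) : 0 ≤ fderiv ℝ H q v := by
  have slope := (hasDerivAt_iff_tendsto_slope_zero.1 (hH.hasFDerivAt.hasLineDerivAt v)).mono_left
    (nhdsWithin_mono _ fun x (hx : x ∈ Ioi (0 : ℝ)) ↦ ne_of_gt hx)
  refine ge_of_tendsto slope ?_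
  filter_upwards [h, self_mem_nhdsWithin] with s hs (hs0 : 0 < s)
  simpa using mul_nonneg (inv_nonneg.2 hs0.le) (sub_nonneg.2 hs)

end smoothing

namespace ConeField

variable {E : Type*} [NormedAddCommGroup E] [NormedSpace ℝ E] {p : E} {R : ℝ}
  (F : ConeField E p R)

lemma sub_mem_almostPast {r ε σ s : ℝ} {q v z : E} (hr : r ≤ R) (hσ : 0 < σ)
    (hσε : F.C * √σ < ε) (hq : q ∈ ball p (r - σ)) (hv : v ≠ 0) (hqv : 0 ≤ F.f q v)
    (hs : s ∈ Ioo 0 (ε / ‖v‖)) (hz : z ∈ ball 0 σ) (hP : q + s • v - z ∈ F.almostPast r ε) :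
    q - z ∈ F.almostPast r ε := by
  have v_pos := norm_pos_iff.2 hv
  rw [mem_ball_zero_iff] at hz
  have hqR : q ∈ ball p R := ball_subset_ball (by linarith) hq
  have mem_ball : q - z ∈ ball p r := by
    rw [mem_ball_iff_norm] at hq ⊢
    rw [sub_right_comm]
    linarith [norm_sub_le (q - p) z]
  have mem_ball' := ball_subset_ball hr mem_ball
  have displacement : q + s • v - z - (q - z) = s • v := by abel
  refine Step.mem_almostPast F ⟨mem_ball, ?_, ?_⟩ hP
  · rw [displacement, norm_smul, Real.norm_of_nonneg hs.1.le]
    exact (lt_div_iff₀ v_pos).1 hs.2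
  · rw [displacement, norm_smul, Real.norm_of_nonneg hs.1.le, F.smul _ mem_ball' _ _ hs.1.le]
    have turn := (abs_le.1 (F.holder _ hqR _ mem_ball' v)).2
    rw [sub_sub_cancel] at turn
    have error : F.C * √‖z‖ * ‖v‖ < ε * ‖v‖ :=
      mul_lt_mul_of_pos_right ((mul_le_mul_of_nonneg_left (Real.sqrt_le_sqrt hz.le)
        F.C_pos.le).trans_lt hσε) v_pos
    nlinarith [hs.1]

open MeasureTheory in
lemma exists_smooth_indicator [FiniteDimensional ℝ E] {r ε σ : ℝ} (hr : r ≤ R)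
    (hσ : 0 < σ) (hσε : F.C * √σ < ε) :
    ∃ H : E → ℝ, ContDiff ℝ ∞ H ∧ (∀ q, 0 ≤ H q) ∧
      (∀ q, ball q σ ⊆ F.almostPast r ε → H q = 0) ∧
      (∀ q, Disjoint (ball q σ) (F.almostPast r ε) → H q = 1) ∧
      ∀ q ∈ ball p (r - σ), ∀ v, v ≠ 0 → 0 ≤ F.f q v → 0 ≤ fderiv ℝ H q v := by
  classical
  borelize E
  have hε : 0 < ε := (mul_nonneg F.C_pos.le (Real.sqrt_nonneg _)).trans_lt hσε
  let g : E → ℝ := (F.almostPast r ε)ᶜ.indicator 1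
  have g_nonneg : ∀ x, 0 ≤ g x := indicator_nonneg fun _ _ ↦ zero_le_one
  have g_integrable : LocallyIntegrable g (Measure.addHaar : Measure E) :=
    (locallyIntegrable_const (1 : ℝ)).indicator (F.isOpen_almostPast hr).measurableSet.compl
  obtain ⟨H, H_smooth, H_const, H_nonneg, H_mono⟩ :=
    exists_contDiff_mollification Measure.addHaar g_integrable hσ
  refine ⟨H, H_smooth, fun q ↦ H_nonneg q g_nonneg,
    fun q hq ↦ H_const q 0 fun x hx ↦ indicator_of_notMem (not_not.2 (hq hx)) _,
    fun q hq ↦ H_const q 1 fun x hx ↦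
      indicator_of_mem (s := (F.almostPast r ε)ᶜ) (disjoint_left.1 hq hx) 1,
    fun q hq v hv hqv ↦ fderiv_nonneg_of_eventually_le (H_smooth.differentiable (by simp) q) ?_⟩
  filter_upwards [Ioo_mem_nhdsGT (div_pos hε (norm_pos_iff.2 hv))] with s hs
  refine H_mono _ _ fun z hz ↦ ?_
  by_cases h : q + s • v - z ∈ F.almostPast r ε
  · have h' := F.sub_mem_almostPast hr hσ hσε hq hv hqv hs hz h
    simp [g, h, h']
  · simp only [g, indicator_of_mem (mem_compl h)]
    exact indicator_le_self' (fun _ _ ↦ zero_le_one) _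

lemma disjoint_ball_almostPast {T : E → ℝ} {r ε σ L : ℝ} {q : E}
    (hP : ∀ x ∈ F.almostPast r ε, ‖x - p‖ < r / 2 ∨ T x < -ε)
    (hL : ∀ x ∈ ball p R, ∀ y ∈ ball p R, |T x - T y| ≤ L * ‖x - y‖)
    (hσr : σ < r / 8) (hσL : |L| * σ < ε / 2) (hrR : r < R) (hq : q ∈ ball p (7 * r / 8))
    (hq' : 5 * r / 8 ≤ ‖q - p‖) (hTq : -(ε / 2) ≤ T q) :
    Disjoint (ball q σ) (F.almostPast r ε) := by
  refine disjoint_left.2 fun x hx hxP ↦ ?_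
  rw [mem_ball_iff_norm] at hx hq
  have q_to_x : ‖q - p‖ ≤ ‖x - q‖ + ‖x - p‖ := by
    rw [norm_sub_rev x q]; exact norm_sub_le_norm_sub_add_norm_sub q x p
  have x_to_q : ‖x - p‖ ≤ ‖x - q‖ + ‖q - p‖ := norm_sub_le_norm_sub_add_norm_sub x q p
  rcases hP x hxP with near | low
  · linarith
  · have lipschitz := (abs_le.1 (hL x (by rw [mem_ball_iff_norm]; linarith) q
      (by rw [mem_ball_iff_norm]; linarith))).1
    have : L * ‖x - q‖ ≤ |L| * σ :=
      mul_le_mul (le_abs_self L) hx.le (norm_nonneg _) (abs_nonneg _)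
    linarith

lemma l_pos_of_f_nonneg {y v : E} (hy : y ∈ ball p R) (hv : v ≠ 0) (hyv : 0 ≤ F.f y v) :
    0 < F.l v :=
  pos_of_mul_pos_right ((norm_pos_iff.2 hv).trans_le (F.norm_le_of_f_nonneg hy hyv)) F.C_pos.le

lemma exists_pos_smoothing_radius {ε r : ℝ} (hε : 0 < ε) (hr : 0 < r) (L : ℝ) :
    ∃ σ > 0, F.C * √σ < ε ∧ |L| * σ < ε / 2 ∧ σ < ε ∧ σ < r / 8 := by
  have sqrt_lim : Tendsto (fun σ : ℝ ↦ F.C * √σ) (𝓝[>] 0) (𝓝 0) :=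
    (Continuous.tendsto' (by fun_prop) _ _ (by simp)).mono_left nhdsWithin_le_nhds
  have linear_lim : Tendsto (fun σ : ℝ ↦ |L| * σ) (𝓝[>] 0) (𝓝 0) :=
    (Continuous.tendsto' (by fun_prop) _ _ (by simp)).mono_left nhdsWithin_le_nhds
  have small := inter_mem (Ioo_mem_nhdsGT hε) (Ioo_mem_nhdsGT (by linarith : 0 < r / 8))
  obtain ⟨σ, ⟨hσ, hσ'⟩, hσε, hσr⟩ := ((sqrt_lim.eventually (gt_mem_nhds hε)).and
    (linear_lim.eventually (gt_mem_nhds (half_pos hε))) |>.and small).exists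
  exact ⟨σ, hσε.1, hσ, hσ', hσε.2, hσr.2⟩

-- The smoothed indicator of the complement of the almost causal past is only nondecreasing along
-- the cones; a small multiple of `l` makes the increase strict.
theorem exists_local_time [FiniteDimensional ℝ E] {T : E → ℝ} {r : ℝ} (hr0 : 0 < r) (hr : r < R)
    (hT : F.Increasing T) {L : ℝ}
    (hL : ∀ x ∈ ball p R, ∀ y ∈ ball p R, |T x - T y| ≤ L * ‖x - y‖) (hTp : T p = 0) :
    ∃ (h : E → ℝ) (δ : ℝ), 0 < δ ∧ ContDiff ℝ ∞ h ∧ h p < 0 ∧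
      (∀ q ∈ ball p (7 * r / 8), ∀ v, v ≠ 0 → 0 ≤ F.f q v → 0 < fderiv ℝ h q v) ∧
      ∀ q ∈ ball p (7 * r / 8), 5 * r / 8 ≤ ‖q - p‖ → T q + δ ≤ h q := by
  have : ProperSpace E := FiniteDimensional.proper_real E
  obtain ⟨ε, hε, hP⟩ := exists_forall_almostPast_lt hr0 hr hT hL hTp
  obtain ⟨σ, hσ, hσC, hσL, hσε, hσr⟩ := F.exists_pos_smoothing_radius hε hr0 L
  obtain ⟨H, H_smooth, H_nonneg, H_zero, H_one, H_deriv⟩ := F.exists_smooth_indicator hr.le hσ hσC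
  set B := ‖F.l‖ * r + 1
  have B_pos : 0 < B := by positivity
  set k := ε / 4 / B
  have k_pos : 0 < k := by positivity
  have k_mul_B : k * B = ε / 4 := div_mul_cancel₀ _ B_pos.ne'
  set A := |L| * r + ε
  have A_pos : 0 < A := by positivity
  refine ⟨fun q ↦ A * H q + k * (F.l (q - p) - 1), ε / 4, by positivity, by fun_prop, ?_, ?_, ?_⟩
  · simpa [H_zero p ((ball_subset_ball hσε.le).trans (F.ball_subset_almostPast r ε))] using k_pos
  · intro q hq v hv hqv
    have deriv : HasFDerivAt (fun q ↦ A * H q + k * (F.l (q - p) - 1))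
        (A • fderiv ℝ H q + k • F.l) q :=
      ((H_smooth.differentiable (by simp) q).hasFDerivAt.const_mul A).add
        (((F.l.hasFDerivAt.comp q ((hasFDerivAt_id q).sub_const p)).sub_const 1).const_mul k)
    have H_nondecreasing := H_deriv q (ball_subset_ball (by linarith) hq) v hv hqv
    have l_increasing := F.l_pos_of_f_nonneg (ball_subset_ball (by linarith) hq) hv hqv
    rw [deriv.fderiv]
    exact add_pos_of_nonneg_of_pos (mul_nonneg A_pos.le H_nondecreasing)
      (mul_pos k_pos l_increasing)
  · intro q hq hq'
    have hqr : ‖q - p‖ ≤ r := by rw [mem_ball_iff_norm] at hq; linarith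
    have k_bound : -(ε / 4) ≤ k * (F.l (q - p) - 1) := by
      have := (abs_le.1 (F.l.le_opNorm_of_le hqr)).1
      rw [← k_mul_B]; nlinarith
    rcases lt_or_ge (T q) (-(ε / 2)) with low | high
    · linarith [mul_nonneg A_pos.le (H_nonneg q)]
    · have T_le := (abs_le.1 (hL q (ball_subset_ball (by linarith) hq) p
        (mem_ball_self (by linarith)))).2
      have : L * ‖q - p‖ ≤ |L| * r := mul_le_mul (le_abs_self L) hqr (norm_nonneg _) (abs_nonneg _)
      beta_reduce
      rw [H_one q (F.disjoint_ball_almostPast hP hL hσr hσL hr hq hq' high)]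
      linarith

end ConeField

/-! ### The causal cones of a Lorentzian form -/

section LorentzForm

variable {E : Type*} [NormedAddCommGroup E] [NormedSpace ℝ E]

/-- The form `-G(e,e) G(v,w) + G(v,e) G(w,e)`. For a Lorentz form `G` and a timelike vector `e` it
vanishes in the direction of `e` and is positive definite on the orthogonal complement of `e`. -/
noncomputable def spatialForm (G : E →L[ℝ] E →L[ℝ] ℝ) (e v w : E) : ℝ :=
  -(G e e) * G v w + G v e * G w e

/-- A superadditive function which, for a Lorentz form `G` and a timelike vector `e`, is nonnegative
exactly on the closed causal cone of `G` that contains `e`. -/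
noncomputable def coneFun (G : E →L[ℝ] E →L[ℝ] ℝ) (e v : E) : ℝ :=
  -(G v e) - √(spatialForm G e v v)

variable {G G' : E →L[ℝ] E →L[ℝ] ℝ} {e : E}

lemma spatialForm_sub_smul (hG : ∀ v w, G v w = G w v) (v : E) (t : ℝ) :
    spatialForm G e (v - t • e) (v - t • e) = spatialForm G e v v := by
  simp only [spatialForm, map_sub, map_smul, FunLike.coe_sub,
    FunLike.coe_smul, Pi.sub_apply, Pi.smul_apply, smul_eq_mul, hG e v]
  ring

lemma spatialForm_add_smul (hG : ∀ v w, G v w = G w v) (v w : E) (t : ℝ) :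
    spatialForm G e (v + t • w) (v + t • w) =
      spatialForm G e w w * (t * t) + 2 * spatialForm G e v w * t + spatialForm G e v v := by
  simp only [spatialForm, map_add, map_smul, FunLike.coe_add,
    FunLike.coe_smul, Pi.add_apply, Pi.smul_apply, smul_eq_mul, hG w v]
  ring

lemma spatialForm_smul (t : ℝ) (v : E) :
    spatialForm G e (t • v) (t • v) = t ^ 2 * spatialForm G e v v := by
  simp only [spatialForm, map_smul, FunLike.coe_smul, Pi.smul_apply, smul_eq_mul]
  ring

lemma spatialForm_parallelogram (v w : E) :
    2 * spatialForm G e v v + 2 * spatialForm G e w w - spatialForm G e (v + w) (v + w) =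
      spatialForm G e (v - w) (v - w) := by
  simp only [spatialForm, map_add, map_sub, FunLike.coe_add, FunLike.coe_sub, Pi.add_apply,
    Pi.sub_apply]
  ring

lemma coneFun_smul {t : ℝ} (ht : 0 ≤ t) (v : E) : coneFun G e (t • v) = t * coneFun G e v := by
  rw [coneFun, coneFun, spatialForm_smul, Real.sqrt_mul (sq_nonneg t), Real.sqrt_sq ht]
  simp only [map_smul, FunLike.coe_smul, Pi.smul_apply, smul_eq_mul]
  ring

lemma coneFun_self : coneFun G e e = -(G e e) := by
  simp [coneFun, spatialForm]

lemma sqrt_spatialForm_add_le (hG : ∀ v w, G v w = G w v) (h0 : ∀ v, 0 ≤ spatialForm G e v v)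
    (v w : E) : √(spatialForm G e (v + w) (v + w)) ≤
      √(spatialForm G e v v) + √(spatialForm G e w w) := by
  have discrim_nonpos := discrim_le_zero (a := spatialForm G e w w) (b := 2 * spatialForm G e v w)
    (c := spatialForm G e v v) fun t ↦ by rw [← spatialForm_add_smul hG]; exact h0 _
  rw [discrim] at discrim_nonpos
  have cauchy_schwarz : spatialForm G e v w ≤ √(spatialForm G e v v) * √(spatialForm G e w w) := by
    rw [← Real.sqrt_mul (h0 v)]
    exact Real.le_sqrt_of_sq_le (by linarith)
  have expand := spatialForm_add_smul (e := e) hG v w 1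
  rw [one_smul] at expand
  rw [Real.sqrt_le_left (by positivity), expand, add_sq, Real.sq_sqrt (h0 v), Real.sq_sqrt (h0 w)]
  linarith

lemma abs_apply_apply_le {M : ℝ} (hM : ‖G‖ ≤ M) (v w : E) : |G v w| ≤ M * ‖v‖ * ‖w‖ :=
  (G.le_opNorm₂ v w).trans (by gcongr)

lemma abs_spatialForm_sub_le {M : ℝ} (hM : ‖G‖ ≤ M) (hM' : ‖G'‖ ≤ M) (v : E) :
    |spatialForm G e v v - spatialForm G' e v v| ≤ 4 * M * ‖e‖ ^ 2 * ‖G - G'‖ * ‖v‖ ^ 2 := by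
  have M_nonneg : 0 ≤ M := G.opNorm_nonneg.trans hM
  have telescope : spatialForm G e v v - spatialForm G' e v v =
      -((G - G') e e * G v v) - G' e e * (G - G') v v + (G - G') v e * (G v e + G' v e) := by
    simp only [spatialForm, FunLike.coe_sub, Pi.sub_apply]; ring
  have first : |(G - G') e e * G v v| ≤ (‖G - G'‖ * ‖e‖ * ‖e‖) * (M * ‖v‖ * ‖v‖) := by
    rw [abs_mul]
    gcongr
    exacts [abs_apply_apply_le le_rfl _ _, abs_apply_apply_le hM _ _]
  have second : |G' e e * (G - G') v v| ≤ (M * ‖e‖ * ‖e‖) * (‖G - G'‖ * ‖v‖ * ‖v‖) := by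
    rw [abs_mul]
    gcongr
    exacts [abs_apply_apply_le hM' _ _, abs_apply_apply_le le_rfl _ _]
  have third : |(G - G') v e * (G v e + G' v e)| ≤
      (‖G - G'‖ * ‖v‖ * ‖e‖) * (M * ‖v‖ * ‖e‖ + M * ‖v‖ * ‖e‖) := by
    rw [abs_mul]
    gcongr
    exacts [abs_apply_apply_le le_rfl _ _, (abs_add_le _ _).trans
      (add_le_add (abs_apply_apply_le hM _ _) (abs_apply_apply_le hM' _ _))]
  rw [telescope]
  rw [abs_le] at first second third ⊢
  constructor <;> nlinarith [first.1, first.2, second.1, second.2, third.1, third.2]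

lemma abs_spatialForm_le {M : ℝ} (hM : ‖G‖ ≤ M) (v : E) :
    |spatialForm G e v v| ≤ (2 * M * ‖e‖ * ‖v‖) ^ 2 := by
  have M_nonneg : 0 ≤ M := G.opNorm_nonneg.trans hM
  rw [spatialForm]
  calc |-(G e e) * G v v + G v e * G v e| ≤ |-(G e e) * G v v| + |G v e * G v e| := abs_add_le _ _
    _ = |G e e| * |G v v| + |G v e| * |G v e| := by rw [abs_mul, abs_mul, abs_neg]
    _ ≤ (M * ‖e‖ * ‖e‖) * (M * ‖v‖ * ‖v‖) + (M * ‖v‖ * ‖e‖) * (M * ‖v‖ * ‖e‖) := by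
        gcongr <;> exact abs_apply_apply_le hM _ _
    _ ≤ _ := by nlinarith [sq_nonneg (M * ‖e‖ * ‖v‖)]

lemma two_mul_sq_add_two_mul_sq_sub_sq_le {x y η a b s : ℝ} (ha : 0 ≤ a) (hb : 0 ≤ b)
    (hη : 0 ≤ η) (hax : a ≤ x + η) (hby : b ≤ y + η) (hsxy : x + y - η ≤ s) :
    2 * a ^ 2 + 2 * b ^ 2 - s ^ 2 ≤ (x - y) ^ 2 + 36 * η * (|x| + |y| + η) := by
  have hηx : 0 ≤ η * |x| := mul_nonneg hη (abs_nonneg x)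
  have hηy : 0 ≤ η * |y| := mul_nonneg hη (abs_nonneg y)
  rcases le_total η (x + y) with h | h
  · have a_sq : a ^ 2 ≤ (x + η) ^ 2 := by gcongr
    have b_sq : b ^ 2 ≤ (y + η) ^ 2 := by gcongr
    have s_sq : (x + y - η) ^ 2 ≤ s ^ 2 := by
      have : 0 ≤ x + y - η := by linarith
      gcongr
    nlinarith [mul_le_mul_of_nonneg_left (le_abs_self x) hη,
      mul_le_mul_of_nonneg_left (le_abs_self y) hη, sq_nonneg η]
  · have a_sq : a ^ 2 ≤ (3 * η) ^ 2 := by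
      have : a ≤ 3 * η := by linarith
      gcongr
    have b_sq : b ^ 2 ≤ (3 * η) ^ 2 := by
      have : b ≤ 3 * η := by linarith
      gcongr
    nlinarith [sq_nonneg s, sq_nonneg (x - y)]

end LorentzForm

lemma eventually_nhdsGT_mul_le (a : ℝ) {b : ℝ} (hb : 0 < b) : ∀ᶠ R in 𝓝[>] (0 : ℝ), a * R ≤ b :=
  ((Continuous.tendsto' (by fun_prop) _ _ (mul_zero a)).mono_left nhdsWithin_le_nhds).eventually
    (ge_mem_nhds hb)

lemma exists_pos_le_sq_le {a b : ℝ} (ha : 0 < a) (hb : 0 < b) : ∃ c > 0, c ≤ a ∧ c ^ 2 ≤ b := by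
  refine ⟨min a √b, by positivity, min_le_left _ _, ?_⟩
  exact (pow_le_pow_left₀ (by positivity) (min_le_right _ _) 2).trans_eq (Real.sq_sqrt hb.le)

lemma exists_coneBounds_radius {R₀ m c b : ℝ} (hR₀ : 0 < R₀) (hc : 0 < c) (hm : 0 < m)
    (hb : 0 < b) (K M d : ℝ) :
    ∃ R > 0, R ≤ R₀ ∧ R ≤ 1 / 2 ∧ K * R * d ≤ c / 4 ∧ K * R * d * d ≤ c / 4 ∧
      K * R * d * d ≤ m / 2 ∧ 4 * M * d ^ 2 * (K * R) ≤ b := by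
  have R_pos : ∀ᶠ R in 𝓝[>] (0 : ℝ), 0 < R := self_mem_nhdsWithin
  obtain ⟨R, hR, hR₀, hR_half, small, small', timelike, spatial⟩ := (R_pos.and <|
    (eventually_nhdsGT_mul_le 1 hR₀).and <|
    (eventually_nhdsGT_mul_le 1 one_half_pos).and <|
    (eventually_nhdsGT_mul_le (K * d) (show 0 < c / 4 by positivity)).and <|
    (eventually_nhdsGT_mul_le (K * d * d) (show 0 < c / 4 by positivity)).and <|
    (eventually_nhdsGT_mul_le (K * d * d) (half_pos hm)).and <|
    eventually_nhdsGT_mul_le (4 * M * d ^ 2 * K) hb).exists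
  refine ⟨R, hR, ?_, ?_, ?_, ?_, ?_, ?_⟩ <;> linarith

section

variable {E : Type*} [NormedAddCommGroup E] [NormedSpace ℝ E]

lemma exists_forall_mul_sq_norm_le [FiniteDimensional ℝ E] (G : E →L[ℝ] E →L[ℝ] ℝ) (l : E →L[ℝ] ℝ)
    (h : ∀ u, l u = 0 → u ≠ 0 → 0 < G u u) : ∃ c > 0, ∀ u, l u = 0 → c * ‖u‖ ^ 2 ≤ G u u := by
  have : ProperSpace E := FiniteDimensional.proper_real E
  set S : Set E := sphere 0 1 ∩ {u | l u = 0}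
  have S_compact : IsCompact S :=
    (isCompact_sphere 0 1).inter_right (isClosed_eq l.continuous continuous_const)
  have S_bound : ∃ c > 0, ∀ u ∈ S, c ≤ G u u := by
    rcases S.eq_empty_or_nonempty with S_empty | S_nonempty
    · exact ⟨1, one_pos, by simp [S_empty]⟩
    · have G_cont : Continuous fun u ↦ G u u := by fun_prop
      obtain ⟨x, hx, hmin⟩ := S_compact.exists_isMinOn S_nonempty G_cont.continuousOn
      exact ⟨G x x, h x hx.2 (ne_of_mem_sphere hx.1 one_ne_zero), fun u hu ↦ hmin hu⟩
  obtain ⟨c, hc, hcS⟩ := S_bound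
  refine ⟨c, hc, fun u hu ↦ ?_⟩
  rcases eq_or_ne u 0 with rfl | hu0
  · simp
  · have u_pos := norm_pos_iff.2 hu0
    have unit := hcS (‖u‖⁻¹ • u) ⟨by simp [norm_smul, u_pos.ne'], by simp [hu]⟩
    simp only [map_smul, FunLike.coe_smul, Pi.smul_apply, smul_eq_mul] at unit
    have rescale : G u u = ‖u‖ ^ 2 * (‖u‖⁻¹ * (‖u‖⁻¹ * G u u)) := by field_simp
    rw [rescale, mul_comm]
    gcongr

variable {G : E → E →L[ℝ] E →L[ℝ] ℝ} {p e : E}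

/-- The numerical bounds that make the causal cones of a metric `G` on a ball around `p` into a
`ConeField`: `K` is a Lipschitz constant and `M` a bound of `G`, and `c` bounds from below the
length of `e` and the spatial form on the orthogonal complement of `e` at the center `p`. -/
structure ConeBounds (G : E → E →L[ℝ] E →L[ℝ] ℝ) (p e : E) (R K M c : ℝ) : Prop where
  R_pos : 0 < R
  R_le : R ≤ 1 / 2
  c_pos : 0 < c
  K_nonneg : 0 ≤ K
  symm : ∀ y ∈ ball p R, ∀ v w, G y v w = G y w v
  lipschitz : ∀ y ∈ ball p R, ∀ y' ∈ ball p R, ‖G y - G y'‖ ≤ K * ‖y - y'‖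
  norm_le : ∀ y ∈ ball p R, ‖G y‖ ≤ M
  timelike : ∀ y ∈ ball p R, c ≤ -(G y e e)
  spatial : ∀ y ∈ ball p R, ∀ u, G p u e = 0 → c ^ 2 * ‖u‖ ^ 2 ≤ spatialForm (G y) e u u
  mul_norm_le : K * R * ‖e‖ ≤ c / 4
  mul_norm_mul_norm_le : K * R * ‖e‖ * ‖e‖ ≤ c / 4

lemma exists_coneBounds [FiniteDimensional ℝ E] {R₀ K : ℝ} (hR₀ : 0 < R₀) (hK : 0 ≤ K)
    (symm : ∀ y ∈ ball p R₀, ∀ v w, G y v w = G y w v)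
    (lipschitz : ∀ y ∈ ball p R₀, ∀ y' ∈ ball p R₀, ‖G y - G y'‖ ≤ K * ‖y - y'‖)
    (he : G p e e < 0) (hpos : ∀ u, G p u e = 0 → u ≠ 0 → 0 < G p u u) :
    ∃ R M c, R ≤ R₀ ∧ ConeBounds G p e R K M c := by
  obtain ⟨c₀, hc₀, hcG⟩ := exists_forall_mul_sq_norm_le (G p) ((G p).flip e) (by simpa using hpos)
  set m := -(G p e e) with hm
  have m_pos : 0 < m := by linarith
  set M := ‖G p‖ + K
  have M_nonneg : 0 ≤ M := add_nonneg (G p).opNorm_nonneg hK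
  obtain ⟨c, hc, hcm, hcc⟩ := exists_pos_le_sq_le (half_pos m_pos)
    (show 0 < m * c₀ / 2 by positivity)
  obtain ⟨R, hR, hRR₀, hR_half, small, small', timelike, spatial⟩ :=
    exists_coneBounds_radius hR₀ hc m_pos (show 0 < m * c₀ / 2 by positivity) K M ‖e‖
  have sub := ball_subset_ball (x := p) hRR₀
  have near : ∀ y ∈ ball p R, ‖G y - G p‖ ≤ K * R := fun y hy ↦
    (lipschitz y (sub hy) p (mem_ball_self hR₀)).trans
      (mul_le_mul_of_nonneg_left (mem_ball_iff_norm.1 hy).le hK)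
  have norm_le : ∀ y ∈ ball p R, ‖G y‖ ≤ M := fun y hy ↦
    (norm_le_norm_add_norm_sub' (G y) (G p)).trans (add_le_add_right ((near y hy).trans
      (mul_le_of_le_one_right hK (by linarith))) _)
  refine ⟨R, M, c, hRR₀, hR, hR_half, hc, hK, fun y hy ↦ symm y (sub hy),
    fun y hy y' hy' ↦ lipschitz y (sub hy) y' (sub hy'), norm_le, fun y hy ↦ ?_,
    fun y hy u hu ↦ ?_, small, small'⟩
  · have perturbation := (abs_le.1 (abs_apply_apply_le (near y hy) e e)).2
    simp only [FunLike.coe_sub, Pi.sub_apply] at perturbation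
    linarith
  · have perturbation := (abs_le.1 (abs_spatialForm_sub_le (e := e) (norm_le y hy)
      (norm_le p (mem_ball_self hR)) u)).1
    have error : 4 * M * ‖e‖ ^ 2 * ‖G y - G p‖ * ‖u‖ ^ 2 ≤ m * c₀ / 2 * ‖u‖ ^ 2 := by
      refine mul_le_mul_of_nonneg_right (le_trans ?_ spatial) (by positivity)
      gcongr
      exact near y hy
    have center : spatialForm (G p) e u u = m * G p u u := by simp [spatialForm, hu, hm]
    have center_ge := mul_le_mul_of_nonneg_left (hcG u (by simpa using hu)) m_pos.le
    have : c ^ 2 * ‖u‖ ^ 2 ≤ m * c₀ / 2 * ‖u‖ ^ 2 := by gcongr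
    linarith

end

lemma abs_sqrt_sub_sqrt_le {a b : ℝ} (ha : 0 ≤ a) (hb : 0 ≤ b) : |√a - √b| ≤ √|a - b| := by
  have sqrt_sub_le : ∀ a b : ℝ, 0 ≤ b → √a - √b ≤ √|a - b| := fun a b hb ↦ by
    rw [sub_le_iff_le_add', Real.sqrt_le_left (by positivity), add_sq, Real.sq_sqrt hb,
      Real.sq_sqrt (abs_nonneg _)]
    have cross_nonneg : 0 ≤ 2 * √b * √|a - b| := by positivity
    linarith [le_abs_self (a - b)]
  exact abs_sub_le_iff.2 ⟨sqrt_sub_le a b hb, abs_sub_comm a b ▸ sqrt_sub_le b a ha⟩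

lemma le_mul_of_mul_le_add_mul {n u x m c d ε : ℝ} (hc : 0 < c) (hcm : c ≤ m) (hu : 0 ≤ u)
    (hd : 0 ≤ d) (hε : 0 ≤ ε) (hεc : ε ≤ c / 2) (hεd : ε * d ≤ m / 2)
    (hn : n ≤ u + |x| / m * d) (h : c * u ≤ x + ε * n) : n ≤ (3 / c + d / c) * x := by
  have hm : 0 < m := hc.trans_le hcm
  have absorb : ε * n ≤ c / 2 * u + |x| / 2 := by
    calc ε * n ≤ ε * (u + |x| / m * d) := by gcongr
      _ = ε * u + ε * d * (|x| / m) := by ring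
      _ ≤ c / 2 * u + m / 2 * (|x| / m) := by gcongr
      _ = c / 2 * u + |x| / 2 := by field_simp
  have hcu : 0 ≤ c / 2 * u := by positivity
  have hx : 0 ≤ x := by
    by_contra! hx
    rw [abs_of_neg hx] at absorb
    linarith
  rw [abs_of_nonneg hx] at absorb hn
  have u_le : u ≤ 3 / c * x := by
    rw [div_mul_eq_mul_div, le_div_iff₀ hc]; linarith
  have : x / m * d ≤ d / c * x := by
    calc x / m * d ≤ x / c * d := by gcongr
      _ = d / c * x := by ring
  linarith

namespace ConeBounds

variable {E : Type*} [NormedAddCommGroup E] [NormedSpace ℝ E]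
  {G : E → E →L[ℝ] E →L[ℝ] ℝ} {p e : E} {R K M c : ℝ}

lemma mem_self (H : ConeBounds G p e R K M c) : p ∈ ball p R := mem_ball_self H.R_pos

lemma M_nonneg (H : ConeBounds G p e R K M c) : 0 ≤ M :=
  (G p).opNorm_nonneg.trans (H.norm_le p H.mem_self)

lemma apply_self_ne_zero (H : ConeBounds G p e R K M c) : G p e e ≠ 0 := by
  linarith [H.c_pos, H.timelike p H.mem_self]

lemma sq_norm_sub_smul_le (H : ConeBounds G p e R K M c) {y : E} (hy : y ∈ ball p R) (v : E) :
    c ^ 2 * ‖v - (G p v e / G p e e) • e‖ ^ 2 ≤ spatialForm (G y) e v v := by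
  rw [← spatialForm_sub_smul (H.symm y hy) v (G p v e / G p e e)]
  exact H.spatial y hy _ (by simp [H.apply_self_ne_zero])

lemma spatialForm_nonneg (H : ConeBounds G p e R K M c) {y : E} (hy : y ∈ ball p R) (v : E) :
    0 ≤ spatialForm (G y) e v v :=
  le_trans (by positivity) (H.sq_norm_sub_smul_le hy v)

lemma eq_smul_of_spatialForm_nonpos (H : ConeBounds G p e R K M c) {y : E} (hy : y ∈ ball p R)
    {v : E} (hv : spatialForm (G y) e v v ≤ 0) : v = (G p v e / G p e e) • e := by
  have sq_nonpos := nonpos_of_mul_nonpos_right ((H.sq_norm_sub_smul_le hy v).trans hv)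
    (pow_pos H.c_pos 2)
  rwa [sq_nonpos_iff, norm_eq_zero, sub_eq_zero] at sq_nonpos

lemma norm_sub_center_le (H : ConeBounds G p e R K M c) {y : E} (hy : y ∈ ball p R) :
    ‖G y - G p‖ ≤ K * R :=
  (H.lipschitz y hy p H.mem_self).trans
    (mul_le_mul_of_nonneg_left (mem_ball_iff_norm.1 hy).le H.K_nonneg)

lemma abs_apply_sub_center_le (H : ConeBounds G p e R K M c) {y : E} (hy : y ∈ ball p R) (v : E) :
    |G y v e - G p v e| ≤ K * R * ‖e‖ * ‖v‖ :=
  (abs_apply_apply_le (H.norm_sub_center_le hy) v e).trans_eq (mul_right_comm _ _ _)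

lemma abs_apply_le (H : ConeBounds G p e R K M c) {y : E} (hy : y ∈ ball p R) (v : E) :
    |G y v e| ≤ M * ‖e‖ * ‖v‖ :=
  (abs_apply_apply_le (H.norm_le y hy) v e).trans_eq (mul_right_comm _ _ _)

lemma add_le (H : ConeBounds G p e R K M c) {y : E} (hy : y ∈ ball p R) (v w : E) :
    coneFun (G y) e v + coneFun (G y) e w ≤ coneFun (G y) e (v + w) := by
  have triangle := sqrt_spatialForm_add_le (H.symm y hy) (H.spatialForm_nonneg hy) v w
  simp only [coneFun, map_add, FunLike.coe_add, Pi.add_apply]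
  linarith

lemma bound (H : ConeBounds G p e R K M c) {y : E} (hy : y ∈ ball p R) (v : E) :
    |coneFun (G y) e v| ≤ 3 * M * ‖e‖ * ‖v‖ := by
  have := H.M_nonneg
  have sqrt_le : √(spatialForm (G y) e v v) ≤ 2 * M * ‖e‖ * ‖v‖ := by
    rw [Real.sqrt_le_left (by positivity)]
    exact (le_abs_self _).trans (abs_spatialForm_le (H.norm_le y hy) v)
  have time := abs_le.1 (H.abs_apply_le hy v)
  have sqrt_nonneg := Real.sqrt_nonneg (spatialForm (G y) e v v)
  rw [coneFun, abs_le]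
  constructor <;> linarith

lemma norm_sub_le_sqrt (H : ConeBounds G p e R K M c) {y y' : E} (hy : y ∈ ball p R)
    (hy' : y' ∈ ball p R) : ‖y - y'‖ ≤ √‖y - y'‖ := by
  have le_one : ‖y - y'‖ ≤ 1 := by
    have := norm_sub_le_norm_sub_add_norm_sub y p y'
    linarith [mem_ball_iff_norm.1 hy, mem_ball_iff_norm'.1 hy', H.R_le]
  exact Real.le_sqrt_of_sq_le (by rw [sq]; exact mul_le_of_le_one_left (norm_nonneg _) le_one)

lemma abs_apply_sub_le (H : ConeBounds G p e R K M c) {y y' : E} (hy : y ∈ ball p R)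
    (hy' : y' ∈ ball p R) (v : E) : |G y v e - G y' v e| ≤ K * ‖e‖ * √‖y - y'‖ * ‖v‖ := by
  have norm_sub_le : ‖G y - G y'‖ ≤ K * √‖y - y'‖ :=
    (H.lipschitz y hy y' hy').trans
      (mul_le_mul_of_nonneg_left (H.norm_sub_le_sqrt hy hy') H.K_nonneg)
  calc |G y v e - G y' v e| ≤ K * √‖y - y'‖ * ‖v‖ * ‖e‖ := abs_apply_apply_le norm_sub_le v e
    _ = K * ‖e‖ * √‖y - y'‖ * ‖v‖ := by ring

lemma abs_sqrt_spatialForm_sub_le (H : ConeBounds G p e R K M c) {y y' : E} (hy : y ∈ ball p R)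
    (hy' : y' ∈ ball p R) (v : E) :
    |√(spatialForm (G y) e v v) - √(spatialForm (G y') e v v)| ≤
      √(4 * M * ‖e‖ ^ 2 * K) * √‖y - y'‖ * ‖v‖ := by
  have hM := H.M_nonneg
  have hK := H.K_nonneg
  have difference : |spatialForm (G y) e v v - spatialForm (G y') e v v| ≤
      4 * M * ‖e‖ ^ 2 * K * ‖y - y'‖ * ‖v‖ ^ 2 := by
    refine (abs_spatialForm_sub_le (H.norm_le y hy) (H.norm_le y' hy') v).trans ?_
    rw [mul_assoc _ K]
    gcongr
    exact H.lipschitz y hy y' hy'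
  refine (abs_sqrt_sub_sqrt_le (H.spatialForm_nonneg hy v) (H.spatialForm_nonneg hy' v)).trans
    ((Real.sqrt_le_sqrt difference).trans_eq ?_)
  rw [Real.sqrt_mul (by positivity) (‖v‖ ^ 2), Real.sqrt_mul (by positivity) ‖y - y'‖,
    Real.sqrt_sq (norm_nonneg _)]

lemma holder (H : ConeBounds G p e R K M c) {y y' : E} (hy : y ∈ ball p R) (hy' : y' ∈ ball p R)
    (v : E) : |coneFun (G y) e v - coneFun (G y') e v| ≤
      (K * ‖e‖ + √(4 * M * ‖e‖ ^ 2 * K)) * √‖y - y'‖ * ‖v‖ := by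
  have time := abs_le.1 (H.abs_apply_sub_le hy hy' v)
  have space := abs_le.1 (H.abs_sqrt_spatialForm_sub_le hy hy' v)
  rw [coneFun, coneFun, abs_le]
  constructor <;> linarith [time.1, time.2, space.1, space.2]

lemma narrow (H : ConeBounds G p e R K M c) {y : E} (hy : y ∈ ball p R) {v : E}
    (hv : -(c / (4 * (1 + ‖e‖)) * ‖v‖) ≤ coneFun (G y) e v) :
    ‖v‖ ≤ (3 / c + ‖e‖ / c) * -(G p v e) := by
  have hc := H.c_pos
  have hm : c ≤ -(G p e e) := H.timelike p H.mem_self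
  have hK := H.K_nonneg
  have hR := H.R_pos
  set u := v - (G p v e / G p e e) • e with hu
  set κ := c / (4 * (1 + ‖e‖))
  have κ_nonneg : 0 ≤ κ := by positivity
  have κ_mul : κ * (1 + ‖e‖) = c / 4 := by simp only [κ]; field_simp
  have κ_mul_norm_nonneg : 0 ≤ κ * ‖e‖ := by positivity
  have u_le_sqrt : c * ‖u‖ ≤ √(spatialForm (G y) e v v) :=
    Real.le_sqrt_of_sq_le (by rw [mul_pow]; exact H.sq_norm_sub_smul_le hy v)
  have time := (abs_le.1 (H.abs_apply_sub_center_le hy v)).1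
  refine le_mul_of_mul_le_add_mul (u := ‖u‖) (ε := K * R * ‖e‖ + κ) hc hm (norm_nonneg _)
    (norm_nonneg _) (by positivity) ?_ ?_ ?_ ?_
  · linarith [H.mul_norm_le]
  · linarith [H.mul_norm_mul_norm_le]
  · have := norm_add_le u ((G p v e / G p e e) • e)
    rwa [hu, sub_add_cancel, ← hu, norm_smul, Real.norm_eq_abs, abs_div,
      abs_of_neg (by linarith : G p e e < 0), ← abs_neg (G p v e)] at this
  · rw [coneFun] at hv
    linarith

lemma sq_apply_sub_apply_le (H : ConeBounds G p e R K M c) {y : E} (hy : y ∈ ball p R) {v w : E}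
    (hvw : G p v e = G p w e) : (G y v e - G y w e) ^ 2 ≤ (c / 4 * ‖v - w‖) ^ 2 := by
  have time := H.abs_apply_sub_center_le hy (v - w)
  simp only [map_sub, FunLike.coe_sub, Pi.sub_apply, hvw, sub_self, sub_zero] at time
  rw [← sq_abs]
  exact pow_le_pow_left₀ (abs_nonneg _) (time.trans (by gcongr; exact H.mul_norm_le)) 2

lemma strict (H : ConeBounds G p e R K M c) {y : E} (hy : y ∈ ball p R) {v w : E} {η : ℝ}
    (hη : 0 ≤ η) (hvw : G p v e = G p w e) (hv : -η ≤ coneFun (G y) e v)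
    (hw : -η ≤ coneFun (G y) e w) (hs : coneFun (G y) e (v + w) ≤ η) :
    ‖v - w‖ ^ 2 ≤ 72 / c ^ 2 * (M * ‖e‖ + 1) * η * (‖v‖ + ‖w‖ + η) := by
  have hc := H.c_pos
  have hM := H.M_nonneg
  have spatial := H.spatial y hy (v - w) (by simp [hvw])
  have time := H.sq_apply_sub_apply_le hy hvw
  have convexity := two_mul_sq_add_two_mul_sq_sub_sq_le (x := -(G y v e)) (y := -(G y w e)) (η := η)
    (s := √(spatialForm (G y) e (v + w) (v + w)))
    (Real.sqrt_nonneg (spatialForm (G y) e v v)) (Real.sqrt_nonneg (spatialForm (G y) e w w)) hη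
    (by rw [coneFun] at hv; linarith) (by rw [coneFun] at hw; linarith)
    (by
      simp only [coneFun, map_add, FunLike.coe_add, Pi.add_apply] at hs ⊢
      linarith)
  rw [Real.sq_sqrt (H.spatialForm_nonneg hy _), Real.sq_sqrt (H.spatialForm_nonneg hy _),
    Real.sq_sqrt (H.spatialForm_nonneg hy _), abs_neg, abs_neg, spatialForm_parallelogram]
    at convexity
  have size : |G y v e| + |G y w e| + η ≤ (M * ‖e‖ + 1) * (‖v‖ + ‖w‖ + η) := by
    have : 0 ≤ M * ‖e‖ * η := by positivity
    linarith [H.abs_apply_le hy v, H.abs_apply_le hy w, norm_nonneg v, norm_nonneg w]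
  have scaled : c ^ 2 / 2 * ‖v - w‖ ^ 2 ≤ 36 * η * ((M * ‖e‖ + 1) * (‖v‖ + ‖w‖ + η)) := by
    have : 0 ≤ c ^ 2 * ‖v - w‖ ^ 2 := by positivity
    rw [mul_pow] at time
    linarith [mul_le_mul_of_nonneg_left size (by positivity : 0 ≤ 36 * η)]
  calc ‖v - w‖ ^ 2 = 2 / c ^ 2 * (c ^ 2 / 2 * ‖v - w‖ ^ 2) := by field_simp
    _ ≤ 2 / c ^ 2 * (36 * η * ((M * ‖e‖ + 1) * (‖v‖ + ‖w‖ + η))) := by gcongr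
    _ = _ := by ring

lemma coneFun_nonneg_iff (H : ConeBounds G p e R K M c) {y : E} (hy : y ∈ ball p R) {v : E}
    (hv : v ≠ 0) : 0 ≤ coneFun (G y) e v ↔ G y v v ≤ 0 ∧ G y v e < 0 := by
  have timelike := H.c_pos.trans_le (H.timelike y hy)
  rw [coneFun, sub_nonneg]
  constructor
  · intro h
    have time_nonneg : 0 ≤ -(G y v e) := (Real.sqrt_nonneg _).trans h
    have spatial_le : spatialForm (G y) e v v ≤ (-(G y v e)) ^ 2 :=
      (Real.sqrt_le_left time_nonneg).1 h
    constructor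
    · rw [spatialForm] at spatial_le
      by_contra! pos
      nlinarith [mul_pos timelike pos]
    · refine lt_of_le_of_ne (by linarith) fun time_eq_zero ↦ hv ?_
      rw [time_eq_zero, neg_zero, zero_pow two_ne_zero] at spatial_le
      have parallel := H.eq_smul_of_spatialForm_nonpos hy spatial_le
      rw [parallel, map_smul, FunLike.coe_smul, Pi.smul_apply, smul_eq_mul] at time_eq_zero
      rw [parallel, (mul_eq_zero.1 time_eq_zero).resolve_right (by linarith), zero_smul]
  · rintro ⟨causal, future⟩
    rw [Real.sqrt_le_left (by linarith), spatialForm]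
    nlinarith [mul_nonneg timelike.le (neg_nonneg.2 causal)]

/-- The causal cones of a metric with controlled geometry, as a `ConeField`. -/
noncomputable def coneField (H : ConeBounds G p e R K M c) : ConeField E p R where
  f y v := coneFun (G y) e v
  l := -((G p).flip e)
  e := e
  C := max (max 1 (3 * M * ‖e‖)) (max (K * ‖e‖ + √(4 * M * ‖e‖ ^ 2 * K))
    (max (3 / c + ‖e‖ / c) (72 / c ^ 2 * (M * ‖e‖ + 1))))
  κ := c / (4 * (1 + ‖e‖))
  one_le_C := by simp
  κ_pos := by have := H.c_pos; positivity
  add_le y hy v w := H.add_le hy v w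
  smul y _ t v ht := coneFun_smul ht v
  holder y hy y' hy' v := (H.holder hy hy' v).trans (by gcongr; simp)
  bound y hy v := (H.bound hy v).trans (by gcongr; simp)
  narrow y hy v hv := by
    have := H.c_pos
    have v_le := H.narrow hy hv
    have l_nonneg : 0 ≤ -(G p v e) :=
      nonneg_of_mul_nonneg_right ((norm_nonneg _).trans v_le) (by positivity)
    exact v_le.trans (mul_le_mul_of_nonneg_right (by simp) l_nonneg)
  interior y hy := by
    rw [coneFun_self]
    exact (div_le_self H.c_pos.le (by linarith [norm_nonneg e])).trans (H.timelike y hy)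
  strict y hy v w η hη hvw hv hw hs := by
    have := H.c_pos
    refine (H.strict hy hη (neg_injective hvw) hv hw hs).trans ?_
    gcongr
    simp

end ConeBounds

/-! ### Lorentzian metrics in charts -/

section LorentzianMetric

variable {d : ℕ} {M : Type*} [TopologicalSpace M] [ChartedSpace (EuclideanSpace ℝ (Fin d)) M]
  [IsManifold (𝓡 d) ∞ M] {g : LorentzianMetric d M}

namespace LorentzianMetric

lemma pos_of_orthogonal (g : LorentzianMetric d M) {x : M} {e w : TangentSpace (𝓡 d) x}
    (he : g.form x e e < 0) (hw : g.form x e w = 0) (hw0 : w ≠ 0) : 0 < g.form x w w := by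
  by_contra! w_nonpos
  obtain ⟨v, -, pos⟩ := g.signature x
  -- The form is nonpositive on the span of `e` and `w`, which meets the orthogonal complement of
  -- `v` in the nonzero vector `u`.
  set u := (g.form x v w) • e - (g.form x v e) • w with hu
  have u_orthogonal : g.form x v u = 0 := by
    simp only [hu, map_sub, map_smul, smul_eq_mul]; ring
  have hwe : g.form x w e = 0 := by rw [g.symm, hw]
  have form_u : g.form x u u = (g.form x v w) ^ 2 * g.form x e e +
      (g.form x v e) ^ 2 * g.form x w w := by
    simp only [hu, map_sub, map_smul, sub_apply, smul_apply, smul_eq_mul, hw, hwe]; ring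
  have u_ne_zero : u ≠ 0 := by
    intro u_eq_zero
    have form_e_u : g.form x e u = g.form x v w * g.form x e e := by simp [hu, hw]
    rw [u_eq_zero, map_zero] at form_e_u
    have hvw : g.form x v w = 0 := (mul_eq_zero.1 form_e_u.symm).resolve_right he.ne
    rw [hu, hvw, zero_smul, zero_sub, neg_eq_zero, smul_eq_zero] at u_eq_zero
    linarith [pos e (u_eq_zero.resolve_right hw0) (by rintro rfl; simp at he)]
  linarith [pos u u_orthogonal u_ne_zero,
    mul_nonpos_of_nonneg_of_nonpos (sq_nonneg (g.form x v w)) he.le,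
    mul_nonpos_of_nonneg_of_nonpos (sq_nonneg (g.form x v e)) w_nonpos]

lemma neg_of_neg (g : LorentzianMetric d M) {x : M} {e e' v : TangentSpace (𝓡 d) x}
    (he : g.form x e e < 0) (he' : g.form x e' e' < 0) (hee : g.form x e e' < 0)
    (hv : g.form x v v ≤ 0) (hve : g.form x v e < 0) : g.form x v e' < 0 := by
  by_contra! hve'
  -- `v + t • e` is timelike, being a sum of causal vectors, but orthogonal to `e'`.
  set t := g.form x v e' / -(g.form x e e')
  have t_nonneg : 0 ≤ t := div_nonneg hve' (by linarith)
  have t_mul : t * -(g.form x e e') = g.form x v e' := div_mul_cancel₀ _ (neg_ne_zero.2 hee.ne)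
  have orthogonal : g.form x e' (v + t • e) = 0 := by
    rw [g.symm]; simp only [map_add, map_smul, add_apply, smul_apply, smul_eq_mul]; linarith
  have ne_zero : v + t • e ≠ 0 := by
    intro h
    have : g.form x (v + t • e) e = g.form x v e + t * g.form x e e := by simp
    rw [h] at this
    simp only [map_zero, FunLike.coe_zero, Pi.zero_apply] at this
    nlinarith
  have form_self : g.form x (v + t • e) (v + t • e) =
      g.form x v v + 2 * t * g.form x v e + t ^ 2 * g.form x e e := by
    simp only [map_add, map_smul, add_apply, smul_eq_mul, smul_apply, g.symm x e v]; ring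
  have := g.pos_of_orthogonal he' orthogonal ne_zero
  nlinarith [mul_nonneg t_nonneg (neg_nonneg.2 hve.le),
    mul_nonneg (sq_nonneg t) (neg_nonneg.2 he.le)]

end LorentzianMetric

/-- The coordinate frame of the chart at `p`, as a linear map to the tangent space at `x`. It
identifies coordinate vectors with tangent vectors when `x` lies in the domain of that chart. -/
noncomputable def chartFrame (d : ℕ) {M : Type*} [TopologicalSpace M]
    [ChartedSpace (EuclideanSpace ℝ (Fin d)) M] [IsManifold (𝓡 d) ∞ M] (p x : M) :
    EuclideanSpace ℝ (Fin d) →L[ℝ] TangentSpace (𝓡 d) x :=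
  (trivializationAt (EuclideanSpace ℝ (Fin d)) (TangentSpace (𝓡 d)) p).symmL ℝ x

/-- The metric in the coordinates of the chart at `p`, a function on the coordinate space. -/
noncomputable def chartMetric (g : LorentzianMetric d M) (p : M) (y : EuclideanSpace ℝ (Fin d)) :
    EuclideanSpace ℝ (Fin d) →L[ℝ] EuclideanSpace ℝ (Fin d) →L[ℝ] ℝ :=
  LinearMap.toContinuousLinearMap (LinearMap.toContinuousLinearMap.toLinearMap ∘ₗ
    (LinearMap.mk₂ ℝ (fun v w ↦ g.form ((extChartAt (𝓡 d) p).symm y)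
      (chartFrame d p ((extChartAt (𝓡 d) p).symm y) v)
      (chartFrame d p ((extChartAt (𝓡 d) p).symm y) w))
      (fun _ _ _ ↦ by rw [map_add, map_add]; rfl) (fun _ _ _ ↦ by rw [map_smul, map_smul]; rfl)
      (fun _ _ _ ↦ by rw [map_add, map_add]) (fun _ _ _ ↦ by rw [map_smul, map_smul])))

lemma chartMetric_apply (p : M) (y v w : EuclideanSpace ℝ (Fin d)) :
    chartMetric g p y v w = g.form ((extChartAt (𝓡 d) p).symm y)
      (chartFrame d p ((extChartAt (𝓡 d) p).symm y) v)
      (chartFrame d p ((extChartAt (𝓡 d) p).symm y) w) := rfl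

lemma contMDiffOn_chartFrame (p : M) (v : EuclideanSpace ℝ (Fin d)) :
    ContMDiffOn (𝓡 d) ((𝓡 d).prod 𝓘(ℝ, EuclideanSpace ℝ (Fin d))) ∞
      (fun x : M ↦ (⟨x, chartFrame d p x v⟩ : TangentBundle (𝓡 d) M))
      (chartAt (EuclideanSpace ℝ (Fin d)) p).source := by
  set e := trivializationAt (EuclideanSpace ℝ (Fin d)) (TangentSpace (𝓡 d) : M → Type _) p
  have symm_smooth : ContMDiffOn ((𝓡 d).prod 𝓘(ℝ, EuclideanSpace ℝ (Fin d)))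
      ((𝓡 d).prod 𝓘(ℝ, EuclideanSpace ℝ (Fin d))) ∞
      e.toOpenPartialHomeomorph.symm e.target := e.contMDiffOn_symm
  have section_smooth : ContMDiffOn (𝓡 d) ((𝓡 d).prod 𝓘(ℝ, EuclideanSpace ℝ (Fin d))) ∞
      (fun x : M ↦ (x, v)) e.baseSet := contMDiffOn_id.prodMk contMDiffOn_const
  refine (symm_smooth.comp section_smooth fun x hx ↦ by
    simpa [e.mem_target] using hx).congr fun x hx ↦ ?_
  rw [Function.comp_apply, ← e.mk_symm hx v, chartFrame, e.symmL_apply hx]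

lemma contDiffOn_chartMetric (p : M) :
    ContDiffOn ℝ ∞ (chartMetric g p) (extChartAt (𝓡 d) p).target := by
  rw [contDiffOn_clm_apply]
  intro v
  rw [contDiffOn_clm_apply]
  intro w
  rw [← contMDiffOn_iff_contDiffOn]
  have bundle_smooth : ContMDiffOn (𝓡 d) ((𝓡 d).prod 𝓘(ℝ, ℝ)) ∞ (fun x : M ↦
      Bundle.TotalSpace.mk' ℝ (E := Bundle.Trivial M ℝ) x
        (g.form x (chartFrame d p x v) (chartFrame d p x w)))
      (chartAt (EuclideanSpace ℝ (Fin d)) p).source := by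
    apply ContMDiffOn.clm_bundle_apply₂ (F₁ := EuclideanSpace ℝ (Fin d))
      (F₂ := EuclideanSpace ℝ (Fin d))
    · exact g.contMDiff.contMDiffOn
    · exact contMDiffOn_chartFrame p v
    · exact contMDiffOn_chartFrame p w
  have smooth : ContMDiffOn (𝓡 d) 𝓘(ℝ, ℝ) ∞
      (fun x : M ↦ g.form x (chartFrame d p x v) (chartFrame d p x w))
      (chartAt (EuclideanSpace ℝ (Fin d)) p).source := fun x hx ↦
    (Bundle.contMDiffWithinAt_totalSpace.1 (bundle_smooth x hx)).2
  refine smooth.comp (contMDiffOn_extChartAt_symm p) fun y hy ↦ ?_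
  simpa using (extChartAt (𝓡 d) p).map_target hy

lemma continuousOn_form_chartFrame (τ : TimeOrientation g) (p : M)
    (v : EuclideanSpace ℝ (Fin d)) :
    ContinuousOn (fun x ↦ g.form x (chartFrame d p x v) (τ.field x))
      (chartAt (EuclideanSpace ℝ (Fin d)) p).source := by
  have bundle_continuous : ContinuousOn (fun x : M ↦
      Bundle.TotalSpace.mk' ℝ (E := Bundle.Trivial M ℝ) x
        (g.form x (chartFrame d p x v) (τ.field x)))
      (chartAt (EuclideanSpace ℝ (Fin d)) p).source := by
    apply ContinuousOn.clm_bundle_apply₂ (F₁ := EuclideanSpace ℝ (Fin d))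
      (F₂ := EuclideanSpace ℝ (Fin d))
    · exact g.contMDiff.continuous.continuousOn
    · exact (contMDiffOn_chartFrame p v).continuousOn
    · exact τ.continuous.continuousOn
  exact (Bundle.Trivial.homeomorphProd M ℝ).continuous.snd.comp_continuousOn bundle_continuous

lemma mfderiv_chartFrame {p x : M} (hx : x ∈ (chartAt (EuclideanSpace ℝ (Fin d)) p).source)
    (v : EuclideanSpace ℝ (Fin d)) :
    (mfderiv (𝓡 d) 𝓘(ℝ, EuclideanSpace ℝ (Fin d)) (extChartAt (𝓡 d) p) x)
      (chartFrame d p x v) = v := by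
  rw [← TangentBundle.continuousLinearMapAt_trivializationAt hx]
  exact Bundle.Trivialization.continuousLinearMapAt_symmL _ hx v

lemma chartFrame_mfderiv {p x : M} (hx : x ∈ (chartAt (EuclideanSpace ℝ (Fin d)) p).source)
    (w : TangentSpace (𝓡 d) x) :
    chartFrame d p x ((mfderiv (𝓡 d) 𝓘(ℝ, EuclideanSpace ℝ (Fin d)) (extChartAt (𝓡 d) p) x) w)
      = w := by
  rw [← TangentBundle.continuousLinearMapAt_trivializationAt hx]
  exact Bundle.Trivialization.symmL_continuousLinearMapAt _ hx w

lemma chartFrame_eq_zero {p x : M} (hx : x ∈ (chartAt (EuclideanSpace ℝ (Fin d)) p).source)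
    {v : EuclideanSpace ℝ (Fin d)} : chartFrame d p x v = 0 ↔ v = 0 := by
  refine ⟨fun h ↦ ?_, by rintro rfl; exact map_zero _⟩
  have := mfderiv_chartFrame hx v
  rw [h, map_zero] at this
  exact this.symm

lemma hasDerivWithinAt_extChartAt_comp {p : M} {γ : ℝ → M} {J : Set ℝ} {s : ℝ}
    (hγ : MDifferentiableWithinAt 𝓘(ℝ, ℝ) (𝓡 d) γ J s)
    (hs : γ s ∈ (chartAt (EuclideanSpace ℝ (Fin d)) p).source) :
    HasDerivWithinAt (extChartAt (𝓡 d) p ∘ γ)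
      ((mfderiv (𝓡 d) 𝓘(ℝ, EuclideanSpace ℝ (Fin d)) (extChartAt (𝓡 d) p) (γ s))
        (mfderivWithin 𝓘(ℝ, ℝ) (𝓡 d) γ J s (1 : ℝ))) J s := by
  have chain := (mdifferentiableAt_extChartAt (I := 𝓡 d) hs).hasMFDerivAt.comp_hasMFDerivWithinAt s
    hγ.hasMFDerivWithinAt
  have of_hasFDerivWithinAt : ∀ L : ℝ →L[ℝ] EuclideanSpace ℝ (Fin d),
      HasFDerivWithinAt (extChartAt (𝓡 d) p ∘ γ) L J s →
      HasDerivWithinAt (extChartAt (𝓡 d) p ∘ γ) (L 1) J s := fun L h ↦ h.hasDerivWithinAt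
  exact of_hasFDerivWithinAt _ chain.hasFDerivWithinAt

lemma mfderivWithin_extChartAt_symm_comp {p : M} {y : ℝ → EuclideanSpace ℝ (Fin d)}
    {v : EuclideanSpace ℝ (Fin d)} {J : Set ℝ} {s : ℝ} (hJ : UniqueDiffWithinAt ℝ J s)
    (hy : HasDerivWithinAt y v J s) (hs : y s ∈ (extChartAt (𝓡 d) p).target) :
    mfderivWithin 𝓘(ℝ, ℝ) (𝓡 d) ((extChartAt (𝓡 d) p).symm ∘ y) J s (1 : ℝ) =
      chartFrame d p ((extChartAt (𝓡 d) p).symm (y s)) v := by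
  have hx : (extChartAt (𝓡 d) p).symm (y s) ∈ (chartAt (EuclideanSpace ℝ (Fin d)) p).source := by
    simpa using (extChartAt (𝓡 d) p).map_target hs
  have y_deriv : HasMFDerivWithinAt 𝓘(ℝ, ℝ) 𝓘(ℝ, EuclideanSpace ℝ (Fin d)) y J s _ :=
    hy.hasFDerivWithinAt.hasMFDerivWithinAt
  have chain := (mdifferentiableWithinAt_extChartAt_symm (I := 𝓡 d) hs).hasMFDerivWithinAt.comp s
    y_deriv fun _ _ ↦ by simp
  rw [chain.mfderivWithin hJ.uniqueMDiffWithinAt, chartFrame,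
    TangentBundle.symmL_trivializationAt (I := 𝓡 d) (𝕜 := ℝ) hx,
    (extChartAt (𝓡 d) p).right_inv hs]
  exact congrArg (mfderivWithin 𝓘(ℝ, EuclideanSpace ℝ (Fin d)) (𝓡 d) (extChartAt (𝓡 d) p).symm
    (range (𝓡 d)) (y s)) (ContinuousLinearMap.toSpanSingleton_apply_one ℝ v)

end LorentzianMetric

/-! ### Causal curves -/

section CausalCurve

lemma strictMonoOn_of_locally {φ : ℝ → ℝ} {I : Set ℝ} (hI : I.OrdConnected)
    (right : ∀ t ∈ I, ∀ u ∈ I, t < u → ∃ b ∈ Ioc t u, StrictMonoOn φ (Icc t b))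
    (left : ∀ t ∈ I, ∀ u ∈ I, u < t → ∃ a ∈ Ico u t, StrictMonoOn φ (Icc a t)) :
    StrictMonoOn φ I := by
  have union {x c y : ℝ} (hxc : x ≤ c) (hcy : c ≤ y) (below : StrictMonoOn φ (Icc x c))
      (above : StrictMonoOn φ (Icc c y)) : StrictMonoOn φ (Icc x y) :=
    Icc_union_Icc_eq_Icc hxc hcy ▸ below.union above (isGreatest_Icc hxc) (isLeast_Icc hcy)
  intro x hx y hy hxy
  set A : Set ℝ := {t ∈ Icc x y | StrictMonoOn φ (Icc x t)}
  have mem_x : x ∈ A := ⟨⟨le_rfl, hxy.le⟩, by simp⟩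
  have bdd : BddAbove A := ⟨y, fun t ht ↦ ht.1.2⟩
  set c := sSup A
  have hxc : x ≤ c := le_csSup bdd mem_x
  have hcy : c ≤ y := csSup_le ⟨x, mem_x⟩ fun t ht ↦ ht.1.2
  have hcI : c ∈ I := hI.out hx hy ⟨hxc, hcy⟩
  have mono_c : StrictMonoOn φ (Icc x c) := by
    rcases hxc.eq_or_lt with hxc | hxc
    · simp [← hxc]
    obtain ⟨a, ha, mono_a⟩ := left c hcI x hx hxc
    obtain ⟨t, ht, hat⟩ := exists_lt_of_lt_csSup ⟨x, mem_x⟩ ha.2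
    exact union ha.1 ha.2.le (ht.2.mono (Icc_subset_Icc_right hat.le)) mono_a
  rcases hcy.eq_or_lt with hcy | hcy
  · rw [hcy] at mono_c
    exact mono_c ⟨le_rfl, hxy.le⟩ ⟨hxy.le, le_rfl⟩ hxy
  · obtain ⟨b, hb, mono_b⟩ := right c hcI y hy hcy
    have mem_b : b ∈ A := ⟨⟨hxc.trans hb.1.le, hb.2⟩, union hxc hb.1.le mono_c mono_b⟩
    exact absurd (le_csSup bdd mem_b) hb.1.not_ge

variable {d : ℕ} {M : Type*} [TopologicalSpace M] [ChartedSpace (EuclideanSpace ℝ (Fin d)) M]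

lemma IsFutureEndpoint.of_inter_Ici {γ : ℝ → M} {I : Set ℝ} {t₀ : ℝ} {q : M}
    (h : IsFutureEndpoint γ (I ∩ Ici t₀) q) : IsFutureEndpoint γ I q := fun V hV ↦
  let ⟨t₁, ht₁, H⟩ := h V hV
  ⟨t₁, ht₁.1, fun t ht htt ↦ H t ⟨ht, le_trans ht₁.2 htt⟩ htt⟩

lemma IsPastEndpoint.of_inter_Iic {γ : ℝ → M} {I : Set ℝ} {t₀ : ℝ} {q : M}
    (h : IsPastEndpoint γ (I ∩ Iic t₀) q) : IsPastEndpoint γ I q := fun V hV ↦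
  let ⟨t₁, ht₁, H⟩ := h V hV
  ⟨t₁, ht₁.1, fun t ht htt ↦ H t ⟨ht, le_trans htt ht₁.2⟩ htt⟩

variable [IsManifold (𝓡 d) ∞ M] {g : LorentzianMetric d M} {τ : TimeOrientation g}
  {γ γ₁ γ₂ : ℝ → M} {I J : Set ℝ} {a b c : ℝ}

namespace IsC1CausalOn

lemma mdifferentiableWithinAt (h : IsC1CausalOn τ γ a b) {s : ℝ} (hs : s ∈ Icc a b) :
    MDifferentiableWithinAt 𝓘(ℝ, ℝ) (𝓡 d) γ (Icc a b) s :=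
  (h.1 s hs).mdifferentiableWithinAt one_ne_zero

lemma mono (h : IsC1CausalOn τ γ a b) {a' b' : ℝ} (ha : a ≤ a') (hab : a' < b') (hb : b' ≤ b) :
    IsC1CausalOn τ γ a' b' := by
  have sub : Icc a' b' ⊆ Icc a b := Icc_subset_Icc ha hb
  refine ⟨h.1.mono sub, fun s hs ↦ ?_⟩
  rw [mfderivWithin_subset sub (uniqueDiffOn_Icc hab s hs).uniqueMDiffWithinAt
    (h.mdifferentiableWithinAt (sub hs))]
  exact h.2 s (sub hs)

lemma isCausalCurveOn (h : IsC1CausalOn τ γ a b) : IsCausalCurveOn τ γ (Icc a b) where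
  ordConnected := ordConnected_Icc
  right _ ht u hu htu := ⟨u, ⟨htu, le_rfl⟩, h.mono ht.1 htu hu.2⟩
  left _ ht u hu hut := ⟨u, ⟨le_rfl, hut⟩, h.mono hu.1 hut ht.2⟩

lemma congr (h : IsC1CausalOn τ γ₁ a b) (heq : EqOn γ₂ γ₁ (Icc a b)) :
    IsC1CausalOn τ γ₂ a b := by
  have transport {x y : M} (hxy : x = y) {v : EuclideanSpace ℝ (Fin d)}
      (hv : IsFutureCausal τ (x := x) v) : IsFutureCausal τ (x := y) v := by
    subst hxy; exact hv
  refine ⟨h.1.congr heq, fun s hs ↦ ?_⟩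
  have velocity : mfderivWithin 𝓘(ℝ, ℝ) (𝓡 d) γ₂ (Icc a b) s =
    mfderivWithin 𝓘(ℝ, ℝ) (𝓡 d) γ₁ (Icc a b) s := mfderivWithin_congr heq (heq hs)
  rw [velocity]
  exact transport (heq hs).symm (h.2 s hs)

lemma comp_add_const (h : IsC1CausalOn τ γ a b) (hab : a < b) (c : ℝ) :
    IsC1CausalOn τ (fun t ↦ γ (t + c)) (a - c) (b - c) := by
  have mapsTo : MapsTo (fun t : ℝ ↦ t + c) (Icc (a - c) (b - c)) (Icc a b) :=
    fun t ht ↦ ⟨by linarith [ht.1], by linarith [ht.2]⟩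
  refine ⟨h.1.comp (contMDiff_iff_contDiff.2 (by fun_prop)).contMDiffOn mapsTo, fun s hs ↦ ?_⟩
  have shift : HasMFDerivWithinAt 𝓘(ℝ, ℝ) 𝓘(ℝ, ℝ) (fun t : ℝ ↦ t + c) (Icc (a - c) (b - c)) s
      (ContinuousLinearMap.id ℝ ℝ) :=
    ((hasFDerivAt_id s).add_const c).hasFDerivWithinAt.hasMFDerivWithinAt
  have velocity : mfderivWithin 𝓘(ℝ, ℝ) (𝓡 d) (fun t ↦ γ (t + c)) (Icc (a - c) (b - c)) s =
      mfderivWithin 𝓘(ℝ, ℝ) (𝓡 d) γ (Icc a b) (s + c) :=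
    ((h.mdifferentiableWithinAt (mapsTo hs)).hasMFDerivWithinAt.comp s shift
      mapsTo.subset_preimage).mfderivWithin
      (uniqueDiffOn_Icc (by linarith) s hs).uniqueMDiffWithinAt
  rw [velocity]
  exact h.2 _ (mapsTo hs)

end IsC1CausalOn

namespace IsCausalCurveOn

lemma mono (h : IsCausalCurveOn τ γ I) (hJ : J.OrdConnected) (hJI : J ⊆ I) :
    IsCausalCurveOn τ γ J where
  ordConnected := hJ
  right t ht u hu htu := h.right t (hJI ht) u (hJI hu) htu
  left t ht u hu hut := h.left t (hJI ht) u (hJI hu) hut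

lemma comp_add_const (h : IsCausalCurveOn τ γ (Icc a b)) (c : ℝ) :
    IsCausalCurveOn τ (fun t ↦ γ (t + c)) (Icc (a - c) (b - c)) where
  ordConnected := ordConnected_Icc
  right t ht u hu htu := by
    obtain ⟨b', hb', C1⟩ := h.right (t + c) ⟨by linarith [ht.1], by linarith [ht.2]⟩ (u + c)
      ⟨by linarith [hu.1], by linarith [hu.2]⟩ (by linarith)
    refine ⟨b' - c, ⟨by linarith [hb'.1], by linarith [hb'.2]⟩, ?_⟩
    simpa only [add_sub_cancel_right] using C1.comp_add_const hb'.1 c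
  left t ht u hu hut := by
    obtain ⟨a', ha', C1⟩ := h.left (t + c) ⟨by linarith [ht.1], by linarith [ht.2]⟩ (u + c)
      ⟨by linarith [hu.1], by linarith [hu.2]⟩ (by linarith)
    refine ⟨a' - c, ⟨by linarith [ha'.1], by linarith [ha'.2]⟩, ?_⟩
    simpa only [add_sub_cancel_right] using C1.comp_add_const ha'.2 c

lemma congr (h : IsCausalCurveOn τ γ₁ I) (heq : EqOn γ₂ γ₁ I) : IsCausalCurveOn τ γ₂ I where
  ordConnected := h.ordConnected
  right t ht u hu htu := by
    obtain ⟨b, hb, C1⟩ := h.right t ht u hu htu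
    exact ⟨b, hb,
      C1.congr (heq.mono ((Icc_subset_Icc_right hb.2).trans (h.ordConnected.out ht hu)))⟩
  left t ht u hu hut := by
    obtain ⟨a, ha, C1⟩ := h.left t ht u hu hut
    exact ⟨a, ha,
      C1.congr (heq.mono ((Icc_subset_Icc_left ha.1).trans (h.ordConnected.out hu ht)))⟩

lemma union (h₁ : IsCausalCurveOn τ γ (Icc a b)) (h₂ : IsCausalCurveOn τ γ (Icc b c)) :
    IsCausalCurveOn τ γ (Icc a c) where
  ordConnected := ordConnected_Icc
  right t ht u hu htu := by
    rcases lt_or_ge t b with htb | hbt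
    · obtain ⟨b', hb', C1⟩ := h₁.right t ⟨ht.1, htb.le⟩ (min u b)
        ⟨ht.1.trans (le_min htu.le htb.le), min_le_right _ _⟩ (lt_min htu htb)
      exact ⟨b', ⟨hb'.1, hb'.2.trans (min_le_left _ _)⟩, C1⟩
    · exact h₂.right t ⟨hbt, ht.2⟩ u ⟨hbt.trans htu.le, hu.2⟩ htu
  left t ht u hu hut := by
    rcases lt_or_ge b t with hbt | htb
    · obtain ⟨a', ha', C1⟩ := h₂.left t ⟨hbt.le, ht.2⟩ (max u b)
        ⟨le_max_right _ _, (max_le hut.le hbt.le).trans ht.2⟩ (max_lt hut hbt)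
      exact ⟨a', ⟨(le_max_left _ _).trans ha'.1, ha'.2⟩, C1⟩
    · exact h₁.left t ⟨ht.1, htb⟩ u ⟨hu.1, hut.le.trans htb⟩ hut

lemma exists_concat {a' b' : ℝ} (hab : a < b) (hab' : a' < b')
    (h₁ : IsCausalCurveOn τ γ₁ (Icc a b)) (h₂ : IsCausalCurveOn τ γ₂ (Icc a' b'))
    (meet : γ₁ b = γ₂ a') :
    ∃ (γ : ℝ → M) (c : ℝ), a < c ∧ IsCausalCurveOn τ γ (Icc a c) ∧ γ a = γ₁ a ∧
      γ c = γ₂ b' := by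
  classical
  set γ : ℝ → M := fun t ↦ if t ≤ b then γ₁ t else γ₂ (t + (a' - b)) with hγ
  have eqOn₁ : EqOn γ γ₁ (Icc a b) := fun t ht ↦ if_pos ht.2
  have eqOn₂ : EqOn γ (fun t ↦ γ₂ (t + (a' - b))) (Icc b (b' - (a' - b))) := by
    intro t ht
    rcases ht.1.eq_or_lt with rfl | hbt
    · simp [hγ, meet]
    · exact if_neg hbt.not_ge
  have shifted := h₂.comp_add_const (a' - b)
  rw [sub_sub_cancel] at shifted
  refine ⟨γ, b' - (a' - b), by linarith, (h₁.congr eqOn₁).union (shifted.congr eqOn₂),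
    eqOn₁ ⟨le_rfl, hab.le⟩, ?_⟩
  rw [eqOn₂ ⟨by linarith, le_rfl⟩]
  simp

lemma continuousOn (h : IsCausalCurveOn τ γ I) : ContinuousOn γ I := by
  intro t ht
  have left_continuous : ContinuousWithinAt γ (I ∩ Iic t) t := by
    by_cases! hu : ∃ u ∈ I, u < t
    · obtain ⟨u, hu, hut⟩ := hu
      obtain ⟨a, ha, C1⟩ := h.left t ht u hu hut
      refine (C1.1.continuousOn t ⟨ha.2.le, le_rfl⟩).mono_of_mem_nhdsWithin ?_
      filter_upwards [self_mem_nhdsWithin, mem_nhdsWithin_of_mem_nhds (Ioi_mem_nhds ha.2)]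
        with s hs has using ⟨le_of_lt has, hs.2⟩
    · have sub : I ∩ Iic t ⊆ {t} := fun s hs ↦ le_antisymm hs.2 (hu s hs.1)
      exact (continuousWithinAt_singleton (f := γ) (x := t)).mono sub
  have right_continuous : ContinuousWithinAt γ (I ∩ Ici t) t := by
    by_cases! hu : ∃ u ∈ I, t < u
    · obtain ⟨u, hu, htu⟩ := hu
      obtain ⟨b, hb, C1⟩ := h.right t ht u hu htu
      refine (C1.1.continuousOn t ⟨le_rfl, hb.1.le⟩).mono_of_mem_nhdsWithin ?_
      filter_upwards [self_mem_nhdsWithin, mem_nhdsWithin_of_mem_nhds (Iio_mem_nhds hb.1)]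
        with s hs hsb using ⟨hs.2, le_of_lt hsb⟩
    · have sub : I ∩ Ici t ⊆ {t} := fun s hs ↦ le_antisymm (hu s hs.1) hs.2
      exact (continuousWithinAt_singleton (f := γ) (x := t)).mono sub
  simpa only [← inter_union_distrib_left, Iic_union_Ici, inter_univ]
    using left_continuous.union right_continuous

end IsCausalCurveOn

lemma strictMonoOn_comp_of_locally {f : M → ℝ}
    (hf : ∀ x, ∃ V ∈ 𝓝 x, ∀ (γ : ℝ → M) (J : Set ℝ), IsCausalCurveOn τ γ J → MapsTo γ J V →
      StrictMonoOn (f ∘ γ) J) (hγ : IsCausalCurveOn τ γ I) : StrictMonoOn (f ∘ γ) I := by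
  have near : ∀ t ∈ I, ∃ ε > 0, StrictMonoOn (f ∘ γ) (I ∩ ball t ε) := by
    intro t ht
    obtain ⟨V, hV, mono⟩ := hf (γ t)
    obtain ⟨ε, hε, sub⟩ := mem_nhdsWithin_iff.1
      ((hγ.continuousOn t ht).preimage_mem_nhdsWithin hV)
    refine ⟨ε, hε, mono γ _ (hγ.mono ?_ inter_subset_left) fun s hs ↦ sub ⟨hs.2, hs.1⟩⟩
    rw [Real.ball_eq_Ioo]
    exact hγ.ordConnected.inter ordConnected_Ioo
  refine strictMonoOn_of_locally hγ.ordConnected (fun t ht u hu htu ↦ ?_) fun t ht u hu hut ↦ ?_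
  · obtain ⟨ε, hε, mono⟩ := near t ht
    refine ⟨min u (t + ε / 2), ⟨lt_min htu (by linarith), min_le_left _ _⟩, mono.mono fun s hs ↦
      ⟨hγ.ordConnected.out ht hu ⟨hs.1, hs.2.trans (min_le_left _ _)⟩, ?_⟩⟩
    rw [Real.ball_eq_Ioo]
    exact ⟨by linarith [hs.1], by linarith [hs.2.trans (min_le_right _ _)]⟩
  · obtain ⟨ε, hε, mono⟩ := near t ht
    refine ⟨max u (t - ε / 2), ⟨le_max_left _ _, max_lt hut (by linarith)⟩, mono.mono fun s hs ↦
      ⟨hγ.ordConnected.out hu ht ⟨(le_max_left _ _).trans hs.1, hs.2⟩, ?_⟩⟩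
    rw [Real.ball_eq_Ioo]
    exact ⟨by linarith [(le_max_right _ _).trans hs.1], by linarith [hs.2]⟩

lemma causalFuture_subset_of_subset {S S' : Set M} (h : S' ⊆ causalFuture τ S) :
    causalFuture τ S' ⊆ causalFuture τ S := by
  rintro q ⟨p, hp, hpq⟩
  obtain ⟨r, hr, hrp⟩ := h hp
  refine ⟨r, hr, ?_⟩
  rcases hpq with rfl | ⟨γ₂, a', b', hab', h₂, rfl, rfl⟩
  · exact hrp
  rcases hrp with rfl | ⟨γ₁, a, b, hab, h₁, rfl, meet⟩
  · exact Or.inr ⟨γ₂, a', b', hab', h₂, rfl, rfl⟩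
  · obtain ⟨γ, c, hac, hγ, start, finish⟩ := h₁.exists_concat hab hab' h₂ meet
    exact Or.inr ⟨γ, a, c, hac, hγ, start, finish⟩

lemma causalPast_subset_of_subset {S S' : Set M} (h : S' ⊆ causalPast τ S) :
    causalPast τ S' ⊆ causalPast τ S := by
  rintro q ⟨p, hp, hpq⟩
  obtain ⟨r, hr, hrp⟩ := h hp
  refine ⟨r, hr, ?_⟩
  rcases hpq with rfl | ⟨γ₁, a, b, hab, h₁, rfl, meet⟩
  · exact hrp
  rcases hrp with rfl | ⟨γ₂, a', b', hab', h₂, rfl, rfl⟩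
  · exact Or.inr ⟨γ₁, a, b, hab, h₁, rfl, meet⟩
  · obtain ⟨γ, c, hac, hγ, start, finish⟩ := h₁.exists_concat hab hab' h₂ meet
    exact Or.inr ⟨γ, a, c, hac, hγ, start, finish⟩

end CausalCurve

/-! ### Coordinate balls adapted to the causal cones -/

variable {d : ℕ} {M : Type*} [TopologicalSpace M] [ChartedSpace (EuclideanSpace ℝ (Fin d)) M]

variable (d) in
/-- The open coordinate ball of radius `ρ` around `p`, as a subset of the spacetime. -/
def coordBall (p : M) (ρ : ℝ) : Set M :=
  (extChartAt (𝓡 d) p).source ∩ extChartAt (𝓡 d) p ⁻¹' ball (extChartAt (𝓡 d) p p) ρ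

variable (d) in
/-- The closed coordinate ball of radius `ρ` around `p`, as a subset of the spacetime. -/
def coordClosedBall (p : M) (ρ : ℝ) : Set M :=
  (extChartAt (𝓡 d) p).symm '' closedBall (extChartAt (𝓡 d) p p) ρ

lemma isOpen_coordBall (p : M) (ρ : ℝ) : IsOpen (coordBall d p ρ) :=
  isOpen_extChartAt_preimage' p isOpen_ball

variable [IsManifold (𝓡 d) ∞ M] {g : LorentzianMetric d M}

namespace TimeOrientation

variable (τ : TimeOrientation g)

lemma isFutureCausal_iff {x : M} {e v : TangentSpace (𝓡 d) x} (he : g.form x e e < 0)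
    (he' : g.form x e (τ.field x) < 0) :
    IsFutureCausal τ v ↔ v ≠ 0 ∧ g.form x v v ≤ 0 ∧ g.form x v e < 0 :=
  ⟨fun ⟨hv0, hv, hv'⟩ ↦ ⟨hv0, hv, g.neg_of_neg (τ.timelike x) he (by rwa [g.symm]) hv hv'⟩,
    fun ⟨hv0, hv, hv'⟩ ↦ ⟨hv0, hv, g.neg_of_neg he (τ.timelike x) he' hv hv'⟩⟩

/-- The coordinates, in the chart at `p`, of the time orientation at `p`. -/
noncomputable def axis (p : M) : EuclideanSpace ℝ (Fin d) :=
  mfderiv (𝓡 d) 𝓘(ℝ, EuclideanSpace ℝ (Fin d)) (extChartAt (𝓡 d) p) p (τ.field p)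

lemma chartFrame_axis (p : M) : chartFrame d p p (τ.axis p) = τ.field p :=
  chartFrame_mfderiv (mem_chart_source (EuclideanSpace ℝ (Fin d)) p) _

lemma eventually_form_axis_neg (p : M) :
    ∀ᶠ x in 𝓝 p, g.form x (chartFrame d p x (τ.axis p)) (τ.field x) < 0 := by
  have continuousAt : ContinuousAt
      (fun x ↦ g.form x (chartFrame d p x (τ.axis p)) (τ.field x)) p :=
    (continuousOn_form_chartFrame τ p _).continuousAt (chart_source_mem_nhds _ p)
  exact continuousAt.eventually
    (gt_mem_nhds (by beta_reduce; rw [chartFrame_axis]; exact τ.timelike p))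

lemma exists_coneBounds_chartMetric (p : M) {V : Set (EuclideanSpace ℝ (Fin d))}
    (hV : V ∈ 𝓝 (extChartAt (𝓡 d) p p)) :
    ∃ R K m c, ball (extChartAt (𝓡 d) p p) R ⊆ V ∧
      ConeBounds (chartMetric g p) (extChartAt (𝓡 d) p p) (τ.axis p) R K m c := by
  have chartMetric_center (v w) : chartMetric g p (extChartAt (𝓡 d) p p) v w =
      g.form p (chartFrame d p p v) (chartFrame d p p w) := by
    rw [chartMetric_apply, extChartAt_to_inv p]
  have smooth : ContDiffAt ℝ 1 (chartMetric g p) (extChartAt (𝓡 d) p p) :=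
    ((contDiffOn_chartMetric p).contDiffAt (extChartAt_target_mem_nhds p)).of_le (by simp)
  obtain ⟨K, t, ht, lipschitz⟩ := smooth.exists_lipschitzOnWith
  obtain ⟨R₀, hR₀, sub⟩ := Metric.mem_nhds_iff.1 (inter_mem hV ht)
  obtain ⟨R, m, c, hRR₀, H⟩ := exists_coneBounds (G := chartMetric g p) (e := τ.axis p) hR₀
    K.coe_nonneg (fun y _ v w ↦ by rw [chartMetric_apply, chartMetric_apply, g.symm])
    (fun y hy y' hy' ↦ by
      simpa only [dist_eq_norm] using lipschitz.dist_le_mul y (sub hy).2 y' (sub hy').2)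
    (by rw [chartMetric_center, chartFrame_axis]; exact τ.timelike p)
    (fun u hu hu0 ↦ by
      rw [chartMetric_center] at hu ⊢
      rw [chartFrame_axis, g.symm] at hu
      refine g.pos_of_orthogonal (τ.timelike p) hu ?_
      rwa [ne_eq, chartFrame_eq_zero (mem_chart_source (EuclideanSpace ℝ (Fin d)) p)])
  exact ⟨R, K, m, c, fun y hy ↦ (sub (ball_subset_ball hRR₀ hy)).1, H⟩

end TimeOrientation

/-- A coordinate ball around `p`, inside `U`, on which the future causal cones are given by a
`ConeField`. -/
structure ConeChart (τ : TimeOrientation g) (p : M) (U : Set M) where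
  R : ℝ
  F : ConeField (EuclideanSpace ℝ (Fin d)) (extChartAt (𝓡 d) p p) R
  R_pos : 0 < R
  ball_subset : ball (extChartAt (𝓡 d) p p) R ⊆ (extChartAt (𝓡 d) p).target
  symm_mem : ∀ y ∈ ball (extChartAt (𝓡 d) p p) R, (extChartAt (𝓡 d) p).symm y ∈ U
  isFutureCausal_iff : ∀ y ∈ ball (extChartAt (𝓡 d) p p) R, ∀ v,
    IsFutureCausal τ (chartFrame d p ((extChartAt (𝓡 d) p).symm y) v) ↔ v ≠ 0 ∧ 0 ≤ F.f y v

lemma exists_coneChart (τ : TimeOrientation g) (p : M) {U : Set M} (hU : U ∈ 𝓝 p) :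
    Nonempty (ConeChart τ p U) := by
  have symm_tendsto : Tendsto (extChartAt (𝓡 d) p).symm (𝓝 (extChartAt (𝓡 d) p p)) (𝓝 p) := by
    simpa only [ContinuousAt, extChartAt_to_inv] using continuousAt_extChartAt_symm (I := 𝓡 d) p
  obtain ⟨R, K, m, c, sub, H⟩ := τ.exists_coneBounds_chartMetric p
    (inter_mem (extChartAt_target_mem_nhds p)
      (symm_tendsto (inter_mem hU (τ.eventually_form_axis_neg p))))
  refine ⟨⟨R, H.coneField, H.R_pos, fun y hy ↦ (sub hy).1, fun y hy ↦ (sub hy).2.1,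
    fun y hy v ↦ ?_⟩⟩
  have mem_source : (extChartAt (𝓡 d) p).symm y ∈
      (chartAt (EuclideanSpace ℝ (Fin d)) p).source := by
    simpa using (extChartAt (𝓡 d) p).map_target (sub hy).1
  have axis_timelike : chartMetric g p y (τ.axis p) (τ.axis p) < 0 :=
    neg_pos.1 (H.c_pos.trans_le (H.timelike y hy))
  rw [τ.isFutureCausal_iff axis_timelike (sub hy).2.2, ne_eq, chartFrame_eq_zero mem_source]
  exact and_congr_right fun hv ↦ (H.coneFun_nonneg_iff hy hv).symm

namespace ConeChart

variable {τ : TimeOrientation g} {p : M} {U : Set M} (κ : ConeChart τ p U)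

lemma coordBall_subset {ρ : ℝ} (hρ : ρ ≤ κ.R) : coordBall d p ρ ⊆ U := fun x hx ↦ by
  simpa only [(extChartAt (𝓡 d) p).left_inv hx.1] using κ.symm_mem _ (ball_subset_ball hρ hx.2)

lemma right_inv {y : EuclideanSpace ℝ (Fin d)} (hy : y ∈ ball (extChartAt (𝓡 d) p p) κ.R) :
    extChartAt (𝓡 d) p ((extChartAt (𝓡 d) p).symm y) = y :=
  (extChartAt (𝓡 d) p).right_inv (κ.ball_subset hy)

lemma symm_mem_coordBall {ρ : ℝ} (hρ : ρ ≤ κ.R) {y : EuclideanSpace ℝ (Fin d)}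
    (hy : y ∈ ball (extChartAt (𝓡 d) p p) ρ) : (extChartAt (𝓡 d) p).symm y ∈ coordBall d p ρ :=
  ⟨(extChartAt (𝓡 d) p).map_target (κ.ball_subset (ball_subset_ball hρ hy)), by
    rwa [mem_preimage, κ.right_inv (ball_subset_ball hρ hy)]⟩

lemma exists_hasDerivWithinAt {γ : ℝ → M} {a b : ℝ} (hγ : IsC1CausalOn τ γ a b) {s : ℝ}
    (hs : s ∈ Icc a b) (hm : γ s ∈ coordBall d p κ.R) :
    ∃ v, HasDerivWithinAt (extChartAt (𝓡 d) p ∘ γ) v (Icc a b) s ∧ v ≠ 0 ∧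
      0 ≤ κ.F.f (extChartAt (𝓡 d) p (γ s)) v := by
  have mem_source : γ s ∈ (chartAt (EuclideanSpace ℝ (Fin d)) p).source := by simpa using hm.1
  refine ⟨_, hasDerivWithinAt_extChartAt_comp (hγ.mdifferentiableWithinAt hs) mem_source,
    (κ.isFutureCausal_iff _ hm.2 _).1 ?_⟩
  suffices H : ∀ x, x = γ s → IsFutureCausal τ (chartFrame d p x
      ((mfderiv (𝓡 d) 𝓘(ℝ, EuclideanSpace ℝ (Fin d)) (extChartAt (𝓡 d) p) (γ s))
        (mfderivWithin 𝓘(ℝ, ℝ) (𝓡 d) γ (Icc a b) s (1 : ℝ)))) from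
    H _ ((extChartAt (𝓡 d) p).left_inv hm.1)
  rintro _ rfl
  rw [chartFrame_mfderiv mem_source]
  exact hγ.2 s hs

lemma isC1CausalOn_symm_comp {y y' : ℝ → EuclideanSpace ℝ (Fin d)} {a b : ℝ} (hab : a < b)
    (hy : ∀ s ∈ Icc a b, HasDerivWithinAt y (y' s) (Icc a b) s)
    (hy' : ContinuousOn y' (Icc a b))
    (causal : ∀ s ∈ Icc a b, y s ∈ ball (extChartAt (𝓡 d) p p) κ.R ∧ y' s ≠ 0 ∧
      0 ≤ κ.F.f (y s) (y' s)) :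
    IsC1CausalOn τ ((extChartAt (𝓡 d) p).symm ∘ y) a b := by
  have unique := uniqueDiffOn_Icc hab
  refine ⟨?_, fun s hs ↦ ?_⟩
  · have y_C1 : ContDiffOn ℝ 1 y (Icc a b) := by
      rw [show (1 : WithTop ℕ∞) = 0 + 1 from (zero_add _).symm,
        contDiffOn_succ_iff_derivWithin unique]
      refine ⟨fun s hs ↦ (hy s hs).differentiableWithinAt, by simp, ?_⟩
      rw [contDiffOn_zero]
      exact hy'.congr fun s hs ↦ (hy s hs).derivWithin (unique s hs)
    exact ((contMDiffOn_extChartAt_symm (n := ∞) p).of_le (by simp)).comp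
      (contMDiffOn_iff_contDiffOn.2 y_C1) fun s hs ↦ κ.ball_subset (causal s hs).1
  · rw [mfderivWithin_extChartAt_symm_comp (unique s hs) (hy s hs) (κ.ball_subset (causal s hs).1)]
    exact (κ.isFutureCausal_iff _ (causal s hs).1 _).2 (causal s hs).2

lemma increasing {T : M → ℝ} (hT : IsTimeFunction τ T) :
    κ.F.Increasing (T ∘ (extChartAt (𝓡 d) p).symm) := by
  intro y y' a b hab hy hy' causal
  exact hT.strictMonoOn _ _ (κ.isC1CausalOn_symm_comp hab hy hy' causal).isCausalCurveOn
    ⟨le_rfl, hab.le⟩ ⟨hab.le, le_rfl⟩ hab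

section

variable {ρ : ℝ} {h : EuclideanSpace ℝ (Fin d) → ℝ} {γ : ℝ → M}

lemma strictMonoOn_Icc_of_fderiv_pos (hρ : ρ ≤ κ.R) (hd : Differentiable ℝ h)
    (hpos : ∀ q ∈ ball (extChartAt (𝓡 d) p p) ρ, ∀ v, v ≠ 0 → 0 ≤ κ.F.f q v → 0 < fderiv ℝ h q v)
    {a b : ℝ} (hγ : IsC1CausalOn τ γ a b) (hm : MapsTo γ (Icc a b) (coordBall d p ρ)) :
    StrictMonoOn (h ∘ extChartAt (𝓡 d) p ∘ γ) (Icc a b) := by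
  have derivative : ∀ s ∈ Icc a b, ∃ x, 0 < x ∧
      HasDerivWithinAt (h ∘ extChartAt (𝓡 d) p ∘ γ) x (Icc a b) s := by
    intro s hs
    obtain ⟨v, hv, hv0, hvf⟩ := κ.exists_hasDerivWithinAt hγ hs
      ⟨(hm hs).1, ball_subset_ball hρ (hm hs).2⟩
    exact ⟨_, hpos _ (hm hs).2 v hv0 hvf, (hd _).hasFDerivAt.comp_hasDerivWithinAt s hv⟩
  choose! x x_pos hx using derivative
  refine strictMonoOn_of_deriv_pos (convex_Icc a b)
    (fun s hs ↦ (hx s hs).continuousWithinAt) fun s hs ↦ ?_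
  rw [interior_Icc] at hs
  rw [((hx s (Ioo_subset_Icc_self hs)).hasDerivAt (Icc_mem_nhds hs.1 hs.2)).deriv]
  exact x_pos s (Ioo_subset_Icc_self hs)

lemma strictMonoOn_of_fderiv_pos (hρ : ρ ≤ κ.R) (hd : Differentiable ℝ h)
    (hpos : ∀ q ∈ ball (extChartAt (𝓡 d) p p) ρ, ∀ v, v ≠ 0 → 0 ≤ κ.F.f q v → 0 < fderiv ℝ h q v)
    {I : Set ℝ} (hγ : IsCausalCurveOn τ γ I) (hm : MapsTo γ I (coordBall d p ρ)) :
    StrictMonoOn (h ∘ extChartAt (𝓡 d) p ∘ γ) I := by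
  refine strictMonoOn_of_locally hγ.ordConnected (fun t ht u hu htu ↦ ?_) fun t ht u hu hut ↦ ?_
  · obtain ⟨b, hb, C1⟩ := hγ.right t ht u hu htu
    exact ⟨b, hb, κ.strictMonoOn_Icc_of_fderiv_pos hρ hd hpos C1
      (hm.mono_left ((Icc_subset_Icc_right hb.2).trans (hγ.ordConnected.out ht hu)))⟩
  · obtain ⟨a, ha, C1⟩ := hγ.left t ht u hu hut
    exact ⟨a, ha, κ.strictMonoOn_Icc_of_fderiv_pos hρ hd hpos C1
      (hm.mono_left ((Icc_subset_Icc_left ha.1).trans (hγ.ordConnected.out hu ht)))⟩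

end

end ConeChart

variable {τ : TimeOrientation g}

/-- A smooth cutoff function which vanishes exactly on `(-∞, -δ]` and whose slope lies between `0`
and `1`, so that subtracting it preserves monotonicity. -/
structure IsCutoff (δ : ℝ) (θ : ℝ → ℝ) : Prop where
  contDiff : ContDiff ℝ ∞ θ
  eq_zero {x : ℝ} : x ≤ -δ → θ x = 0
  pos {x : ℝ} : -δ < x → 0 < θ x
  monotone : Monotone θ
  monotone_sub : Monotone fun x ↦ x - θ x

lemma exists_deriv_smoothTransition_le : ∃ C, 0 ≤ C ∧ ∀ x, deriv Real.smoothTransition x ≤ C := by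
  have continuous : Continuous (deriv Real.smoothTransition) :=
    (Real.smoothTransition.contDiff (n := 1)).continuous_deriv le_rfl
  have support : HasCompactSupport (deriv Real.smoothTransition) := by
    refine .intro (isCompact_Icc (a := (0 : ℝ)) (b := 1)) fun x hx ↦ ?_
    rw [mem_Icc, not_and_or, not_le, not_le] at hx
    rcases hx with hx | hx
    · have eventually_zero : Real.smoothTransition =ᶠ[𝓝 x] fun _ ↦ 0 := by
        filter_upwards [Iio_mem_nhds hx] with y hy
        exact Real.smoothTransition.zero_of_nonpos (le_of_lt hy)
      rw [eventually_zero.deriv_eq, deriv_const]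
    · have eventually_one : Real.smoothTransition =ᶠ[𝓝 x] fun _ ↦ 1 := by
        filter_upwards [Ioi_mem_nhds hx] with y hy
        exact Real.smoothTransition.one_of_one_le (le_of_lt hy)
      rw [eventually_one.deriv_eq, deriv_const]
  obtain ⟨C, hC⟩ := support.exists_bound_of_continuous continuous
  exact ⟨C, (norm_nonneg _).trans (hC 0), fun x ↦ (le_abs_self _).trans (hC x)⟩

lemma exists_isCutoff (δ : ℝ) : ∃ θ, IsCutoff δ θ := by
  obtain ⟨C, C_nonneg, hC⟩ := exists_deriv_smoothTransition_le
  have smooth : ContDiff ℝ ∞ Real.smoothTransition := Real.smoothTransition.contDiff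
  set c := (C + 1)⁻¹
  have c_pos : 0 < c := by positivity
  refine ⟨fun x ↦ c * Real.smoothTransition (x + δ),
    contDiff_const.mul (smooth.comp (contDiff_id.add contDiff_const)), fun {x} hx ↦ ?_,
    fun {x} hx ↦ mul_pos c_pos (Real.smoothTransition.pos_of_pos (by linarith)),
    fun x y hxy ↦ mul_le_mul_of_nonneg_left (Real.smoothTransition.monotone (by linarith)) c_pos.le,
    ?_⟩
  · rw [Real.smoothTransition.zero_of_nonpos (by linarith), mul_zero]
  · have derivative (x : ℝ) : HasDerivAt (fun x ↦ x - c * Real.smoothTransition (x + δ))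
        (1 - c * deriv Real.smoothTransition (x + δ)) x :=
      (hasDerivAt_id x).sub
        (((smooth.differentiable (by simp) (x + δ)).hasDerivAt.comp_add_const x δ).const_mul c)
    refine monotone_of_deriv_nonneg (fun x ↦ (derivative x).differentiableAt) fun x ↦ ?_
    rw [(derivative x).deriv, sub_nonneg]
    calc c * deriv Real.smoothTransition (x + δ) ≤ c * (C + 1) := by
          gcongr; linarith [hC (x + δ)]
      _ = 1 := inv_mul_cancel₀ (by positivity)

namespace IsCutoff

variable {δ : ℝ} {θ : ℝ → ℝ} (hθ : IsCutoff δ θ)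

include hθ

lemma nonneg (x : ℝ) : 0 ≤ θ x := by
  rcases le_or_gt x (-δ) with hx | hx
  · exact (hθ.eq_zero hx).ge
  · exact (hθ.pos hx).le

lemma sub_lt_sub {x y h k : ℝ} (hxy : x < y) (hhk : h < k) : x - θ (x - h) < y - θ (y - k) := by
  rcases le_total (y - k) (x - h) with H | H
  · linarith [hθ.monotone H]
  · have mono := hθ.monotone_sub H
    simp only at mono
    linarith

end IsCutoff

lemma exists_limit_of_dist_le_sub {ι E : Type*} [Preorder ι] [PseudoMetricSpace E] {K : Set E}
    (hK : IsCompact K) {m : E → ℝ} (hm : ContinuousOn m K) {y : ι → E} {J : Set ι}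
    (hJ : J.Nonempty) (hy : MapsTo y J K)
    (hdist : ∀ t ∈ J, ∀ t' ∈ J, t ≤ t' → dist (y t') (y t) ≤ m (y t') - m (y t)) :
    ∃ z ∈ K, ∀ V ∈ 𝓝 z, ∃ t₁ ∈ J, ∀ t ∈ J, t₁ ≤ t → y t ∈ V := by
  have bdd : BddAbove ((m ∘ y) '' J) := (hK.bddAbove_image hm).mono <| by
    rw [image_comp]; exact image_mono hy.image_subset
  have almost_sup (n : ℕ) : ∃ t ∈ J, sSup ((m ∘ y) '' J) - 1 / (n + 1) < m (y t) := by
    obtain ⟨_, ⟨t, ht, rfl⟩, H⟩ := exists_lt_of_lt_csSup (hJ.image (m ∘ y))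
      (sub_lt_self _ (show (0 : ℝ) < 1 / (n + 1) by positivity))
    exact ⟨t, ht, H⟩
  choose t ht hmt using almost_sup
  obtain ⟨z, hz, ψ, hψ, lim⟩ := hK.tendsto_subseq fun n ↦ hy (ht n)
  refine ⟨z, hz, fun V hV ↦ ?_⟩
  obtain ⟨ε, hε, ball_sub⟩ := Metric.mem_nhds_iff.1 hV
  have eventually_near : ∀ᶠ n in atTop, y (t (ψ n)) ∈ ball z (ε / 2) :=
    lim.eventually (ball_mem_nhds z (half_pos hε))
  have eventually_small : ∀ᶠ n : ℕ in atTop, (1 : ℝ) / (ψ n + 1) < ε / 2 :=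
    (tendsto_one_div_add_atTop_nhds_zero_nat.comp hψ.tendsto_atTop).eventually
      (gt_mem_nhds (half_pos hε))
  obtain ⟨n, near, small⟩ := (eventually_near.and eventually_small).exists
  refine ⟨t (ψ n), ht _, fun s hs hts ↦ ball_sub (mem_ball.2 ?_)⟩
  have le_sup : m (y s) ≤ sSup ((m ∘ y) '' J) := le_csSup bdd (mem_image_of_mem _ hs)
  calc dist (y s) z ≤ dist (y s) (y (t (ψ n))) + dist (y (t (ψ n))) z := dist_triangle _ _ _
    _ < ε := by linarith [hdist _ (ht (ψ n)) s hs hts, hmt (ψ n), mem_ball.1 near]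

lemma exists_pos_norm_add_smul_eq {E : Type*} [NormedAddCommGroup E] [NormedSpace ℝ E] {y v : E}
    {r : ℝ} (hy : ‖y‖ < r) (hv : v ≠ 0) : ∃ s : ℝ, 0 < s ∧ ‖y + s • v‖ = r := by
  have v_pos : 0 < ‖v‖ := norm_pos_iff.2 hv
  have S_nonneg : 0 ≤ (‖y‖ + r) / ‖v‖ :=
    div_nonneg (add_nonneg (norm_nonneg y) ((norm_nonneg y).trans hy.le)) v_pos.le
  have far : r ≤ ‖y + ((‖y‖ + r) / ‖v‖) • v‖ := by
    have triangle := norm_sub_le (y + ((‖y‖ + r) / ‖v‖) • v) y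
    rw [add_sub_cancel_left, norm_smul, Real.norm_of_nonneg S_nonneg,
      div_mul_cancel₀ _ v_pos.ne'] at triangle
    linarith
  obtain ⟨s, hs, norm_eq⟩ := intermediate_value_Icc S_nonneg
    (f := fun s : ℝ ↦ ‖y + s • v‖) (by fun_prop)
    (show r ∈ Icc _ _ from ⟨by simpa using hy.le, far⟩)
  refine ⟨s, hs.1.lt_of_ne' ?_, norm_eq⟩
  rintro rfl
  simp only [zero_smul, add_zero] at norm_eq
  exact hy.ne norm_eq

namespace ConeChart

variable {p : M} {U : Set M} (κ : ConeChart τ p U)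

lemma norm_coord_sub_le {γ : ℝ → M} {I : Set ℝ} (hγ : IsCausalCurveOn τ γ I)
    (hm : MapsTo γ I (coordBall d p κ.R)) {t t' : ℝ} (ht : t ∈ I) (ht' : t' ∈ I) (h : t ≤ t') :
    ‖extChartAt (𝓡 d) p (γ t') - extChartAt (𝓡 d) p (γ t)‖ ≤
      (κ.F.C + 1) * κ.F.l (extChartAt (𝓡 d) p (γ t')) -
        (κ.F.C + 1) * κ.F.l (extChartAt (𝓡 d) p (γ t)) := by
  obtain ⟨ξ, ξ_le_one, ξ_eq⟩ := exists_dual_vector'' ℝ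
    (extChartAt (𝓡 d) p (γ t') - extChartAt (𝓡 d) p (γ t))
  have strictMono := κ.strictMonoOn_of_fderiv_pos le_rfl (h := ⇑((κ.F.C + 1) • κ.F.l - ξ))
    (ContinuousLinearMap.differentiable _) (fun q hq v hv0 hv ↦ ?_) hγ hm
  · have mono := strictMono.monotoneOn ht ht' h
    simp only [Function.comp_apply, FunLike.coe_sub, FunLike.coe_smul, Pi.sub_apply,
      Pi.smul_apply, smul_eq_mul] at mono
    rw [map_sub] at ξ_eq
    simp only [RCLike.ofReal_real_eq_id, id_eq] at ξ_eq
    linarith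
  · rw [ContinuousLinearMap.fderiv]
    simp only [FunLike.coe_sub, FunLike.coe_smul, Pi.sub_apply, Pi.smul_apply, smul_eq_mul]
    have norm_le := κ.F.norm_le_of_f_nonneg hq hv
    have ξ_le : ξ v ≤ 1 * ‖v‖ := (le_abs_self _).trans (ξ.le_of_opNorm_le ξ_le_one v)
    have l_pos := κ.F.l_pos_of_f_nonneg hq hv0 hv
    linarith

variable {κ} {ρ : ℝ}

lemma mem_coordClosedBall_iff {ρ' : ℝ} (hρ : ρ < ρ') (hρ' : ρ' ≤ κ.R) {x : M} :
    x ∈ coordClosedBall d p ρ ↔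
      x ∈ coordBall d p ρ' ∧ ‖extChartAt (𝓡 d) p x - extChartAt (𝓡 d) p p‖ ≤ ρ := by
  constructor
  · rintro ⟨y, hy, rfl⟩
    have hy' := closedBall_subset_ball hρ hy
    refine ⟨κ.symm_mem_coordBall hρ' hy', ?_⟩
    rw [κ.right_inv (ball_subset_ball hρ' hy')]
    exact mem_closedBall_iff_norm.1 hy
  · rintro ⟨hx, hn⟩
    exact ⟨_, mem_closedBall_iff_norm.2 hn, (extChartAt (𝓡 d) p).left_inv hx.1⟩

lemma isCompact_coordClosedBall (hρ : ρ < κ.R) : IsCompact (coordClosedBall d p ρ) :=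
  (isCompact_closedBall _ _).image_of_continuousOn
    ((continuousOn_extChartAt_symm p).mono ((closedBall_subset_ball hρ).trans κ.ball_subset))

section endpoints

variable {γ : ℝ → M} {J : Set ℝ}

lemma exists_isFutureEndpoint (hρ : ρ < κ.R) (hγ : IsCausalCurveOn τ γ J) (hJ : J.Nonempty)
    (hm : MapsTo γ J (coordClosedBall d p ρ)) : ∃ q, IsFutureEndpoint γ J q := by
  have hm' : MapsTo γ J (coordBall d p κ.R) := fun t ht ↦
    ((mem_coordClosedBall_iff hρ le_rfl).1 (hm ht)).1
  obtain ⟨z, hz, lim⟩ := exists_limit_of_dist_le_sub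
    (isCompact_closedBall (extChartAt (𝓡 d) p p) ρ)
    (m := fun y ↦ (κ.F.C + 1) * κ.F.l y) (by fun_prop) (y := extChartAt (𝓡 d) p ∘ γ) hJ
    (fun t ht ↦ mem_closedBall_iff_norm.2 ((mem_coordClosedBall_iff hρ le_rfl).1 (hm ht)).2)
    fun t ht t' ht' h ↦ (dist_eq_norm _ _).trans_le (κ.norm_coord_sub_le hγ hm' ht ht' h)
  refine ⟨(extChartAt (𝓡 d) p).symm z, fun V hV ↦ ?_⟩
  obtain ⟨t₁, ht₁, H⟩ := lim _ ((continuousAt_extChartAt_symm''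
    (κ.ball_subset (closedBall_subset_ball hρ hz))).preimage_mem_nhds hV)
  refine ⟨t₁, ht₁, fun t ht htt ↦ ?_⟩
  simpa only [mem_preimage, Function.comp_apply, (extChartAt (𝓡 d) p).left_inv (hm' ht).1]
    using H t ht htt

lemma exists_isPastEndpoint (hρ : ρ < κ.R) (hγ : IsCausalCurveOn τ γ J) (hJ : J.Nonempty)
    (hm : MapsTo γ J (coordClosedBall d p ρ)) : ∃ q, IsPastEndpoint γ J q := by
  have hm' : MapsTo γ J (coordBall d p κ.R) := fun t ht ↦
    ((mem_coordClosedBall_iff hρ le_rfl).1 (hm ht)).1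
  obtain ⟨z, hz, lim⟩ := exists_limit_of_dist_le_sub (ι := ℝᵒᵈ)
    (isCompact_closedBall (extChartAt (𝓡 d) p p) ρ)
    (m := fun y ↦ -((κ.F.C + 1) * κ.F.l y)) (by fun_prop)
    (y := extChartAt (𝓡 d) p ∘ γ ∘ OrderDual.ofDual) (J := OrderDual.ofDual ⁻¹' J) hJ
    (fun t ht ↦ mem_closedBall_iff_norm.2 ((mem_coordClosedBall_iff hρ le_rfl).1 (hm ht)).2)
    fun t ht t' ht' h ↦ by
      rw [dist_comm, dist_eq_norm, neg_sub_neg]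
      exact κ.norm_coord_sub_le hγ hm' ht' ht h
  refine ⟨(extChartAt (𝓡 d) p).symm z, fun V hV ↦ ?_⟩
  obtain ⟨t₁, ht₁, H⟩ := lim _ ((continuousAt_extChartAt_symm''
    (κ.ball_subset (closedBall_subset_ball hρ hz))).preimage_mem_nhds hV)
  refine ⟨OrderDual.ofDual t₁, ht₁, fun t ht htt ↦ ?_⟩
  simpa only [mem_preimage, Function.comp_apply, OrderDual.ofDual_toDual,
    (extChartAt (𝓡 d) p).left_inv (hm' ht).1] using H (OrderDual.toDual t) ht htt

end endpoints

section inextendible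

variable {γ : ℝ → M} {I : Set ℝ} {t₀ : ℝ}

lemma exists_ge_notMem_coordClosedBall (hρ : ρ < κ.R) (hγ : IsInextendibleCausalCurve τ γ I)
    (ht₀ : t₀ ∈ I) : ∃ t ∈ I, t₀ ≤ t ∧ γ t ∉ coordClosedBall d p ρ := by
  by_contra! H
  obtain ⟨q, hq⟩ := exists_isFutureEndpoint hρ
    (hγ.1.mono (hγ.1.ordConnected.inter ordConnected_Ici) inter_subset_left)
    ⟨t₀, ht₀, self_mem_Ici⟩ fun t ht ↦ H t ht.1 ht.2
  exact (hγ.2 q).1 hq.of_inter_Ici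

lemma exists_le_notMem_coordClosedBall (hρ : ρ < κ.R) (hγ : IsInextendibleCausalCurve τ γ I)
    (ht₀ : t₀ ∈ I) : ∃ t ∈ I, t ≤ t₀ ∧ γ t ∉ coordClosedBall d p ρ := by
  by_contra! H
  obtain ⟨q, hq⟩ := exists_isPastEndpoint hρ
    (hγ.1.mono (hγ.1.ordConnected.inter ordConnected_Iic) inter_subset_left)
    ⟨t₀, ht₀, self_mem_Iic⟩ fun t ht ↦ H t ht.1 ht.2
  exact (hγ.2 q).2 hq.of_inter_Iic

end inextendible

variable (κ) in
lemma isC1CausalOn_symm_line {y : EuclideanSpace ℝ (Fin d)} {a b : ℝ} (hab : a < b)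
    (hy : ∀ s ∈ Icc a b, y + s • κ.F.e ∈ ball (extChartAt (𝓡 d) p p) κ.R) :
    IsC1CausalOn τ ((extChartAt (𝓡 d) p).symm ∘ fun s : ℝ ↦ y + s • κ.F.e) a b :=
  κ.isC1CausalOn_symm_comp hab
    (fun s _ ↦ by
      simpa using (((hasDerivAt_id s).smul_const κ.F.e).const_add y).hasDerivWithinAt)
    continuousOn_const
    fun s hs ↦ ⟨hy s hs, κ.F.e_ne_zero κ.R_pos, κ.F.κ_pos.le.trans (κ.F.interior _ (hy s hs))⟩

lemma exists_isC1CausalOn_notMem_coordClosedBall (hρ : ρ < κ.R) {q : M}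
    (hq : q ∈ coordClosedBall d p ρ) :
    ∃ (γ : ℝ → M) (a b : ℝ), a < 0 ∧ 0 < b ∧ IsC1CausalOn τ γ a b ∧ γ 0 = q ∧
      γ a ∉ coordClosedBall d p ρ ∧ γ b ∉ coordClosedBall d p ρ := by
  obtain ⟨y, hy, rfl⟩ := hq
  rw [mem_closedBall_iff_norm] at hy
  set o := extChartAt (𝓡 d) p p
  obtain ⟨ρ', hρρ', hρ'⟩ := exists_between hρ
  have e_ne : κ.F.e ≠ 0 := κ.F.e_ne_zero κ.R_pos
  obtain ⟨b, hb, norm_b⟩ := exists_pos_norm_add_smul_eq (hy.trans_lt hρρ') e_ne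
  obtain ⟨a, ha, norm_a⟩ := exists_pos_norm_add_smul_eq (hy.trans_lt hρρ') (neg_ne_zero.2 e_ne)
  rw [smul_neg, ← neg_smul] at norm_a
  rw [sub_add_eq_add_sub] at norm_a norm_b
  have line_mem : ∀ s ∈ Icc (-a) b, y + s • κ.F.e ∈ ball o κ.R := by
    intro s hs
    have convex : Convex ℝ ((fun s : ℝ ↦ y + s • κ.F.e) ⁻¹' closedBall o ρ') :=
      (convex_closedBall o ρ').affine_preimage
        (AffineMap.const ℝ ℝ y + (LinearMap.toSpanSingleton ℝ _ κ.F.e).toAffineMap)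
    exact closedBall_subset_ball hρ' <| convex.ordConnected.out
      (mem_closedBall_iff_norm.2 norm_a.le) (mem_closedBall_iff_norm.2 norm_b.le) hs
  have notMem : ∀ s ∈ Icc (-a) b, ‖y + s • κ.F.e - o‖ = ρ' →
      (extChartAt (𝓡 d) p).symm (y + s • κ.F.e) ∉ coordClosedBall d p ρ := by
    intro s hs norm_eq mem
    have norm_le := ((mem_coordClosedBall_iff hρ le_rfl).1 mem).2
    rw [κ.right_inv (line_mem s hs), norm_eq] at norm_le
    exact hρρ'.not_ge norm_le
  have hab : -a < b := by linarith
  exact ⟨_, -a, b, neg_lt_zero.2 ha, hb, κ.isC1CausalOn_symm_line hab line_mem, by simp,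
    notMem _ ⟨le_rfl, hab.le⟩ norm_a, notMem _ ⟨hab.le, le_rfl⟩ norm_b⟩

end ConeChart

/-! ### Deforming a time function -/

/-- A local time for `T₀` at `p`: a smooth function `h` on a coordinate ball inside `U` which
increases along the causal cones, is negative at `p` and exceeds `T₀` by at least `δ` on the shell
`ρ ≤ ‖y‖ < ρ'`. It comes with a cutoff `θ` that is used to glue `h` to a time function. -/
structure LocalTime (τ : TimeOrientation g) (T₀ : M → ℝ) (p : M) (U : Set M)
    extends ConeChart τ p U where
  h : EuclideanSpace ℝ (Fin d) → ℝ
  δ : ℝ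
  ρ : ℝ
  ρ' : ℝ
  θ : ℝ → ℝ
  δ_pos : 0 < δ
  ρ_nonneg : 0 ≤ ρ
  ρ_lt : ρ < ρ'
  ρ'_lt : ρ' < R
  contDiff_h : ContDiff ℝ ∞ h
  h_neg : h (extChartAt (𝓡 d) p p) < 0
  fderiv_h_pos : ∀ q ∈ ball (extChartAt (𝓡 d) p p) ρ', ∀ v, v ≠ 0 → 0 ≤ F.f q v →
    0 < fderiv ℝ h q v
  add_le_h : ∀ q ∈ ball (extChartAt (𝓡 d) p p) ρ', ρ ≤ ‖q - extChartAt (𝓡 d) p p‖ →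
    T₀ ((extChartAt (𝓡 d) p).symm q) + δ ≤ h q
  isCutoff : IsCutoff δ θ

lemma exists_lipschitz_extChartAt_symm {T : M → ℝ} {p : M}
    (hT : ContMDiffAt (𝓡 d) 𝓘(ℝ, ℝ) 1 T p) :
    ∃ L : ℝ, ∃ V ∈ 𝓝 (extChartAt (𝓡 d) p p), ∀ x ∈ V, ∀ y ∈ V,
      |(T ∘ (extChartAt (𝓡 d) p).symm) x - (T ∘ (extChartAt (𝓡 d) p).symm) y| ≤ L * ‖x - y‖ := by
  have smooth : ContDiffAt ℝ 1 (T ∘ (extChartAt (𝓡 d) p).symm) (extChartAt (𝓡 d) p p) := by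
    rw [← contMDiffAt_iff_contDiffAt]
    refine ContMDiffAt.comp _ (by rwa [extChartAt_to_inv]) <|
      ((contMDiffOn_extChartAt_symm (n := ∞) p).of_le (by simp)).contMDiffAt
        (extChartAt_target_mem_nhds p)
  obtain ⟨L, V, hV, lipschitz⟩ := smooth.exists_lipschitzOnWith
  exact ⟨L, V, hV, fun x hx y hy ↦ by
    simpa only [dist_eq_norm, Real.norm_eq_abs] using lipschitz.dist_le_mul x hx y hy⟩

theorem exists_localTime {T₀ : M → ℝ} (hT : IsTimeFunction τ T₀) {p : M} (hp : T₀ p = 0)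
    {U : Set M} (hU : U ∈ 𝓝 p) : Nonempty (LocalTime τ T₀ p U) := by
  obtain ⟨L, V, hV, lipschitz⟩ := exists_lipschitz_extChartAt_symm hT.contMDiff.contMDiffAt
  obtain ⟨κ⟩ := exists_coneChart τ p
    (inter_mem hU ((continuousAt_extChartAt (I := 𝓡 d) p).preimage_mem_nhds hV))
  have ball_sub : ball (extChartAt (𝓡 d) p p) κ.R ⊆ V := fun y hy ↦ by
    simpa only [mem_preimage, κ.right_inv hy] using (κ.symm_mem y hy).2
  have R_pos := κ.R_pos
  obtain ⟨h, δ, hδ, h_smooth, h_neg, h_pos, h_le⟩ := κ.F.exists_local_time (r := κ.R / 2)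
    (by linarith) (by linarith) (κ.increasing hT)
    (fun x hx y hy ↦ lipschitz x (ball_sub hx) y (ball_sub hy)) (by simp [hp])
  obtain ⟨θ, hθ⟩ := exists_isCutoff δ
  exact ⟨{ κ with
    symm_mem := fun y hy ↦ (κ.symm_mem y hy).1
    h, δ, θ
    ρ := 5 * (κ.R / 2) / 8
    ρ' := 7 * (κ.R / 2) / 8
    δ_pos := hδ
    ρ_nonneg := by linarith
    ρ_lt := by linarith
    ρ'_lt := by linarith
    contDiff_h := h_smooth
    h_neg
    fderiv_h_pos := h_pos
    add_le_h := h_le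
    isCutoff := hθ }⟩

lemma subset_causalFuture (S : Set M) : S ⊆ causalFuture τ S := fun q hq ↦ ⟨q, hq, Or.inl rfl⟩

lemma subset_causalPast (S : Set M) : S ⊆ causalPast τ S := fun q hq ↦ ⟨q, hq, Or.inl rfl⟩

namespace IsTimeFunction

variable {T : M → ℝ} (hT : IsTimeFunction τ T)

include hT

lemma sub_const (c : ℝ) : IsTimeFunction τ (fun x ↦ T x - c) where
  contMDiff := hT.contMDiff.sub contMDiff_const
  strictMonoOn γ I hγ _ hx _ hy hxy := sub_lt_sub_right (hT.strictMonoOn γ I hγ hx hy hxy) c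

lemma le_of_mem_causalFuture {c : ℝ} {q : M} (hq : q ∈ causalFuture τ (T ⁻¹' {c})) : c ≤ T q := by
  obtain ⟨p, rfl : T p = c, rfl | ⟨γ, a, b, hab, hγ, rfl, rfl⟩⟩ := hq
  · exact le_rfl
  · exact (hT.strictMonoOn γ _ hγ ⟨le_rfl, hab.le⟩ ⟨hab.le, le_rfl⟩ hab).le

lemma le_of_mem_causalPast {c : ℝ} {q : M} (hq : q ∈ causalPast τ (T ⁻¹' {c})) : T q ≤ c := by
  obtain ⟨p, rfl : T p = c, rfl | ⟨γ, a, b, hab, hγ, rfl, rfl⟩⟩ := hq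
  · exact le_rfl
  · exact (hT.strictMonoOn γ _ hγ ⟨le_rfl, hab.le⟩ ⟨hab.le, le_rfl⟩ hab).le

end IsTimeFunction

/-- `T'` is a time function obtained from `T` by a change inside `U` that lowers its values and
loses no smoothness, such that the zero set of `T'` is a Cauchy evolution of the zero set of `T`. -/
structure IsForwardDeformation (τ : TimeOrientation g) (U : Set M) (T T' : M → ℝ) : Prop where
  isTimeFunction : IsTimeFunction τ T'
  contMDiff : ∀ k : ℕ∞, ContMDiff (𝓡 d) 𝓘(ℝ, ℝ) k T → ContMDiff (𝓡 d) 𝓘(ℝ, ℝ) k T'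
  le : ∀ x, T' x ≤ T x
  eqOn : EqOn T' T Uᶜ
  domain : domainOfDependence τ (T' ⁻¹' {0}) = domainOfDependence τ (T ⁻¹' {0})
  future : T' ⁻¹' {0} ⊆ causalFuture τ (T ⁻¹' {0})
  past : T ⁻¹' {0} ⊆ causalPast τ (T' ⁻¹' {0})

namespace IsForwardDeformation

variable {U : Set M} {T T' T'' : M → ℝ}

lemma refl (hT : IsTimeFunction τ T) (U : Set M) : IsForwardDeformation τ U T T :=
  ⟨hT, fun _ ↦ id, fun _ ↦ le_rfl, fun _ _ ↦ rfl, rfl, subset_causalFuture _, subset_causalPast _⟩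

lemma trans (h : IsForwardDeformation τ U T T') (h' : IsForwardDeformation τ U T' T'') :
    IsForwardDeformation τ U T T'' where
  isTimeFunction := h'.isTimeFunction
  contMDiff k hk := h'.contMDiff k (h.contMDiff k hk)
  le x := (h'.le x).trans (h.le x)
  eqOn := h'.eqOn.trans h.eqOn
  domain := h'.domain.trans h.domain
  future := h'.future.trans (causalFuture_subset_of_subset h.future)
  past := h.past.trans (causalPast_subset_of_subset h'.past)

lemma isForwardCauchyEvolution (h : IsForwardDeformation τ U T T') (hT : IsTimeFunction τ T) :
    IsForwardCauchyEvolution τ U (T ⁻¹' {0}) (T' ⁻¹' {0}) where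
  domain := h.domain
  future := h.future
  past := h.past
  differ x hx := by
    by_contra hxU
    rw [mem_symmDiff, mem_preimage, mem_preimage, h.eqOn hxU] at hx
    tauto
  between x hx := by
    by_contra hxU
    refine hx.2 (le_antisymm ?_ (hT.le_of_mem_causalFuture hx.1.1))
    exact (h.eqOn hxU).ge.trans (h.isTimeFunction.le_of_mem_causalPast hx.1.2)

end IsForwardDeformation

namespace LocalTime

variable {T₀ T : M → ℝ} {p : M} {U : Set M} (B : LocalTime τ T₀ p U)

/-- The coordinate ball on which the gluing takes place. -/
def dom : Set M := coordBall d p B.ρ'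

/-- The compact set outside which a time function bounded by `T₀` is unchanged by the gluing. -/
def core : Set M := coordClosedBall d p B.ρ

/-- The time function `T`, lowered where it comes close to or exceeds the local time `h`. -/
noncomputable def deform (T : M → ℝ) (x : M) : ℝ :=
  open Classical in
  if x ∈ B.dom then T x - B.θ (T x - B.h (extChartAt (𝓡 d) p x)) else T x

/-- The set where the local time `h` is negative; a time function that is at most zero there becomes
negative under the gluing. -/
def negSet : Set M := {x ∈ B.dom | B.h (extChartAt (𝓡 d) p x) < 0}

lemma isOpen_dom : IsOpen B.dom := isOpen_coordBall _ _

lemma core_subset_dom : B.core ⊆ B.dom := fun _ hx ↦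
  ((ConeChart.mem_coordClosedBall_iff B.ρ_lt B.ρ'_lt.le).1 hx).1

lemma core_subset : B.core ⊆ U := B.core_subset_dom.trans (B.coordBall_subset B.ρ'_lt.le)

lemma ρ_lt_R : B.ρ < B.R := B.ρ_lt.trans B.ρ'_lt

lemma isClosed_core [T2Space M] : IsClosed B.core :=
  (ConeChart.isCompact_coordClosedBall B.ρ_lt_R).isClosed

lemma negSet_mem_nhds : B.negSet ∈ 𝓝 p := by
  have h_continuousAt : ContinuousAt (fun x ↦ B.h (extChartAt (𝓡 d) p x)) p :=
    B.contDiff_h.continuous.continuousAt.comp (continuousAt_extChartAt p)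
  have dom_mem : B.dom ∈ 𝓝 p := B.isOpen_dom.mem_nhds
    ⟨mem_extChartAt_source p, mem_ball_self (B.ρ_nonneg.trans_lt B.ρ_lt)⟩
  exact inter_mem dom_mem (h_continuousAt.eventually (gt_mem_nhds B.h_neg))

lemma deform_of_mem {x : M} (hx : x ∈ B.dom) :
    B.deform T x = T x - B.θ (T x - B.h (extChartAt (𝓡 d) p x)) := if_pos hx

lemma deform_le (x : M) : B.deform T x ≤ T x := by
  by_cases hx : x ∈ B.dom
  · rw [B.deform_of_mem hx]
    exact sub_le_self _ (B.isCutoff.nonneg _)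
  · exact (if_neg hx).le

lemma deform_neg {x : M} (hx : x ∈ B.negSet) (hTx : T x ≤ 0) : B.deform T x < 0 := by
  rcases hTx.lt_or_eq with hTx | hTx
  · exact (B.deform_le x).trans_lt hTx
  · rw [B.deform_of_mem hx.1, hTx]
    linarith [B.isCutoff.pos (x := 0 - B.h (extChartAt (𝓡 d) p x)) (by linarith [B.δ_pos, hx.2])]

lemma deform_lt_deform {x y : M} (hx : x ∈ B.dom) (hy : y ∈ B.dom) (hT : T x < T y)
    (hh : B.h (extChartAt (𝓡 d) p x) < B.h (extChartAt (𝓡 d) p y)) :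
    B.deform T x < B.deform T y := by
  rw [B.deform_of_mem hx, B.deform_of_mem hy]
  exact B.isCutoff.sub_lt_sub hT hh

lemma strictMonoOn_deform_comp (hτ : IsTimeFunction τ T) {γ : ℝ → M} {J : Set ℝ}
    (hγ : IsCausalCurveOn τ γ J) (hm : MapsTo γ J B.dom) : StrictMonoOn (B.deform T ∘ γ) J :=
  fun _ hx _ hy hxy ↦ B.deform_lt_deform (hm hx) (hm hy) (hτ.strictMonoOn γ J hγ hx hy hxy)
    (B.strictMonoOn_of_fderiv_pos B.ρ'_lt.le (B.contDiff_h.differentiable (by simp))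
      B.fderiv_h_pos hγ hm hx hy hxy)

section

variable (hT : ∀ x, T x ≤ T₀ x)

include hT

lemma deform_eqOn : EqOn (B.deform T) T B.coreᶜ := by
  intro x hx
  by_cases hx' : x ∈ B.dom
  · have far : B.ρ ≤ ‖extChartAt (𝓡 d) p x - extChartAt (𝓡 d) p p‖ := by
      by_contra! near
      exact hx ((ConeChart.mem_coordClosedBall_iff B.ρ_lt B.ρ'_lt.le).2 ⟨hx', near.le⟩)
    have T₀_le := B.add_le_h _ hx'.2 far
    rw [(extChartAt (𝓡 d) p).left_inv hx'.1] at T₀_le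
    rw [B.deform_of_mem hx', B.isCutoff.eq_zero (by linarith [hT x]), sub_zero]
  · exact if_neg hx'

lemma mem_core_of_deform_ne {x : M} (h : B.deform T x ≠ T x) : x ∈ B.core := by
  by_contra hx
  exact h (B.deform_eqOn hT hx)

variable [T2Space M]

lemma contMDiff_deform {k : ℕ∞} (hk : ContMDiff (𝓡 d) 𝓘(ℝ, ℝ) k T) :
    ContMDiff (𝓡 d) 𝓘(ℝ, ℝ) k (B.deform T) := by
  intro x
  by_cases hx : x ∈ B.core
  · have hx' := B.core_subset_dom hx
    have chart_smooth : ContMDiffAt (𝓡 d) 𝓘(ℝ, EuclideanSpace ℝ (Fin d)) k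
        (extChartAt (𝓡 d) p) x :=
      (contMDiffAt_extChartAt' (n := ∞) (by simpa using hx'.1)).of_le (mod_cast le_top)
    have h_smooth : ContMDiffAt (𝓡 d) 𝓘(ℝ, ℝ) k (fun x ↦ B.h (extChartAt (𝓡 d) p x)) x :=
      (B.contDiff_h.of_le (mod_cast le_top)).contMDiff.contMDiffAt.comp x chart_smooth
    have glued_smooth : ContMDiffAt (𝓡 d) 𝓘(ℝ, ℝ) k
        (fun x ↦ T x - B.θ (T x - B.h (extChartAt (𝓡 d) p x))) x :=
      (hk x).sub ((B.isCutoff.contDiff.of_le (mod_cast le_top)).contMDiff.contMDiffAt.comp x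
        ((hk x).sub h_smooth))
    refine glued_smooth.congr_of_eventuallyEq ?_
    filter_upwards [B.isOpen_dom.mem_nhds hx'] with z hz using B.deform_of_mem hz
  · refine (hk x).congr_of_eventuallyEq ?_
    filter_upwards [B.isClosed_core.isOpen_compl.mem_nhds hx] with z hz using B.deform_eqOn hT hz

variable (hτ : IsTimeFunction τ T)

include hτ

lemma isTimeFunction_deform : IsTimeFunction τ (B.deform T) where
  contMDiff := B.contMDiff_deform hT hτ.contMDiff
  strictMonoOn γ I hγ := by
    refine strictMonoOn_comp_of_locally (fun x ↦ ?_) hγ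
    by_cases hx : x ∈ B.core
    · exact ⟨B.dom, B.isOpen_dom.mem_nhds (B.core_subset_dom hx), fun _ _ ↦
        B.strictMonoOn_deform_comp hτ⟩
    · exact ⟨B.coreᶜ, B.isClosed_core.isOpen_compl.mem_nhds hx, fun γ J hJ hm ↦
        (hτ.strictMonoOn γ J hJ).congr fun t ht ↦ (B.deform_eqOn hT (hm ht)).symm⟩

lemma level_subset_causalFuture : B.deform T ⁻¹' {0} ⊆ causalFuture τ (T ⁻¹' {0}) := by
  intro q (hq : B.deform T q = 0)
  rcases (hq.symm.trans_le (B.deform_le q)).eq_or_lt with hTq | hTq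
  · exact subset_causalFuture _ hTq.symm
  obtain ⟨γ, a, b, ha, hb, hγ, rfl, hγa, -⟩ :=
    ConeChart.exists_isC1CausalOn_notMem_coordClosedBall B.ρ_lt_R
      (B.mem_core_of_deform_ne hT (hq.trans_ne hTq.ne))
  have C1 := hγ.mono le_rfl ha hb.le
  have Ta_neg : T (γ a) < 0 := by
    rw [← B.deform_eqOn hT hγa, ← hq]
    exact (B.isTimeFunction_deform hT hτ).strictMonoOn _ _ C1.isCausalCurveOn
      ⟨le_rfl, ha.le⟩ ⟨ha.le, le_rfl⟩ ha
  obtain ⟨t, ht, hTt⟩ := intermediate_value_Ioo ha.le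
    (hτ.contMDiff.continuous.comp_continuousOn C1.1.continuousOn)
    (show (0 : ℝ) ∈ Ioo _ _ from ⟨Ta_neg, hTq⟩)
  exact ⟨γ t, hTt, Or.inr ⟨γ, t, 0, ht.2,
    (C1.mono ht.1.le ht.2 le_rfl).isCausalCurveOn, rfl, rfl⟩⟩

lemma level_subset_causalPast : T ⁻¹' {0} ⊆ causalPast τ (B.deform T ⁻¹' {0}) := by
  intro q (hq : T q = 0)
  rcases ((B.deform_le q).trans_eq hq).eq_or_lt with hdq | hdq
  · exact subset_causalPast _ hdq
  obtain ⟨γ, a, b, ha, hb, hγ, rfl, -, hγb⟩ :=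
    ConeChart.exists_isC1CausalOn_notMem_coordClosedBall B.ρ_lt_R
      (B.mem_core_of_deform_ne hT (hdq.trans_eq hq.symm).ne)
  have C1 := hγ.mono ha.le hb le_rfl
  have deform_b_pos : 0 < B.deform T (γ b) := by
    rw [B.deform_eqOn hT hγb, ← hq]
    exact hτ.strictMonoOn _ _ C1.isCausalCurveOn ⟨le_rfl, hb.le⟩ ⟨hb.le, le_rfl⟩ hb
  obtain ⟨t, ht, hdt⟩ := intermediate_value_Ioo hb.le
    ((B.isTimeFunction_deform hT hτ).contMDiff.continuous.comp_continuousOn C1.1.continuousOn)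
    (show (0 : ℝ) ∈ Ioo _ _ from ⟨hdq, deform_b_pos⟩)
  exact ⟨γ t, hdt, Or.inr ⟨γ, 0, t, ht.1,
    (C1.mono le_rfl ht.1 ht.2.le).isCausalCurveOn, rfl, rfl⟩⟩

lemma inter_level_nonempty_iff {γ : ℝ → M} {I : Set ℝ} (hγ : IsInextendibleCausalCurve τ γ I) :
    (γ '' I ∩ B.deform T ⁻¹' {0}).Nonempty ↔ (γ '' I ∩ T ⁻¹' {0}).Nonempty := by
  have hd := B.isTimeFunction_deform hT hτ
  have γ_cont := hγ.1.continuousOn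
  constructor
  · rintro ⟨_, ⟨t₀, ht₀, rfl⟩, (h0 : B.deform T (γ t₀) = 0)⟩
    obtain ⟨t, ht, htt, notMem⟩ := ConeChart.exists_le_notMem_coordClosedBall B.ρ_lt_R hγ ht₀
    have sub := hγ.1.ordConnected.out ht ht₀
    have T_le : T (γ t) ≤ 0 := by
      rw [← B.deform_eqOn hT notMem, ← h0]
      exact (hd.strictMonoOn γ I hγ.1).monotoneOn ht ht₀ htt
    obtain ⟨s, hs, hTs⟩ := intermediate_value_Icc htt
      (hτ.contMDiff.continuous.comp_continuousOn (γ_cont.mono sub))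
      (show (0 : ℝ) ∈ Icc _ _ from ⟨T_le, h0.symm.trans_le (B.deform_le _)⟩)
    exact ⟨γ s, mem_image_of_mem γ (sub hs), hTs⟩
  · rintro ⟨_, ⟨t₀, ht₀, rfl⟩, (h0 : T (γ t₀) = 0)⟩
    obtain ⟨t, ht, htt, notMem⟩ := ConeChart.exists_ge_notMem_coordClosedBall B.ρ_lt_R hγ ht₀
    have sub := hγ.1.ordConnected.out ht₀ ht
    have deform_nonneg : 0 ≤ B.deform T (γ t) := by
      rw [B.deform_eqOn hT notMem, ← h0]
      exact (hτ.strictMonoOn γ I hγ.1).monotoneOn ht₀ ht htt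
    obtain ⟨s, hs, hds⟩ := intermediate_value_Icc htt
      (hd.contMDiff.continuous.comp_continuousOn (γ_cont.mono sub))
      (show (0 : ℝ) ∈ Icc _ _ from ⟨(B.deform_le _).trans_eq h0, deform_nonneg⟩)
    exact ⟨γ s, mem_image_of_mem γ (sub hs), hds⟩

lemma isForwardDeformation_deform : IsForwardDeformation τ U T (B.deform T) where
  isTimeFunction := B.isTimeFunction_deform hT hτ
  contMDiff _ := B.contMDiff_deform hT
  le := B.deform_le
  eqOn := (B.deform_eqOn hT).mono (compl_subset_compl.2 B.core_subset)
  domain := by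
    ext x
    exact forall₃_congr fun γ I hγ ↦ imp_congr_right fun _ ↦ B.inter_level_nonempty_iff hT hτ hγ
  future := B.level_subset_causalFuture hT hτ
  past := B.level_subset_causalPast hT hτ

end

end LocalTime

lemma exists_isForwardDeformation_neg [T2Space M] {T₀ : M → ℝ} (hT₀ : IsTimeFunction τ T₀)
    {U : Set M} {ι : Type*} {c : ι → M} (B : ∀ i, LocalTime τ T₀ (c i) U) (s : Finset ι) :
    ∃ T, IsForwardDeformation τ U T₀ T ∧ ∀ i ∈ s, ∀ x ∈ (B i).negSet, T₀ x ≤ 0 → T x < 0 := by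
  classical
  induction s using Finset.induction_on with
  | empty => exact ⟨T₀, .refl hT₀ U, by simp⟩
  | insert i s _ ih =>
    obtain ⟨T, hT, neg⟩ := ih
    refine ⟨(B i).deform T, hT.trans ((B i).isForwardDeformation_deform hT.le hT.isTimeFunction),
      fun j hj x hx hx0 ↦ ?_⟩
    rcases Finset.mem_insert.1 hj with rfl | hj
    · exact (B j).deform_neg hx ((hT.le x).trans hx0)
    · exact ((B i).deform_le x).trans_lt (neg j hj x hx hx0)

lemma exists_isForwardDeformation_neg_of_isCompact [T2Space M] {T₀ : M → ℝ}
    (hT₀ : IsTimeFunction τ T₀) {K U : Set M} (hK : IsCompact K) (hK₀ : K ⊆ T₀ ⁻¹' {0})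
    (hU : U ∈ 𝓝ˢ K) : ∃ T, IsForwardDeformation τ U T₀ T ∧ ∀ x ∈ K, T x < 0 := by
  have B (p : K) : LocalTime τ T₀ p U :=
    (exists_localTime hT₀ (hK₀ p.2) (mem_nhdsSet_iff_forall.1 hU p p.2)).some
  obtain ⟨s, cover⟩ := hK.elim_nhds_subcover' (fun p hp ↦ (B ⟨p, hp⟩).negSet)
    fun p hp ↦ (B ⟨p, hp⟩).negSet_mem_nhds
  obtain ⟨T, hT, neg⟩ := exists_isForwardDeformation_neg hT₀ B s
  refine ⟨T, hT, fun x hx ↦ ?_⟩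
  obtain ⟨i, hi, hxi⟩ := mem_iUnion₂.1 (cover hx)
  exact neg i hi x hxi (hK₀ hx).le

end Spacetime

theorem mainTheorem2_general {d : ℕ} {M : Type*} [TopologicalSpace M]
    [ChartedSpace (EuclideanSpace ℝ (Fin d)) M] [IsManifold (𝓡 d) ∞ M] [T2Space M]
    (g : Spacetime.LorentzianMetric d M) (τ : Spacetime.TimeOrientation g)
    (k : ℕ∞) (S : Set M) (hS : Spacetime.IsTimeslice τ k S)
    (X : Set M) (hX : IsCompact X) (U : Set M) (hU : IsOpen U) (hXU : X ∩ S ⊆ U) :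
    ∃ S' : Set M, Spacetime.IsTimeslice τ k S' ∧
      Spacetime.IsForwardCauchyEvolution τ U S S' ∧ S' ∩ S ∩ X = ∅ := by
  obtain ⟨T, c, hT, T_smooth, rfl⟩ := hS
  have isCompact : IsCompact (X ∩ T ⁻¹' {c}) :=
    hX.inter_right (isClosed_singleton.preimage hT.contMDiff.continuous)
  have level : T ⁻¹' {c} = (fun x ↦ T x - c) ⁻¹' {0} := by ext x; simp [sub_eq_zero]
  rw [level] at isCompact hXU ⊢
  obtain ⟨T', hT', neg⟩ := Spacetime.exists_isForwardDeformation_neg_of_isCompact (hT.sub_const c)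
    isCompact inter_subset_right (hU.mem_nhdsSet.2 hXU)
  refine ⟨T' ⁻¹' {0}, ⟨T', 0, hT'.isTimeFunction,
    hT'.contMDiff k (T_smooth.sub contMDiff_const), rfl⟩,
    hT'.isForwardCauchyEvolution (hT.sub_const c), ?_⟩
  exact eq_empty_of_forall_notMem fun x hx ↦ (neg x ⟨hx.2, hx.1.2⟩).ne hx.1.1

theorem mainTheorem2 {d : ℕ} {M : Type*} [TopologicalSpace M]
    [ChartedSpace (EuclideanSpace ℝ (Fin d)) M] [IsManifold (𝓡 d) ∞ M]
    [T2Space M] [SecondCountableTopology M]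
    (g : Spacetime.LorentzianMetric d M) (τ : Spacetime.TimeOrientation g)
    (k : ℕ∞) (hk : 1 ≤ k) (S : Set M) (hS : Spacetime.IsTimeslice τ k S)
    (X : Set M) (hXS : X ⊆ S) (hX : IsCompact X) (U : Set M) (hU : IsOpen U) (hXU : X ⊆ U) :
    ∃ S' : Set M, Spacetime.IsTimeslice τ k S' ∧
      Spacetime.IsForwardCauchyEvolution τ U S S' ∧ S' ∩ S ∩ X = ∅ :=
  mainTheorem2_general g τ k S hS X hX U hU (inter_subset_left.trans hXU)
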